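/- **Setting.** Let $k\ge 2$, let $d_1,\dots,d_k\ge 1$ be integers, $d=d_1+\cdots+d_k$, $s\ge 0$, and $M_1,\dots,M_k\in\mathbb R$. For $\nu>0$ write $G_\nu(x,y)=\exp(-\nu\|x-y\|^2)$ for the Gaussian kernel, where $\|\cdot\|$ is the Euclidean norm (of $\mathbb R^{d}$ or of $\mathbb R^{d_l}$, according to the arguments). For a density $f$ on $\mathbb R^m$ let $\mathcal F f(\omega)=(2\pi)^{-m/2}\int f(x)e^{-i\langle x,\omega\rangle}\,dx$ and $\|f\|_{\mathcal W^{s,2}}=\big(\int(1+\|\omega\|^2)^s|\mathcal F f(\omega)|^2\,d\omega\big)^{1/2}\in[0,\infty]$, and let $\mathcal W^{s,2}(M)$ consist of those $f$ that are continuous almost everywhere and satisfy $\|f\|_{\mathcal W^{s,2}}\le M$. Let $X_1,X_2,\dots$ be i.i.d. copies of a random vector $X=(X^1,\dots,X^k)\in\mathbb R^{d_1}\times\cdots\times\mathbb R^{d_k}=\mathbb R^d$ with law $\mathbb P$. The null hypothesis $H_0^{\rm IND}$ states that $\mathbb P$ is the product of its marginals, $\mathbb P=\mathbb P^{X^1}\otimes\cdots\otimes\mathbb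 P^{X^k}$, and that each marginal $\mathbb P^{X^j}$ has a Lebesgue density $p_j\in\mathcal W^{s,2}(M_j)$. **The statistic.** For $n\ge \max\{2k,4\}$ put $$\begin{aligned}\widehat{\gamma_\nu^2}={}&\frac1{n(n-1)}\sum_{1\le i\ne j\le n}G_\nu(X_i,X_j)\\&+\frac{(n-2k)!}{n!}\sum_{i_1,\dots,i_k,j_1,\dots,j_k\ \text{distinct}}G_\nu\big((X^1_{i_1},\dots,X^k_{i_k}),(X^1_{j_1},\dots,X^k_{j_k})\big)\\&-\frac{2(n-k-1)!}{n!}\sum_{i,j_1,\dots,j_k\ \text{distinct}}G_\nu\big(X_i,(X^1_{j_1},\dots,X^k_{j_k})\big),\end{aligned}$$ and, for $1\le l\le k$, $$\begin{aligned}a_l&=\frac1{n(n-1)}\sum_{i\ne j}G_{2\nu}(X_i^l,X_j^l),\qquad b_l=\frac{(n-3)!}{n!}\sum_{i,j_1,j_2\ \text{distinct}}G_\nu(X_i^l,X_{j_1}^l)G_\nu(X_i^l,X_{j_2}^l),\\ c_l&=\frac{(n-4)!}{n!}\sum_{i_1,i_2,j_1,j_2\ \text{distinct}}G_\nu(X_{i_1}^l,X_{j_1}^l)G_\nu(X_{i_2}^l,X_{j_2}^l),\end{aligned}$$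 all indices running over $\{1,\dots,n\}$. Let $$\begin{aligned}\tilde s^2_{n,\nu}={}&\prod_l a_l-2\prod_l b_l+\prod_l c_l-2\sum_{j=1}^k\Big(a_j\prod_{l\ne j}b_l-\prod_l b_l-b_j\prod_{l\ne j}c_l+\prod_l c_l\Big)\\&+\sum_{j=1}^k(a_j-2b_j+c_j)\prod_{l\ne j}c_l+\sum_{j_1\ne j_2}(b_{j_1}-c_{j_1})(b_{j_2}-c_{j_2})\prod_{l\ne j_1,j_2}c_l\end{aligned}$$ (for $k=2$ this equals $\prod_{l=1}^2(a_l-2b_l+c_l)$), $\widehat s^2_{n,\nu}=\max\{\tilde s^2_{n,\nu},1/n^2\}$, and $$T^{\rm IND}_{n,\nu}=\frac{n}{\sqrt2}\,\widehat s_{n,\nu}^{-1}\,\widehat{\gamma_\nu^2}.$$ **Theorem.** Let $\nu_n\to\infty$ as $n\to\infty$ with $\nu_n=o(n^{4/d})$. Then under $H_0^{\rm IND}$, with $\mathbb P$ fixed, $T^{\rm IND}_{n,\nu_n}\to_d N(0,1)$ as $n\to\infty$. -/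

import Mathlib

open MeasureTheory ProbabilityTheory Filter Topology Asymptotics
open scoped Nat ENNReal

namespace GaussianDHSIC

noncomputable section

/-! ### Sobolev classes of densities -/

/-- The Fourier transform `(2π)^{-m/2} ∫ f(x) exp(-i ⟨x, ω⟩) dx` of an integrable real function
on `ℝ^m`. -/
def fourierTransform {m : ℕ} (f : EuclideanSpace ℝ (Fin m) → ℝ)
    (w : EuclideanSpace ℝ (Fin m)) : ℂ :=
  (((2 * Real.pi) ^ (-((m : ℝ) / 2)) : ℝ) : ℂ) *
    ∫ x, (f x : ℂ) * Complex.exp (-Complex.I * ((inner ℝ x w : ℝ) : ℂ))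

/-- The Sobolev norm `(∫ (1 + ‖ω‖²)^s |F f(ω)|² dω)^{1/2}`, with values in `[0, ∞]`. -/
def sobolevNorm {m : ℕ} (s : ℝ) (f : EuclideanSpace ℝ (Fin m) → ℝ) : ℝ≥0∞ :=
  (∫⁻ w, ENNReal.ofReal ((1 + ‖w‖ ^ 2) ^ s * ‖fourierTransform f w‖ ^ 2)) ^ (1 / 2 : ℝ)

/-- `f` lies in the ball of radius `M` of the Sobolev space of order `s`: it is integrable (so that
its Fourier transform is given by the integral above; automatic for a density), continuous at
almost every point, and its Sobolev norm is at most `M`. -/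
structure MemSobolevBall {m : ℕ} (s M : ℝ) (f : EuclideanSpace ℝ (Fin m) → ℝ) : Prop where
  integrable : Integrable f
  ae_continuousAt : ∀ᵐ x, ContinuousAt f x
  norm_le : sobolevNorm s f ≤ ENNReal.ofReal M

/-- `f` is a density of `Q` with respect to Lebesgue measure on `ℝ^m`. -/
structure IsDensity {m : ℕ} (Q : Measure (EuclideanSpace ℝ (Fin m)))
    (f : EuclideanSpace ℝ (Fin m) → ℝ) : Prop where
  aemeasurable : AEMeasurable f
  nonneg : ∀ x, 0 ≤ f x
  eq_withDensity : Q = volume.withDensity (fun x => ENNReal.ofReal (f x))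

/-! ### Observations and the null hypothesis -/

/-- `ℝ^{d_1} × ⋯ × ℝ^{d_k}`, the space of values of `X = (X^1, …, X^k)`. -/
abbrev Obs {k : ℕ} (d : Fin k → ℕ) : Type := (j : Fin k) → EuclideanSpace ℝ (Fin (d j))

/-- The `j`-th marginal of a distribution on `ℝ^{d_1} × ⋯ × ℝ^{d_k}`. -/
def marginal {k : ℕ} {d : Fin k → ℕ} (P : Measure (Obs d)) (j : Fin k) :
    Measure (EuclideanSpace ℝ (Fin (d j))) :=
  P.map (fun x => x j)

/-- The null hypothesis of joint independence: `P` is the product of its marginals, and each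
marginal has a density in the Sobolev ball of order `s` and radius `M j`. -/
structure NullHypothesis {k : ℕ} {d : Fin k → ℕ} (s : ℝ) (M : Fin k → ℝ)
    (P : Measure (Obs d)) : Prop where
  eq_pi : P = Measure.pi (fun j => marginal P j)
  exists_density : ∀ j, ∃ p : EuclideanSpace ℝ (Fin (d j)) → ℝ,
    IsDensity (marginal P j) p ∧ MemSobolevBall s (M j) p

/-! ### Gaussian kernels and U-statistics -/

/-- The Gaussian kernel `exp(-ν ‖x - y‖²)`. -/
def gauss {E : Type*} [NormedAddCommGroup E] (ν : ℝ) (x y : E) : ℝ :=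
  Real.exp (-ν * ‖x - y‖ ^ 2)

/-- The Gaussian kernel on `ℝ^d = ℝ^{d_1} × ⋯ × ℝ^{d_k}`, with the Euclidean norm of `ℝ^d`. -/
def gaussJoint {k : ℕ} {d : Fin k → ℕ} (ν : ℝ) (x y : Obs d) : ℝ :=
  gauss ν (WithLp.toLp 2 x) (WithLp.toLp 2 y)

/-- `(n - m)! / n!` times the sum of `f` over all families of `m = |ι|` pairwise distinct indices
in a sample of size `n` (meaningful for `n ≥ m`). -/
def uStat {ι : Type} [Fintype ι] [DecidableEq ι] (n : ℕ) (f : (ι → Fin n) → ℝ) : ℝ :=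
  (((n - Fintype.card ι)! : ℝ) / (n ! : ℝ)) * ∑ i : ι ↪ Fin n, f i

/-- The unbiased estimate of the squared maximum mean discrepancy between the joint distribution and
the product of the marginals. The index `Sum.inl j` stands for `i_j` and `Sum.inr j` for `j_j` in
the second term; `none` stands for `i` and `some j` for `j_j` in the third. -/
def gammaSqHat {k n : ℕ} {d : Fin k → ℕ} (ν : ℝ) (x : Fin n → Obs d) : ℝ :=
  uStat n (fun i : Fin 2 → Fin n => gaussJoint ν (x (i 0)) (x (i 1)))
  + uStat n (fun i : Fin k ⊕ Fin k → Fin n =>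
      gaussJoint ν (fun j => x (i (Sum.inl j)) j) (fun j => x (i (Sum.inr j)) j))
  - 2 * uStat n (fun i : Option (Fin k) → Fin n =>
      gaussJoint ν (x (i none)) (fun j => x (i (some j)) j))

/-- The U-statistic estimating `E G_{2ν}(X_1^l, X_2^l)`. -/
def aHat {k n : ℕ} {d : Fin k → ℕ} (ν : ℝ) (x : Fin n → Obs d) (l : Fin k) : ℝ :=
  uStat n (fun i : Fin 2 → Fin n => gauss (2 * ν) (x (i 0) l) (x (i 1) l))

/-- The U-statistic estimating `E G_ν(X_1^l, X_2^l) G_ν(X_1^l, X_3^l)`. -/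
def bHat {k n : ℕ} {d : Fin k → ℕ} (ν : ℝ) (x : Fin n → Obs d) (l : Fin k) : ℝ :=
  uStat n (fun i : Fin 3 → Fin n =>
    gauss ν (x (i 0) l) (x (i 1) l) * gauss ν (x (i 0) l) (x (i 2) l))

/-- The U-statistic estimating `(E G_ν(X_1^l, X_2^l))²`. -/
def cHat {k n : ℕ} {d : Fin k → ℕ} (ν : ℝ) (x : Fin n → Obs d) (l : Fin k) : ℝ :=
  uStat n (fun i : Fin 4 → Fin n =>
    gauss ν (x (i 0) l) (x (i 1) l) * gauss ν (x (i 2) l) (x (i 3) l))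

/-- The expression of the variance functional
`E Ḡ² - 2 ∑_j E g_j² + ∑_{j₁,j₂} E g_{j₁,j₂}²` (under independence) through
`a l = E G_{2ν}(X_1^l, X_2^l)`, `b l = E G_ν(X_1^l, X_2^l) G_ν(X_1^l, X_3^l)` and
`c l = (E G_ν(X_1^l, X_2^l))²`. -/
def varianceFormula {k : ℕ} (a b c : Fin k → ℝ) : ℝ :=
  (∏ l, a l - 2 * ∏ l, b l + ∏ l, c l)
  - 2 * ∑ j, (a j * ∏ l ∈ Finset.univ.erase j, b l - ∏ l, b l
      - b j * ∏ l ∈ Finset.univ.erase j, c l + ∏ l, c l)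
  + ∑ j₁, ∑ j₂,
      if j₁ = j₂ then
        (a j₁ - 2 * b j₁ + c j₁) * ∏ l ∈ Finset.univ.erase j₁, c l
      else
        (b j₁ - c j₁) * (b j₂ - c j₂) * ∏ l ∈ (Finset.univ.erase j₁).erase j₂, c l

/-- For `k = 2` the variance formula is the product of the two marginal ones. -/
theorem varianceFormula_two (a b c : Fin 2 → ℝ) :
    varianceFormula a b c = ∏ l, (a l - 2 * b l + c l) := by
  have h0 : (Finset.univ : Finset (Fin 2)).erase 0 = {1} := by decide
  have h1 : (Finset.univ : Finset (Fin 2)).erase 1 = {0} := by decide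
  simp [varianceFormula, Fin.sum_univ_two, Fin.prod_univ_two, h0, h1]
  ring

/-- The estimate of the variance functional before truncation. -/
def sTildeSq {k n : ℕ} {d : Fin k → ℕ} (ν : ℝ) (x : Fin n → Obs d) : ℝ :=
  varianceFormula (aHat ν x) (bHat ν x) (cHat ν x)

/-- The truncated estimate `max {s̃², 1/n²}`. -/
def sHatSq {k n : ℕ} {d : Fin k → ℕ} (ν : ℝ) (x : Fin n → Obs d) : ℝ :=
  max (sTildeSq ν x) (1 / (n : ℝ) ^ 2)

/-- The studentized Gaussian dHSIC statistic `T = (n / √2) ŝ⁻¹ γ̂²`. -/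
def tStat {k n : ℕ} {d : Fin k → ℕ} (ν : ℝ) (x : Fin n → Obs d) : ℝ :=
  (n : ℝ) / Real.sqrt 2 * (Real.sqrt (sHatSq ν x))⁻¹ * gammaSqHat ν x

end

end GaussianDHSIC

/-! Under the null hypothesis the law P is the product of marginals `Q l`, and the Gaussian kernel G
on ℝ^d is the product of the Gaussian kernels on the components. Centring G at the mean embedding of
P gives a degenerate kernel H, and replacing G by H leaves the statistic unchanged, because all mean
embeddings cancel (`uStat_sub_eq_centered`). Of the three U-statistics in H, the first is a
degenerate U-statistic of order two and produces the limit; the other two are negligible.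

Scales. For each component let a = ∫∫G², g = ∫∫G, let m bound ∫G(x,y)dQ(y) uniformly in x, and let A
be the product of the a's. A Sobolev density of order s ≥ 0 has a square integrable characteristic
function, so Fourier analysis shows that a and g are of exact order ν^{-d_l/2}, while m can be taken
to be o(ν^{-d_l/4}) (`exists_gauss_moment_bounds`). Hence g ≤ Ca and m²/a → 0, and the assumption ν
= o(n^{4/d}) says precisely enough for n²A → ∞. Everything after this uses only these facts,
collected in `IsAdmissible`.

Main term. The sum of H over pairs i < j is a martingale in the number of observations. Given the
first j observations, the next increment is centred, with a conditional variance that concentrates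
around j∫∫H². Each step therefore multiplies the characteristic function by nearly exp(-u² j ∫∫H² /
2). Adding up the errors (`pairCharFun_succ_sub_le`, `norm_pairCharFun_sub_le`) gives a central
limit theorem under three moment ratio conditions, which follow from |H| ≤ 2 and the scales above.

Remainders. In the second moment of either remaining U-statistic, two terms sharing at most one
index are orthogonal by degeneracy. Since k ≥ 2, each term involves at least three indices; so if
exactly two are shared, then in some component the two kernels sit at different pairs, which gains a
factor m g / a → 0. Sharing three indices has frequency O(n^{-3}). Thus the second moment is o(A/n²)
(`integral_uStat_centered_sq_le`).

Studentisation. The estimates of the marginal moments, divided by a, converge in probability to (1,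
0, 0). The variance formula is homogeneous in each component and equals 1 at that point, so the
variance estimate divided by A tends to 1. Since ∫∫H² ~ A as well, Slutsky's theorem concludes
(`tendstoInDistribution_studentStat`). -/

namespace GaussianDHSIC

set_option linter.unusedSectionVars false

/-! ### Bounded measurable functions -/

/-- Bounded measurable real functions. -/
structure IsBddMeas {α : Type*} [MeasurableSpace α] (f : α → ℝ) : Prop where
  measurable : Measurable f
  bdd : ∃ C, ∀ x, |f x| ≤ C

namespace IsBddMeas

variable {α β : Type*} [MeasurableSpace α] [MeasurableSpace β] {f g : α → ℝ}

lemma const (c : ℝ) : IsBddMeas (fun _ : α => c) := ⟨measurable_const, |c|, fun _ => le_rfl⟩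

lemma add (hf : IsBddMeas f) (hg : IsBddMeas g) : IsBddMeas (fun x => f x + g x) := by
  obtain ⟨C, hC⟩ := hf.bdd
  obtain ⟨D, hD⟩ := hg.bdd
  exact ⟨hf.measurable.add hg.measurable, C + D,
    fun x => (abs_add_le _ _).trans (add_le_add (hC x) (hD x))⟩

lemma neg (hf : IsBddMeas f) : IsBddMeas (fun x => -f x) := by
  obtain ⟨C, hC⟩ := hf.bdd
  exact ⟨hf.measurable.neg, C, fun x => by simpa using hC x⟩

lemma sub (hf : IsBddMeas f) (hg : IsBddMeas g) : IsBddMeas (fun x => f x - g x) := by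
  simpa [sub_eq_add_neg] using hf.add hg.neg

lemma mul (hf : IsBddMeas f) (hg : IsBddMeas g) : IsBddMeas (fun x => f x * g x) := by
  obtain ⟨C, hC⟩ := hf.bdd
  obtain ⟨D, hD⟩ := hg.bdd
  refine ⟨hf.measurable.mul hg.measurable, C * D, fun x => ?_⟩
  rw [abs_mul]
  exact mul_le_mul (hC x) (hD x) (abs_nonneg _) ((abs_nonneg _).trans (hC x))

lemma const_mul (c : ℝ) (hf : IsBddMeas f) : IsBddMeas (fun x => c * f x) := (const c).mul hf

lemma abs (hf : IsBddMeas f) : IsBddMeas (fun x => |f x|) := by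
  obtain ⟨C, hC⟩ := hf.bdd
  exact ⟨hf.measurable.abs, C, fun x => by simpa using hC x⟩

lemma pow (hf : IsBddMeas f) (n : ℕ) : IsBddMeas (fun x => f x ^ n) := by
  obtain ⟨C, hC⟩ := hf.bdd
  refine ⟨hf.measurable.pow_const n, C ^ n, fun x => ?_⟩
  rw [abs_pow]
  exact pow_le_pow_left₀ (abs_nonneg _) (hC x) n

lemma sum {ι : Type*} (s : Finset ι) {f : ι → α → ℝ} (hf : ∀ i ∈ s, IsBddMeas (f i)) :
    IsBddMeas (fun x => ∑ i ∈ s, f i x) := by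
  classical
  induction s using Finset.induction_on with
  | empty => simpa using const (α := α) 0
  | insert a s ha ih =>
    simp only [Finset.sum_insert ha]
    exact (hf a (by simp)).add (ih fun i hi => hf i (by simp [hi]))

lemma comp (hf : IsBddMeas f) {u : β → α} (hu : Measurable u) : IsBddMeas (fun y => f (u y)) := by
  obtain ⟨C, hC⟩ := hf.bdd
  exact ⟨hf.measurable.comp hu, C, fun x => hC _⟩

lemma integrable (hf : IsBddMeas f) (μ : Measure α) [IsFiniteMeasure μ] : Integrable f μ := by
  obtain ⟨C, hC⟩ := hf.bdd
  exact Integrable.of_bound hf.measurable.aestronglyMeasurable C (ae_of_all _ hC)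

lemma integral {f : α → β → ℝ} (hf : IsBddMeas (fun p : α × β => f p.1 p.2)) (P : Measure β)
    [IsProbabilityMeasure P] : IsBddMeas (fun x => ∫ y, f x y ∂P) := by
  obtain ⟨C, hC⟩ := hf.bdd
  refine ⟨(hf.measurable.stronglyMeasurable.integral_prod_right' (ν := P)).measurable, C,
    fun x => ?_⟩
  have h : ∀ y, ‖f x y‖ ≤ C := fun y => hC (x, y)
  simpa using norm_integral_le_of_norm_le_const (μ := P) (ae_of_all _ h)

lemma integral_swap {f : α → β → ℝ} (hf : IsBddMeas (fun p : α × β => f p.1 p.2))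
    (μ : Measure α) [IsProbabilityMeasure μ] (P : Measure β) [IsProbabilityMeasure P] :
    ∫ x, ∫ y, f x y ∂P ∂μ = ∫ y, ∫ x, f x y ∂μ ∂P :=
  integral_integral_swap (hf.integrable (μ.prod P))

lemma integral_add (hf : IsBddMeas f) (hg : IsBddMeas g) (μ : Measure α) [IsFiniteMeasure μ] :
    ∫ x, (f x + g x) ∂μ = ∫ x, f x ∂μ + ∫ x, g x ∂μ :=
  MeasureTheory.integral_add (hf.integrable μ) (hg.integrable μ)

lemma integral_sub (hf : IsBddMeas f) (hg : IsBddMeas g) (μ : Measure α) [IsFiniteMeasure μ] :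
    ∫ x, (f x - g x) ∂μ = ∫ x, f x ∂μ - ∫ x, g x ∂μ :=
  MeasureTheory.integral_sub (hf.integrable μ) (hg.integrable μ)

lemma integral_mono (hf : IsBddMeas f) (hg : IsBddMeas g) (μ : Measure α) [IsFiniteMeasure μ]
    (h : ∀ x, f x ≤ g x) : ∫ x, f x ∂μ ≤ ∫ x, g x ∂μ :=
  MeasureTheory.integral_mono (hf.integrable μ) (hg.integrable μ) h

lemma left {f : α → β → ℝ} (hf : IsBddMeas (fun p : α × β => f p.1 p.2)) (x : α) :
    IsBddMeas (f x) := hf.comp measurable_prodMk_left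

lemma right {f : α → β → ℝ} (hf : IsBddMeas (fun p : α × β => f p.1 p.2)) (y : β) :
    IsBddMeas (fun x => f x y) := hf.comp measurable_prodMk_right

end IsBddMeas

/-- The square of a mean is at most the mean of the square. -/
lemma sq_integral_le {α : Type*} [MeasurableSpace α] {f : α → ℝ} (hf : IsBddMeas f)
    (P : Measure α) [IsProbabilityMeasure P] : (∫ x, f x ∂P) ^ 2 ≤ ∫ x, f x ^ 2 ∂P := by
  have h : 0 ≤ ∫ x, (f x - ∫ y, f y ∂P) ^ 2 ∂P := integral_nonneg fun x => sq_nonneg _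
  have h2 : ∫ x, (f x - ∫ y, f y ∂P) ^ 2 ∂P
      = ∫ x, f x ^ 2 ∂P - 2 * (∫ y, f y ∂P) * (∫ x, f x ∂P) + (∫ y, f y ∂P) ^ 2 := by
    have e : ∀ x, (f x - ∫ y, f y ∂P) ^ 2
      = f x ^ 2 - 2 * (∫ y, f y ∂P) * f x + (∫ y, f y ∂P) ^ 2 := fun x => by ring
    simp_rw [e]
    rw [((hf.pow 2).sub (hf.const_mul _)).integral_add (IsBddMeas.const _),
      (hf.pow 2).integral_sub (hf.const_mul _), integral_const_mul]
    simp
  rw [h2] at h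
  nlinarith

/-! ### Integration with respect to independent variables -/

/-- Freezing one of two independent variables. -/
lemma integral_comp_of_indepFun {Ω α β G : Type*} [MeasurableSpace Ω] [MeasurableSpace α]
    [MeasurableSpace β] [NormedAddCommGroup G] [NormedSpace ℝ G] {μ : Measure Ω}
    [IsProbabilityMeasure μ] {Y : Ω → α} {Z : Ω → β} (hYZ : IndepFun Y Z μ) (hY : Measurable Y)
    (hZ : Measurable Z) {F : α × β → G} (hF : StronglyMeasurable F) {C : ℝ}
    (hC : ∀ p, ‖F p‖ ≤ C) :
    ∫ ω, F (Y ω, Z ω) ∂μ = ∫ ω, ∫ z, F (Y ω, z) ∂(μ.map Z) ∂μ := by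
  have := Measure.isProbabilityMeasure_map (μ := μ) hY.aemeasurable
  have := Measure.isProbabilityMeasure_map (μ := μ) hZ.aemeasurable
  have h1 : ∫ ω, F (Y ω, Z ω) ∂μ = ∫ p, F p ∂(μ.map fun ω => (Y ω, Z ω)) :=
    (integral_map (hY.prodMk hZ).aemeasurable hF.aestronglyMeasurable).symm
  rw [h1, (indepFun_iff_map_prod_eq_prod_map_map hY.aemeasurable hZ.aemeasurable).1 hYZ,
    integral_prod _ (Integrable.of_bound hF.aestronglyMeasurable C (ae_of_all _ hC)),
    integral_map hY.aemeasurable hF.integral_prod_right'.aestronglyMeasurable]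

/-! ### Sums over prefixes of an i.i.d. sequence -/

section Prefix

variable {Ω E : Type*} [MeasurableSpace Ω] [MeasurableSpace E] {μ : Measure Ω}
  [IsProbabilityMeasure μ] {P : Measure E} [IsProbabilityMeasure P] {X : ℕ → Ω → E}

/-- The expectation of a function of `X_0, …, X_j` that is a function of the first `j` variables
and the last one. -/
lemma integral_prefix (hX : ∀ i, Measurable (X i)) (hindep : iIndepFun X μ)
    (hlaw : ∀ i, μ.map (X i) = P) {G : Type*} [NormedAddCommGroup G] [NormedSpace ℝ G] (j : ℕ)
    {F : (ℕ → E) → E → G} (hF : StronglyMeasurable fun p : (ℕ → E) × E => F p.1 p.2) {C : ℝ}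
    (hC : ∀ p z, ‖F p z‖ ≤ C) (hdep : ∀ p p' z, (∀ i < j, p i = p' i) → F p z = F p' z) :
    ∫ ω, F (fun i => X i ω) (X j ω) ∂μ = ∫ ω, ∫ z, F (fun i => X i ω) z ∂P ∂μ := by
  have hne : Nonempty E := nonempty_of_isProbabilityMeasure P
  obtain ⟨e₀⟩ := hne
  -- F takes a whole sequence, while independence concerns finitely many variables. Padding the
  -- prefix of length j with a fixed point e₀ changes no value of F, by `hdep`.
  let ext : (Finset.range j → E) → ℕ → E :=
    fun q i => if h : i ∈ Finset.range j then q ⟨i, h⟩ else e₀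
  have hext : Measurable ext := by
    refine measurable_pi_lambda _ fun i => ?_
    by_cases h : i ∈ Finset.range j
    · simp only [ext, h, dif_pos]
      exact measurable_pi_apply _
    · simp only [ext, h, dif_neg, not_false_iff]
      exact measurable_const
  let Y : Ω → ℕ → E := fun ω => ext fun i => X i ω
  have hY : Measurable Y := hext.comp (measurable_pi_lambda _ fun i => hX i)
  have hind : IndepFun Y (X j) μ := by
    have h := hindep.indepFun_finset (Finset.range j) {j} (by simp) hX
    exact h.comp hext (measurable_pi_apply (⟨j, by simp⟩ : ({j} : Finset ℕ)))
  have hYX : ∀ ω, ∀ i < j, X i ω = Y ω i := fun ω i hi => by simp [Y, ext, hi]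
  have e1 : ∀ ω z, F (fun i => X i ω) z = F (Y ω) z := fun ω z => hdep _ _ _ (hYX ω)
  simp_rw [e1]
  have := integral_comp_of_indepFun hind hY (hX j) hF (C := C) (fun p => hC _ _)
  rw [hlaw] at this
  exact this

/-- `integral_prefix` for bounded measurable real functions. -/
lemma integral_prefix_real (hX : ∀ i, Measurable (X i)) (hindep : iIndepFun X μ)
    (hlaw : ∀ i, μ.map (X i) = P) (j : ℕ)
    {F : (ℕ → E) → E → ℝ} (hF : IsBddMeas fun p : (ℕ → E) × E => F p.1 p.2)
    (hdep : ∀ p p' z, (∀ i < j, p i = p' i) → F p z = F p' z) :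
    ∫ ω, F (fun i => X i ω) (X j ω) ∂μ = ∫ ω, ∫ z, F (fun i => X i ω) z ∂P ∂μ := by
  obtain ⟨C, hC⟩ := hF.bdd
  exact integral_prefix hX hindep hlaw j hF.measurable.stronglyMeasurable
    (fun p z => hC (p, z)) hdep

lemma measurable_seq (hX : ∀ i, Measurable (X i)) : Measurable fun ω => (fun i => X i ω) :=
  measurable_pi_lambda _ hX

lemma isBddMeas_sum_eval {g : E → ℝ} (hg : IsBddMeas g) (j : ℕ) :
    IsBddMeas fun p : ℕ → E => ∑ i ∈ Finset.range j, g (p i) :=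
  IsBddMeas.sum _ fun i _ => hg.comp (measurable_pi_apply i)

/-- The first, second and fourth moment of a sum of centred i.i.d. variables. -/
lemma moments_sum (hX : ∀ i, Measurable (X i)) (hindep : iIndepFun X μ)
    (hlaw : ∀ i, μ.map (X i) = P) {g : E → ℝ} (hg : IsBddMeas g) (h0 : ∫ x, g x ∂P = 0) (j : ℕ) :
    ∫ ω, (∑ i ∈ Finset.range j, g (X i ω)) ∂μ = 0 ∧
    ∫ ω, (∑ i ∈ Finset.range j, g (X i ω)) ^ 2 ∂μ = j * ∫ x, g x ^ 2 ∂P ∧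
    ∫ ω, (∑ i ∈ Finset.range j, g (X i ω)) ^ 4 ∂μ
      ≤ j * ∫ x, g x ^ 4 ∂P + 3 * j ^ 2 * (∫ x, g x ^ 2 ∂P) ^ 2 := by
  induction j with
  | zero => simp
  | succ j ih =>
    obtain ⟨ih1, ih2, ih4⟩ := ih
    have hS := isBddMeas_sum_eval hg j
    have hSX : IsBddMeas fun ω => ∑ i ∈ Finset.range j, g (X i ω) := hS.comp (measurable_seq hX)
    have key : ∀ m, ∫ ω, (∑ i ∈ Finset.range (j + 1), g (X i ω)) ^ m ∂μ
        = ∫ ω, ∫ z, (∑ i ∈ Finset.range j, g (X i ω) + g z) ^ m ∂P ∂μ := fun m => by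
      simp_rw [Finset.sum_range_succ]
      refine integral_prefix_real hX hindep hlaw j
        (F := fun p z => (∑ i ∈ Finset.range j, g (p i) + g z) ^ m)
        (((hS.comp measurable_fst).add (hg.comp measurable_snd)).pow m) fun p p' z h => ?_
      rw [Finset.sum_congr rfl fun i hi => by rw [h i (Finset.mem_range.1 hi)]]
    have i1 : ∀ a : ℝ, ∫ z, (a + g z) ^ 1 ∂P = a := fun a => by
      simp only [pow_one]
      rw [(IsBddMeas.const a).integral_add hg, h0]
      simp
    have i2 : ∀ a : ℝ, ∫ z, (a + g z) ^ 2 ∂P = a ^ 2 + ∫ x, g x ^ 2 ∂P := fun a => by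
      have e : ∀ z, (a + g z) ^ 2 = a ^ 2 + 2 * a * g z + g z ^ 2 := fun z => by ring
      simp_rw [e]
      rw [((IsBddMeas.const _).add (hg.const_mul _)).integral_add (hg.pow 2),
        (IsBddMeas.const _).integral_add (hg.const_mul _), integral_const_mul, h0]
      simp
    have i4 : ∀ a : ℝ, ∫ z, (a + g z) ^ 4 ∂P
        = a ^ 4 + 6 * (∫ x, g x ^ 2 ∂P) * a ^ 2 + 4 * (∫ x, g x ^ 3 ∂P) * a
          + ∫ x, g x ^ 4 ∂P := fun a => by
      have e : ∀ z, (a + g z) ^ 4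
        = a ^ 4 + 4 * a ^ 3 * g z + 6 * a ^ 2 * g z ^ 2 + 4 * a * g z ^ 3 + g z ^ 4 :=
        fun z => by ring
      simp_rw [e]
      rw [((((IsBddMeas.const _).add (hg.const_mul _)).add ((hg.pow 2).const_mul _)).add
          ((hg.pow 3).const_mul _)).integral_add (hg.pow 4),
        (((IsBddMeas.const _).add (hg.const_mul _)).add ((hg.pow 2).const_mul _)).integral_add
          ((hg.pow 3).const_mul _),
        ((IsBddMeas.const _).add (hg.const_mul _)).integral_add ((hg.pow 2).const_mul _),
        (IsBddMeas.const _).integral_add (hg.const_mul _)]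
      simp only [integral_const_mul, h0]
      simp
      ring
    refine ⟨?_, ?_, ?_⟩
    · have := key 1
      simp_rw [i1] at this
      simpa [ih1] using this
    · rw [key 2]
      simp_rw [i2]
      rw [(hSX.pow 2).integral_add (IsBddMeas.const _), ih2]
      simp
      ring
    · rw [key 4]
      simp_rw [i4]
      rw [(((hSX.pow 4).add ((hSX.pow 2).const_mul _)).add (hSX.const_mul _)).integral_add
          (IsBddMeas.const _), ((hSX.pow 4).add ((hSX.pow 2).const_mul _)).integral_add
          (hSX.const_mul _), (hSX.pow 4).integral_add ((hSX.pow 2).const_mul _)]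
      simp only [integral_const_mul, ih1, ih2]
      simp
      -- The step adds 6jσ⁴ and the fourth moment of g, where σ² = ∫g², and the bound allows
      -- 3((j+1)² - j²)σ⁴ ≥ 6jσ⁴.
      nlinarith [sq_nonneg (∫ x, g x ^ 2 ∂P)]

end Prefix

/-! ### Degenerate kernels -/

/-- A bounded symmetric kernel that is degenerate for `P`. -/
structure IsDegenerate {E : Type*} [MeasurableSpace E] (P : Measure E) (h : E → E → ℝ) : Prop where
  isBddMeas : IsBddMeas fun p : E × E => h p.1 p.2
  symm : ∀ x y, h x y = h y x
  integral_eq_zero : ∀ x, ∫ y, h x y ∂P = 0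

section Degenerate

variable {Ω E : Type*} [MeasurableSpace Ω] [MeasurableSpace E] {μ : Measure Ω}
  [IsProbabilityMeasure μ] {P : Measure E} [IsProbabilityMeasure P] {X : ℕ → Ω → E}
  {h : E → E → ℝ}

/-- The iterated kernel `∫ h(x, z) h(y, z) dP(z)`. -/
noncomputable def kernelSq (P : Measure E) (h : E → E → ℝ) (x y : E) : ℝ := ∫ z, h x z * h y z ∂P

/-- `∑_{i < j} h(p_i, z)`. -/
def colSum (h : E → E → ℝ) (j : ℕ) (p : ℕ → E) (z : E) : ℝ := ∑ i ∈ Finset.range j, h (p i) z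

/-- `∑_{i < j < n} h(p_i, p_j)`. -/
def pairSum (h : E → E → ℝ) (n : ℕ) (p : ℕ → E) : ℝ := ∑ j ∈ Finset.range n, colSum h j p (p j)

/-- `∫∫ h²`. -/
noncomputable def secondMoment (P : Measure E) (h : E → E → ℝ) : ℝ := ∫ x, ∫ y, h x y ^ 2 ∂P ∂P

/-- `∫∫ h⁴`. -/
noncomputable def fourthMoment (P : Measure E) (h : E → E → ℝ) : ℝ := ∫ x, ∫ y, h x y ^ 4 ∂P ∂P

/-- `∫ (∫ h(x, y)² dP(y))² dP(x)`. -/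
noncomputable def mixedMoment (P : Measure E) (h : E → E → ℝ) : ℝ :=
  ∫ x, (∫ y, h x y ^ 2 ∂P) ^ 2 ∂P

lemma colSum_congr {j : ℕ} {p p' : ℕ → E} (hp : ∀ i < j, p i = p' i) (z : E) :
    colSum h j p z = colSum h j p' z :=
  Finset.sum_congr rfl fun i hi => by rw [hp i (Finset.mem_range.1 hi)]

lemma pairSum_congr {n : ℕ} {p p' : ℕ → E} (hp : ∀ i < n, p i = p' i) :
    pairSum h n p = pairSum h n p' :=
  Finset.sum_congr rfl fun j hj => by
    have hj := Finset.mem_range.1 hj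
    rw [colSum_congr (fun i hi => hp i (hi.trans hj)), hp j hj]

lemma isBddMeas_colSum (hh : IsBddMeas fun p : E × E => h p.1 p.2) (j : ℕ) :
    IsBddMeas fun q : (ℕ → E) × E => colSum h j q.1 q.2 :=
  IsBddMeas.sum _ fun i _ => hh.comp (u := fun q : (ℕ → E) × E => (q.1 i, q.2))
    (((measurable_pi_apply i).comp measurable_fst).prodMk measurable_snd)

lemma isBddMeas_pairSum (hh : IsBddMeas fun p : E × E => h p.1 p.2) (n : ℕ) :
    IsBddMeas (pairSum h n) :=
  IsBddMeas.sum _ fun j _ => (isBddMeas_colSum hh j).comp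
    (measurable_id.prodMk (measurable_pi_apply j))

lemma IsDegenerate.kernelSq_isBddMeas (hh : IsDegenerate P h) :
    IsBddMeas fun p : E × E => kernelSq P h p.1 p.2 := by
  refine IsBddMeas.integral (f := fun (p : E × E) z => h p.1 z * h p.2 z) ?_ P
  exact (hh.isBddMeas.comp ((measurable_fst.comp measurable_fst).prodMk measurable_snd)).mul
    (hh.isBddMeas.comp ((measurable_snd.comp measurable_fst).prodMk measurable_snd))

/-- Degeneracy is inherited by Fubini. It makes the fluctuation of the conditional variance a
martingale, so that its second moment can be computed step by step. -/
lemma IsDegenerate.kernelSq (hh : IsDegenerate P h) : IsDegenerate P (kernelSq P h) where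
  isBddMeas := hh.kernelSq_isBddMeas
  symm x y := by simp only [GaussianDHSIC.kernelSq, mul_comm]
  integral_eq_zero x := by
    have hb : IsBddMeas fun p : E × E => h x p.2 * h p.1 p.2 :=
      ((hh.isBddMeas.left x).comp measurable_snd).mul hh.isBddMeas
    simp only [GaussianDHSIC.kernelSq]
    rw [IsBddMeas.integral_swap (f := fun y z => h x z * h y z) hb]
    simp only [integral_const_mul]
    have : ∀ z, ∫ y, h y z ∂P = 0 := fun z => by
      simp_rw [fun y => hh.symm y z]
      exact hh.integral_eq_zero z
    simp [this]

/-- `∫∫ (∫ h(x, z) h(y, z) dP(z))²`. -/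
noncomputable def cycleMoment (P : Measure E) (h : E → E → ℝ) : ℝ :=
  secondMoment P (kernelSq P h)

lemma IsDegenerate.integral_left (hh : IsDegenerate P h) (y : E) : ∫ x, h x y ∂P = 0 := by
  simp_rw [fun x => hh.symm x y]
  exact hh.integral_eq_zero y

lemma isBddMeas_colSum_seq (hX : ∀ i, Measurable (X i))
    (hh : IsBddMeas fun p : E × E => h p.1 p.2) (j : ℕ) :
    IsBddMeas fun q : Ω × E => colSum h j (fun i => X i q.1) q.2 :=
  (isBddMeas_colSum hh j).comp (((measurable_seq hX).comp measurable_fst).prodMk measurable_snd)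

/-- For fixed z the column sum is a sum of centred i.i.d. variables. Integrating over the sample
before z reduces this and the fourth-moment bound to `moments_sum`. -/
lemma integral_colSum_sq (hX : ∀ i, Measurable (X i)) (hindep : iIndepFun X μ)
    (hlaw : ∀ i, μ.map (X i) = P) (hh : IsDegenerate P h) (j : ℕ) :
    ∫ ω, ∫ z, colSum h j (fun i => X i ω) z ^ 2 ∂P ∂μ = j * secondMoment P h := by
  rw [IsBddMeas.integral_swap (f := fun ω z => colSum h j (fun i => X i ω) z ^ 2)
    ((isBddMeas_colSum_seq hX hh.isBddMeas j).pow 2)]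
  simp only [colSum]
  simp_rw [fun z => (moments_sum hX hindep hlaw (hh.isBddMeas.right z) (hh.integral_left z) j).2.1]
  rw [integral_const_mul, secondMoment]
  simp_rw [fun x z => hh.symm x z]

lemma integral_colSum_pow_four (hX : ∀ i, Measurable (X i)) (hindep : iIndepFun X μ)
    (hlaw : ∀ i, μ.map (X i) = P) (hh : IsDegenerate P h) (j : ℕ) :
    ∫ ω, ∫ z, colSum h j (fun i => X i ω) z ^ 4 ∂P ∂μ
      ≤ j * fourthMoment P h + 3 * j ^ 2 * mixedMoment P h := by
  have hb := isBddMeas_colSum_seq hX hh.isBddMeas j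
  have hsw : IsBddMeas fun p : E × E => h p.2 p.1 := hh.isBddMeas.comp measurable_swap
  rw [IsBddMeas.integral_swap (f := fun ω z => colSum h j (fun i => X i ω) z ^ 4) (hb.pow 4)]
  have h4 : IsBddMeas fun z => ∫ x, h x z ^ 4 ∂P := IsBddMeas.integral (f := fun z x => h x z ^ 4)
      (hsw.pow 4) P
  have h2 : IsBddMeas fun z => ∫ x, h x z ^ 2 ∂P := IsBddMeas.integral (f := fun z x => h x z ^ 2)
      (hsw.pow 2) P
  calc ∫ z, ∫ ω, colSum h j (fun i => X i ω) z ^ 4 ∂μ ∂P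
      ≤ ∫ z, (j * ∫ x, h x z ^ 4 ∂P + 3 * j ^ 2 * (∫ x, h x z ^ 2 ∂P) ^ 2) ∂P := by
        refine IsBddMeas.integral_mono ?_ ((h4.const_mul _).add ((h2.pow 2).const_mul _)) P
          fun z => (moments_sum hX hindep hlaw (hh.isBddMeas.right z) (hh.integral_left z) j).2.2
        exact IsBddMeas.integral (f := fun z ω => colSum h j (fun i => X i ω) z ^ 4)
          ((hb.pow 4).comp measurable_swap) μ
    _ = _ := by
        rw [(h4.const_mul _).integral_add ((h2.pow 2).const_mul _), integral_const_mul,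
          integral_const_mul, fourthMoment, mixedMoment]
        simp_rw [fun x z => hh.symm x z]

/-- The conditional variance `∫ (∑_{i < j} h(p_i, z))² dP(z)`. -/
noncomputable def condVar (P : Measure E) (h : E → E → ℝ) (j : ℕ) (p : ℕ → E) : ℝ :=
  ∫ z, colSum h j p z ^ 2 ∂P

lemma isBddMeas_condVar (hh : IsBddMeas fun p : E × E => h p.1 p.2) (j : ℕ) :
    IsBddMeas (condVar P h j) :=
  IsBddMeas.integral (f := fun p z => colSum h j p z ^ 2) ((isBddMeas_colSum hh j).pow 2) P

/-- In the expanded square, the cross term integrates to a column sum of the iterated kernel and the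
new square to its diagonal value. -/
lemma condVar_succ (hh : IsBddMeas fun p : E × E => h p.1 p.2) (j : ℕ) (p : ℕ → E) :
    condVar P h (j + 1) p
      = condVar P h j p + (2 * colSum (kernelSq P h) j p (p j) + kernelSq P h (p j) (p j)) := by
  have hc : IsBddMeas (colSum h j p) := (isBddMeas_colSum hh j).left p
  have hl : IsBddMeas (h (p j)) := hh.left (p j)
  have e : ∀ z, colSum h (j + 1) p z ^ 2
      = colSum h j p z ^ 2 + (2 * (colSum h j p z * h (p j) z) + h (p j) z * h (p j) z) :=
    fun z => by simp only [colSum, Finset.sum_range_succ]; ring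
  simp only [condVar]
  simp_rw [e]
  rw [(hc.pow 2).integral_add (((hc.mul hl).const_mul 2).add (hl.mul hl)),
    ((hc.mul hl).const_mul 2).integral_add (hl.mul hl), integral_const_mul]
  congr 3
  simp only [colSum, Finset.sum_mul, kernelSq]
  rw [integral_finsetSum]
  exact fun i _ => ((hh.left (p i)).mul hl).integrable P

lemma integral_kernelSq_diag :
    ∫ x, kernelSq P h x x ∂P = secondMoment P h := by
  simp only [kernelSq, secondMoment, sq]

/-- The conditional variance concentrates around its mean. -/
lemma integral_condVar_sub_sq_le (hX : ∀ i, Measurable (X i)) (hindep : iIndepFun X μ)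
    (hlaw : ∀ i, μ.map (X i) = P) (hh : IsDegenerate P h) (j : ℕ) :
    ∫ ω, (condVar P h j (fun i => X i ω) - j * secondMoment P h) ^ 2 ∂μ
      ≤ 8 * j ^ 2 * cycleMoment P h + 2 * j * mixedMoment P h := by
  set s := secondMoment P h
  have hK := hh.kernelSq
  have hdiag : IsBddMeas fun x => kernelSq P h x x :=
    hK.isBddMeas.comp (measurable_id.prodMk measurable_id)
  have hkap : 0 ≤ cycleMoment P h :=
    integral_nonneg fun x => integral_nonneg fun y => sq_nonneg _
  have hmix : mixedMoment P h = ∫ x, kernelSq P h x x ^ 2 ∂P := by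
    simp only [mixedMoment, kernelSq, sq]
  induction j with
  | zero => simp [condVar, colSum]
  | succ j ih =>
    -- D is the martingale increment of the centred conditional variance M. Its first summand has
    -- mean zero in z by degeneracy of the iterated kernel, its second because the diagonal of that
    -- kernel has mean s.
    set D : (ℕ → E) → E → ℝ := fun p z => 2 * colSum (kernelSq P h) j p z + (kernelSq P h z z - s)
      with hD
    set M : (ℕ → E) → ℝ := fun p => condVar P h j p - j * s with hM
    have hDb : IsBddMeas fun q : (ℕ → E) × E => D q.1 q.2 :=
      ((isBddMeas_colSum hK.isBddMeas j).const_mul 2).add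
        ((hdiag.sub (IsBddMeas.const s)).comp measurable_snd)
    have hMb : IsBddMeas M := (isBddMeas_condVar hh.isBddMeas j).sub (IsBddMeas.const _)
    have hseq := measurable_seq hX
    have e : ∀ p : ℕ → E, condVar P h (j + 1) p - ((j + 1 : ℕ) : ℝ) * s = M p + D p (p j) :=
      fun p => by simp only [condVar_succ hh.isBddMeas, hM, hD]; push_cast; ring
    simp_rw [e]
    have hDz : ∀ p, IsBddMeas (D p) := fun p => hDb.left p
    have hD0 : ∀ p, ∫ z, D p z ∂P = 0 := fun p => by
      simp only [hD]
      rw [(((isBddMeas_colSum hK.isBddMeas j).left p).const_mul 2).integral_add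
        (hdiag.sub (IsBddMeas.const s)), hdiag.integral_sub (IsBddMeas.const s),
        integral_const_mul, integral_kernelSq_diag]
      simp only [colSum]
      rw [integral_finsetSum _ fun i _ => (hK.isBddMeas.left _).integrable P]
      simp [hK.integral_eq_zero, s]
    rw [integral_prefix_real hX hindep hlaw j (F := fun p z => (M p + D p z) ^ 2)
      (((hMb.comp measurable_fst).add hDb).pow 2) (fun p p' z hp => by
        simp only [hM, hD, condVar, colSum_congr hp])]
    have i2 : ∀ p, ∫ z, (M p + D p z) ^ 2 ∂P = M p ^ 2 + ∫ z, D p z ^ 2 ∂P := fun p => by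
      have e : ∀ z, (M p + D p z) ^ 2 = M p ^ 2 + 2 * M p * D p z + D p z ^ 2 := fun z => by ring
      simp_rw [e]
      rw [((IsBddMeas.const _).add ((hDz p).const_mul _)).integral_add ((hDz p).pow 2),
        (IsBddMeas.const _).integral_add ((hDz p).const_mul _), integral_const_mul, hD0]
      simp
    simp_rw [i2]
    have hDsq : IsBddMeas fun p => ∫ z, D p z ^ 2 ∂P :=
      IsBddMeas.integral (f := fun p z => D p z ^ 2) (hDb.pow 2) P
    rw [((hMb.pow 2).comp hseq).integral_add (hDsq.comp hseq)]
    have hcs := isBddMeas_colSum_seq hX hK.isBddMeas j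
    have hcs2 : IsBddMeas fun ω => ∫ z, colSum (kernelSq P h) j (fun i => X i ω) z ^ 2 ∂P :=
      IsBddMeas.integral (f := fun ω z => colSum (kernelSq P h) j (fun i => X i ω) z ^ 2)
        (hcs.pow 2) P
    have hvar : ∫ z, (kernelSq P h z z - s) ^ 2 ∂P ≤ mixedMoment P h := by
      have e : ∀ z, (kernelSq P h z z - s) ^ 2
        = kernelSq P h z z ^ 2 - 2 * s * kernelSq P h z z + s ^ 2 := fun z => by ring
      simp_rw [e]
      rw [((hdiag.pow 2).sub (hdiag.const_mul _)).integral_add (IsBddMeas.const _),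
        (hdiag.pow 2).integral_sub (hdiag.const_mul _), integral_const_mul,
        integral_kernelSq_diag, hmix]
      simp
      nlinarith [sq_nonneg s]
    have hDle : ∫ ω, ∫ z, D (fun i => X i ω) z ^ 2 ∂P ∂μ
        ≤ 8 * (j * cycleMoment P h) + 2 * mixedMoment P h := by
      calc ∫ ω, ∫ z, D (fun i => X i ω) z ^ 2 ∂P ∂μ
          ≤ ∫ ω, (8 * ∫ z, colSum (kernelSq P h) j (fun i => X i ω) z ^ 2 ∂P
              + 2 * mixedMoment P h) ∂μ := by
            refine IsBddMeas.integral_mono (hDsq.comp hseq)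
              ((hcs2.const_mul 8).add (IsBddMeas.const _)) μ fun ω => ?_
            have hc := (IsBddMeas.left (f := fun ω z =>
              colSum (kernelSq P h) j (fun i => X i ω) z) hcs ω).pow 2
            have hk := (hdiag.sub (IsBddMeas.const s)).pow 2
            calc ∫ z, D (fun i => X i ω) z ^ 2 ∂P
                ≤ ∫ z, (8 * colSum (kernelSq P h) j (fun i => X i ω) z ^ 2
                  + 2 * (kernelSq P h z z - s) ^ 2) ∂P := by
                  refine IsBddMeas.integral_mono ((hDz _).pow 2)
                    ((hc.const_mul 8).add (hk.const_mul 2)) P fun z => ?_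
                  simp only [hD]
                  nlinarith [sq_nonneg (2 * colSum (kernelSq P h) j (fun i => X i ω) z
                    - (kernelSq P h z z - s))]
              _ ≤ _ := by
                  rw [(hc.const_mul 8).integral_add (hk.const_mul 2), integral_const_mul,
                    integral_const_mul]
                  linarith
        _ = _ := by
            rw [(hcs2.const_mul 8).integral_add (IsBddMeas.const _), integral_const_mul,
              integral_colSum_sq hX hindep hlaw hK]
            simp [cycleMoment]
    -- The increment contributes at most 8j times the cycle moment plus twice the mixed moment, and
    -- 8j² + 8j ≤ 8(j+1)².
    push_cast
    nlinarith [mul_nonneg (Nat.cast_nonneg (α := ℝ) j) hkap]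

end Degenerate

/-! ### A central limit theorem for degenerate U-statistics -/

/-- For |x| ≤ 1 this is the remainder of the exponential series; for |x| ≥ 1 the crude bound 2 + |x|
+ x²/2 is already below 4|x|³. -/
lemma norm_cexp_mul_I_sub_le (x : ℝ) :
    ‖Complex.exp (x * Complex.I) - (1 + x * Complex.I - ((x ^ 2 / 2 : ℝ) : ℂ))‖ ≤ 4 * |x| ^ 3 := by
  rcases le_total |x| 1 with hx | hx
  · have hn : ‖(x * Complex.I : ℂ)‖ = |x| := by simp
    have h := Complex.exp_bound (x := x * Complex.I) (by rw [hn]; exact hx) (n := 3) (by norm_num)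
    rw [hn] at h
    have e : ∑ m ∈ Finset.range 3, (x * Complex.I) ^ m / (m ! : ℂ)
        = 1 + x * Complex.I - ((x ^ 2 / 2 : ℝ) : ℂ) := by
      simp [Finset.sum_range_succ, mul_pow, Nat.factorial]
      ring
    rw [e] at h
    refine h.trans ?_
    have h3 : 0 ≤ |x| ^ 3 := by positivity
    norm_num [Nat.factorial]
    linarith
  · have h1 : ‖Complex.exp (x * Complex.I)‖ = 1 := Complex.norm_exp_ofReal_mul_I x
    have h2 : ‖(1 + x * Complex.I - ((x ^ 2 / 2 : ℝ) : ℂ))‖ ≤ 1 + |x| + |x| ^ 2 / 2 := by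
      refine (norm_sub_le _ _).trans (add_le_add ((norm_add_le _ _).trans ?_) ?_)
      · simp
      · rw [Complex.norm_real, Real.norm_eq_abs, abs_of_nonneg (by positivity), sq_abs]
    refine (norm_sub_le _ _).trans ?_
    rw [h1]
    nlinarith [mul_nonneg (sub_nonneg.2 hx) (abs_nonneg x),
      mul_nonneg (mul_nonneg (sub_nonneg.2 hx) (abs_nonneg x)) (abs_nonneg x)]

lemma abs_one_sub_sub_exp_neg_le {a : ℝ} (ha : 0 ≤ a) : |1 - a - Real.exp (-a)| ≤ a ^ 2 := by
  have h1 := Real.add_one_le_exp (-a)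
  rw [abs_le]
  refine ⟨?_, by nlinarith⟩
  rcases le_total a 1 with h | h
  · have := Real.norm_exp_sub_one_sub_id_le (x := -a) (by simpa [abs_of_nonneg ha] using h)
    rw [Real.norm_eq_abs, Real.norm_eq_abs, abs_neg, abs_of_nonneg ha] at this
    linarith [(abs_le.1 this).2]
  · have : Real.exp (-a) ≤ 1 := Real.exp_le_one_iff.2 (by linarith)
    nlinarith

/-- Weighted AM-GM. It trades the cubic Taylor remainder for second and fourth moments, which are
computable for column sums; the weight δ stays free until the final limit. -/
lemma pow_three_le {δ x : ℝ} (hδ : 0 < δ) : |x| ^ 3 ≤ δ * x ^ 2 + x ^ 4 / δ := by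
  have h : 0 ≤ x ^ 2 * (δ - |x|) ^ 2 / δ := by positivity
  have hx : x ^ 2 = |x| ^ 2 := (sq_abs x).symm
  have hx4 : x ^ 4 = |x| ^ 4 := by rw [show x ^ 4 = (x ^ 2) ^ 2 by ring, hx]; ring
  have e : x ^ 2 * (δ - |x|) ^ 2 / δ = δ * x ^ 2 + x ^ 4 / δ - 2 * |x| ^ 3 := by
    rw [hx4, hx]
    field_simp
    ring
  have : 0 ≤ |x| ^ 3 := by positivity
  linarith

/-- The same device bounds the mean absolute deviation of the conditional variance by its mean
square deviation. -/
lemma abs_le_add_sq_div {N x : ℝ} (hN : 0 < N) : |x| ≤ N + x ^ 2 / N := by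
  have h : 0 ≤ (N - |x|) ^ 2 / N := by positivity
  have e : (N - |x|) ^ 2 / N = N + x ^ 2 / N - 2 * |x| := by
    rw [← sq_abs x]
    field_simp
    ring
  have := abs_nonneg x
  linarith

section Degenerate

variable {Ω E : Type*} [MeasurableSpace Ω] [MeasurableSpace E] {μ : Measure Ω}
  [IsProbabilityMeasure μ] {P : Measure E} [IsProbabilityMeasure P] {X : ℕ → Ω → E}
  {h : E → E → ℝ}

/-- Taylor expansion: centring removes the linear term, leaving 1 - u²/2 ∫W², which is compared with
1 - a and then with exp(-a). The number a need not be the true variance term; in the application W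
is a random column sum and a is deterministic. -/
lemma norm_integral_cexp_sub_le {W : E → ℝ} (hW : IsBddMeas W) (h0 : ∫ z, W z ∂P = 0) (u : ℝ)
    {a δ : ℝ} (ha : 0 ≤ a) (hδ : 0 < δ) :
    ‖∫ z, Complex.exp (((u * W z : ℝ) : ℂ) * Complex.I) ∂P - (Real.exp (-a) : ℂ)‖
      ≤ 4 * (δ * (u ^ 2 * ∫ z, W z ^ 2 ∂P) + u ^ 4 * (∫ z, W z ^ 4 ∂P) / δ)
        + |u ^ 2 / 2 * ∫ z, W z ^ 2 ∂P - a| + a ^ 2 := by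
  have hu : IsBddMeas fun z => u * W z := hW.const_mul u
  have hexp : Integrable (fun z => Complex.exp (((u * W z : ℝ) : ℂ) * Complex.I)) P := by
    refine Integrable.of_bound ?_ 1 (ae_of_all _ fun z => ?_)
    · exact (Complex.measurable_exp.comp
        ((Complex.measurable_ofReal.comp hu.measurable).mul_const _)).aestronglyMeasurable
    · rw [Complex.norm_exp_ofReal_mul_I]
  have hq : IsBddMeas fun z => (u * W z) ^ 2 / 2 := by
    simpa [div_eq_inv_mul] using (hu.pow 2).const_mul 2⁻¹
  have hlin : Integrable (fun z => (1 : ℂ) + ((u * W z : ℝ) : ℂ) * Complex.I) P :=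
    (integrable_const 1).add ((hu.integrable P).ofReal.mul_const _)
  have hquad : Integrable (fun z => (((u * W z) ^ 2 / 2 : ℝ) : ℂ)) P := (hq.integrable P).ofReal
  have hT : ∫ z, ((1 : ℂ) + ((u * W z : ℝ) : ℂ) * Complex.I - (((u * W z) ^ 2 / 2 : ℝ) : ℂ)) ∂P
      = ((1 - u ^ 2 / 2 * ∫ z, W z ^ 2 ∂P : ℝ) : ℂ) := by
    rw [integral_sub hlin hquad, integral_add (integrable_const 1)
      ((hu.integrable P).ofReal.mul_const _), integral_mul_const, integral_complex_ofReal,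
      integral_complex_ofReal, integral_const_mul, h0]
    have e : ∀ z, (u * W z) ^ 2 / 2 = u ^ 2 / 2 * W z ^ 2 := fun z => by ring
    simp_rw [e]
    rw [integral_const_mul]
    simp
  have h1 : ‖∫ z, Complex.exp (((u * W z : ℝ) : ℂ) * Complex.I) ∂P
      - ((1 - u ^ 2 / 2 * ∫ z, W z ^ 2 ∂P : ℝ) : ℂ)‖
      ≤ 4 * (δ * (u ^ 2 * ∫ z, W z ^ 2 ∂P) + u ^ 4 * (∫ z, W z ^ 4 ∂P) / δ) := by
    have hlq : Integrable (fun z => (1 : ℂ) + ((u * W z : ℝ) : ℂ) * Complex.I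
      - (((u * W z) ^ 2 / 2 : ℝ) : ℂ)) P := hlin.sub hquad
    rw [← hT, ← integral_sub hexp hlq]
    have hb : IsBddMeas fun z => 4 * (δ * (u * W z) ^ 2 + δ⁻¹ * (u * W z) ^ 4) :=
      (((hu.pow 2).const_mul δ).add ((hu.pow 4).const_mul δ⁻¹)).const_mul 4
    refine (norm_integral_le_of_norm_le (hb.integrable P) (ae_of_all _ fun z => ?_)).trans_eq ?_
    · refine (norm_cexp_mul_I_sub_le (u * W z)).trans ?_
      have := pow_three_le (x := u * W z) hδ
      rw [div_eq_inv_mul] at this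
      linarith
    · rw [integral_const_mul, ((hu.pow 2).const_mul δ).integral_add ((hu.pow 4).const_mul δ⁻¹),
        integral_const_mul, integral_const_mul]
      simp_rw [mul_pow]
      rw [integral_const_mul, integral_const_mul]
      ring
  have h2 : ‖((1 - u ^ 2 / 2 * ∫ z, W z ^ 2 ∂P : ℝ) : ℂ) - (Real.exp (-a) : ℂ)‖
      ≤ |u ^ 2 / 2 * ∫ z, W z ^ 2 ∂P - a| + a ^ 2 := by
    rw [← Complex.ofReal_sub, Complex.norm_real, Real.norm_eq_abs]
    have e : 1 - u ^ 2 / 2 * ∫ z, W z ^ 2 ∂P - Real.exp (-a)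
        = -(u ^ 2 / 2 * ∫ z, W z ^ 2 ∂P - a) + (1 - a - Real.exp (-a)) := by ring
    rw [e]
    refine (abs_add_le _ _).trans ?_
    rw [abs_neg]
    exact add_le_add le_rfl (abs_one_sub_sub_exp_neg_le ha)
  have := norm_sub_le_norm_sub_add_norm_sub
    (∫ z, Complex.exp (((u * W z : ℝ) : ℂ) * Complex.I) ∂P)
    ((1 - u ^ 2 / 2 * ∫ z, W z ^ 2 ∂P : ℝ) : ℂ) (Real.exp (-a) : ℂ)
  linarith

/-- The characteristic function of `pairSum`. -/
noncomputable def pairCharFun (μ : Measure Ω) (X : ℕ → Ω → E) (h : E → E → ℝ) (u : ℝ) (n : ℕ) : ℂ :=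
  ∫ ω, Complex.exp (((u * pairSum h n (fun i => X i ω) : ℝ) : ℂ) * Complex.I) ∂μ

/-- Condition on the first j observations. The exponential of the past has modulus one, so the error
is at most the mean distance between the conditional characteristic function of the new column sum
and exp(-a). The three groups of error terms come from the Taylor remainder, from the fluctuation of
the conditional variance, and from 1 - a against exp(-a). -/
lemma pairCharFun_succ_sub_le (hX : ∀ i, Measurable (X i)) (hindep : iIndepFun X μ)
    (hlaw : ∀ i, μ.map (X i) = P) (hh : IsDegenerate P h) (u : ℝ) (j : ℕ) {δ N : ℝ}
    (hδ : 0 < δ) (hN : 0 < N) :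
    ‖pairCharFun μ X h u (j + 1)
        - (Real.exp (-(u ^ 2 / 2 * (j * secondMoment P h))) : ℂ) * pairCharFun μ X h u j‖
      ≤ 4 * (δ * (u ^ 2 * (j * secondMoment P h))
          + u ^ 4 * (j * fourthMoment P h + 3 * j ^ 2 * mixedMoment P h) / δ)
        + u ^ 2 / 2 * (N + (8 * j ^ 2 * cycleMoment P h + 2 * j * mixedMoment P h) / N)
        + (u ^ 2 / 2 * (j * secondMoment P h)) ^ 2 := by
  set s := secondMoment P h
  have hs : 0 ≤ s := integral_nonneg fun x => integral_nonneg fun y => sq_nonneg _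
  set a := u ^ 2 / 2 * (j * s) with ha_def
  have ha : 0 ≤ a := by positivity
  have hseq := measurable_seq hX
  have hcol := isBddMeas_colSum hh.isBddMeas j
  have hpair := isBddMeas_pairSum hh.isBddMeas j
  set A : (ℕ → E) → ℂ := fun p => Complex.exp (((u * pairSum h j p : ℝ) : ℂ) * Complex.I) with hA
  set B : (ℕ → E) → E → ℂ :=
    fun p z => Complex.exp (((u * colSum h j p z : ℝ) : ℂ) * Complex.I) with hB
  have hAm : Measurable A := Complex.measurable_exp.comp
    ((Complex.measurable_ofReal.comp (hpair.const_mul u).measurable).mul_const _)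
  have hBm : Measurable fun q : (ℕ → E) × E => B q.1 q.2 := Complex.measurable_exp.comp
    ((Complex.measurable_ofReal.comp (hcol.const_mul u).measurable).mul_const _)
  have hAn : ∀ p, ‖A p‖ = 1 := fun p => Complex.norm_exp_ofReal_mul_I _
  have hBn : ∀ p z, ‖B p z‖ = 1 := fun p z => Complex.norm_exp_ofReal_mul_I _
  have e1 : pairCharFun μ X h u (j + 1) = ∫ ω, A (fun i => X i ω) *
      ∫ z, B (fun i => X i ω) z ∂P ∂μ := by
    have := integral_prefix hX hindep hlaw j (F := fun p z => A p * B p z)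
      ((hAm.comp measurable_fst).mul hBm).stronglyMeasurable (C := 1)
      (fun p z => by rw [norm_mul, hAn, hBn, one_mul]) (fun p p' z hp => by
        simp only [hA, hB, colSum_congr hp, pairSum_congr hp])
    simp_rw [integral_const_mul] at this
    rw [← this, pairCharFun]
    refine integral_congr_ae (ae_of_all _ fun ω => ?_)
    simp only [hA, hB, ← Complex.exp_add, pairSum, Finset.sum_range_succ]
    congr 1
    push_cast
    ring
  have hBint : Measurable fun p => ∫ z, B p z ∂P :=
    (hBm.stronglyMeasurable.integral_prod_right' (ν := P)).measurable
  have hBintn : ∀ p, ‖∫ z, B p z ∂P‖ ≤ 1 := fun p => by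
    simpa using norm_integral_le_of_norm_le_const (μ := P) (ae_of_all _ fun z => (hBn p z).le)
  have hi1 : Integrable (fun ω => A (fun i => X i ω) * ∫ z, B (fun i => X i ω) z ∂P) μ := by
    refine Integrable.of_bound ((hAm.mul hBint).comp hseq).aestronglyMeasurable 1
      (ae_of_all _ fun ω => ?_)
    rw [norm_mul, hAn, one_mul]
    exact hBintn _
  have hi2 : Integrable (fun ω => A (fun i => X i ω)) μ :=
    Integrable.of_bound (hAm.comp hseq).aestronglyMeasurable 1 (ae_of_all _ fun ω => (hAn _).le)
  rw [e1, pairCharFun, ← integral_const_mul, ← integral_sub hi1 (hi2.const_mul _)]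
  have hc0 : ∀ p, ∫ z, colSum h j p z ∂P = 0 := fun p => by
    simp only [colSum]
    rw [integral_finsetSum _ fun i _ => (hh.isBddMeas.left _).integrable P]
    simp [hh.integral_eq_zero]
  have hcv := isBddMeas_condVar (P := P) hh.isBddMeas j
  have hcv4 : IsBddMeas fun p => ∫ z, colSum h j p z ^ 4 ∂P :=
    IsBddMeas.integral (f := fun p z => colSum h j p z ^ 4) (hcol.pow 4) P
  have hdev : IsBddMeas fun p => (condVar P h j p - j * s) ^ 2 :=
    (hcv.sub (IsBddMeas.const _)).pow 2
  have hd : IsBddMeas fun ω => 4 * (δ * (u ^ 2 * condVar P h j (fun i => X i ω))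
        + u ^ 4 * δ⁻¹ * (∫ z, colSum h j (fun i => X i ω) z ^ 4 ∂P))
      + u ^ 2 / 2 * (N + N⁻¹ * (condVar P h j (fun i => X i ω) - j * s) ^ 2) :=
    ((((hcv.comp hseq).const_mul _).const_mul _).add ((hcv4.comp hseq).const_mul _)).const_mul 4
      |>.add (((IsBddMeas.const N).add ((hdev.comp hseq).const_mul _)).const_mul _)
  refine (norm_integral_le_of_norm_le ((hd.add (IsBddMeas.const (a ^ 2))).integrable μ)
    (ae_of_all _ fun ω => ?_)).trans ?_
  · have e2 : A (fun i => X i ω) * ∫ z, B (fun i => X i ω) z ∂P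
        - (Real.exp (-a) : ℂ) * Complex.exp (((u * pairSum h j (fun i => X i ω) : ℝ) : ℂ)
          * Complex.I)
        = A (fun i => X i ω) * (∫ z, B (fun i => X i ω) z ∂P - (Real.exp (-a) : ℂ)) := by
      simp only [hA]
      ring
    rw [e2, norm_mul, hAn, one_mul]
    refine (norm_integral_cexp_sub_le (IsBddMeas.left
      (f := fun p z => colSum h j p z) hcol (fun i => X i ω)) (hc0 _) u ha hδ).trans ?_
    have e3 : |u ^ 2 / 2 * ∫ z, colSum h j (fun i => X i ω) z ^ 2 ∂P - a|
        = u ^ 2 / 2 * |condVar P h j (fun i => X i ω) - j * s| := by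
      rw [ha_def, ← mul_sub, abs_mul, abs_of_nonneg (by positivity)]
      rfl
    have e4 := abs_le_add_sq_div (x := condVar P h j (fun i => X i ω) - j * s) hN
    have e5 := mul_le_mul_of_nonneg_left e4 (show 0 ≤ u ^ 2 / 2 by positivity)
    rw [e3]
    rw [div_eq_inv_mul _ N] at e5
    refine add_le_add (add_le_add (le_of_eq ?_) e5) le_rfl
    simp only [condVar]
    ring
  · rw [hd.integral_add (IsBddMeas.const _), IsBddMeas.integral_add
      (((((hcv.comp hseq).const_mul _).const_mul _).add ((hcv4.comp hseq).const_mul _)).const_mul 4)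
      (((IsBddMeas.const N).add ((hdev.comp hseq).const_mul _)).const_mul _), integral_const_mul,
      integral_const_mul, IsBddMeas.integral_add (((hcv.comp hseq).const_mul _).const_mul _)
      ((hcv4.comp hseq).const_mul _), (IsBddMeas.const N).integral_add
      ((hdev.comp hseq).const_mul _)]
    simp only [integral_const_mul]
    have m2 : ∫ ω, condVar P h j (fun i => X i ω) ∂μ = j * s :=
      integral_colSum_sq hX hindep hlaw hh j
    have m4 := integral_colSum_pow_four hX hindep hlaw hh j
    have md := integral_condVar_sub_sq_le hX hindep hlaw hh j
    rw [m2]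
    simp only [integral_const, probReal_univ, one_smul]
    rw [div_eq_mul_inv _ δ, div_eq_inv_mul _ N]
    have hδ' : 0 ≤ u ^ 4 * δ⁻¹ := by positivity
    have k1 := mul_le_mul_of_nonneg_left m4 hδ'
    have k2 := mul_le_mul_of_nonneg_left md (inv_nonneg.2 hN.le)
    have k3 := mul_le_mul_of_nonneg_left k2 (show 0 ≤ u ^ 2 / 2 by positivity)
    nlinarith

/-- The one-step factors lie in (0, 1], so passing through them does not enlarge earlier errors, and
n steps cost at most n times the largest error. The exponents add up through 0 + 1 + ... + (n-1) =
n(n-1)/2. -/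
lemma norm_pairCharFun_sub_le (hX : ∀ i, Measurable (X i)) (hindep : iIndepFun X μ)
    (hlaw : ∀ i, μ.map (X i) = P) (hh : IsDegenerate P h) (u : ℝ) (n : ℕ) {δ N : ℝ}
    (hδ : 0 < δ) (hN : 0 < N) :
    ‖pairCharFun μ X h u n
        - (Real.exp (-(u ^ 2 / 2 * secondMoment P h * (n * (n - 1) / 2))) : ℂ)‖
      ≤ n * (4 * (δ * (u ^ 2 * (n * secondMoment P h))
          + u ^ 4 * (n * fourthMoment P h + 3 * n ^ 2 * mixedMoment P h) / δ)
        + u ^ 2 / 2 * (N + (8 * n ^ 2 * cycleMoment P h + 2 * n * mixedMoment P h) / N)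
        + (u ^ 2 / 2 * (n * secondMoment P h)) ^ 2) := by
  have hs : 0 ≤ secondMoment P h := integral_nonneg fun x => integral_nonneg fun y => sq_nonneg _
  have h4 : 0 ≤ fourthMoment P h :=
    integral_nonneg fun x => integral_nonneg fun y => by positivity
  have hm : 0 ≤ mixedMoment P h := integral_nonneg fun x => sq_nonneg _
  have hc : 0 ≤ cycleMoment P h := integral_nonneg fun x => integral_nonneg fun y => sq_nonneg _
  set s := secondMoment P h
  set err := 4 * (δ * (u ^ 2 * (n * s))
          + u ^ 4 * (n * fourthMoment P h + 3 * n ^ 2 * mixedMoment P h) / δ)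
        + u ^ 2 / 2 * (N + (8 * n ^ 2 * cycleMoment P h + 2 * n * mixedMoment P h) / N)
        + (u ^ 2 / 2 * (n * s)) ^ 2 with herr
  suffices H : ∀ m ≤ n, ‖pairCharFun μ X h u m
      - (Real.exp (-(u ^ 2 / 2 * s * (m * (m - 1) / 2))) : ℂ)‖ ≤ m * err from H n le_rfl
  intro m
  induction m with
  | zero => intro _; simp [pairCharFun, pairSum]
  | succ m ih =>
    intro hmn
    have ih := ih (by omega)
    have hmn' : (m : ℝ) ≤ n := by exact_mod_cast (by omega : m ≤ n)
    have hm0 : (0 : ℝ) ≤ m := Nat.cast_nonneg m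
    have hstep := pairCharFun_succ_sub_le hX hindep hlaw hh u m hδ hN
    have herr' := hstep.trans (show _ ≤ err by rw [herr]; gcongr)
    set e := Real.exp (-(u ^ 2 / 2 * (m * s))) with he
    have he1 : e ≤ 1 := Real.exp_le_one_iff.2 (neg_nonpos.2 (by positivity))
    have hprod : (Real.exp (-(u ^ 2 / 2 * s * (((m + 1 : ℕ) : ℝ) * (((m + 1 : ℕ) : ℝ) - 1) / 2))) :
        ℂ)
        = (e : ℂ) * (Real.exp (-(u ^ 2 / 2 * s * (m * (m - 1) / 2))) : ℂ) := by
      rw [← Complex.ofReal_mul, he, ← Real.exp_add]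
      congr 2
      push_cast
      ring
    rw [hprod]
    have hsplit : pairCharFun μ X h u (m + 1)
        - (e : ℂ) * (Real.exp (-(u ^ 2 / 2 * s * (m * (m - 1) / 2))) : ℂ)
        = (pairCharFun μ X h u (m + 1) - (e : ℂ) * pairCharFun μ X h u m)
          + (e : ℂ) * (pairCharFun μ X h u m
            - (Real.exp (-(u ^ 2 / 2 * s * (m * (m - 1) / 2))) : ℂ)) := by ring
    rw [hsplit]
    refine (norm_add_le _ _).trans ?_
    have he0 : 0 < e := Real.exp_pos _
    rw [norm_mul, Complex.norm_real, Real.norm_eq_abs, abs_of_pos he0]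
    have := mul_le_of_le_one_left (norm_nonneg (pairCharFun μ X h u m
            - (Real.exp (-(u ^ 2 / 2 * s * (m * (m - 1) / 2))) : ℂ))) he1
    rw [Nat.cast_succ, add_mul, one_mul]
    linarith

/-- A quantitative central limit theorem for the normalised degenerate U-statistic of order two. -/
lemma norm_pairCharFun_sub_gaussian_le (hX : ∀ i, Measurable (X i)) (hindep : iIndepFun X μ)
    (hlaw : ∀ i, μ.map (X i) = P) (hh : IsDegenerate P h) (hs : 0 < secondMoment P h) (t : ℝ)
    {n : ℕ} (hn : 2 ≤ n) {δ : ℝ} (hδ : 0 < δ) :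
    ‖pairCharFun μ X h (t * Real.sqrt (2 / (n * (n - 1) * secondMoment P h))) n
        - (Real.exp (-(t ^ 2 / 2)) : ℂ)‖
      ≤ 18 * t ^ 2 * δ
        + ((64 * t ^ 4 * (fourthMoment P h / (n ^ 2 * secondMoment P h ^ 2)
              + 3 * (mixedMoment P h / (n * secondMoment P h ^ 2)))
          + 2 * t ^ 2 * (8 * (cycleMoment P h / secondMoment P h ^ 2)
              + 2 * (mixedMoment P h / (n * secondMoment P h ^ 2)))) / δ)
        + 4 * t ^ 4 / n := by
  have h4 : 0 ≤ fourthMoment P h :=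
    integral_nonneg fun x => integral_nonneg fun y => by positivity
  have hm : 0 ≤ mixedMoment P h := integral_nonneg fun x => sq_nonneg _
  have hc : 0 ≤ cycleMoment P h := integral_nonneg fun x => integral_nonneg fun y => sq_nonneg _
  set s := secondMoment P h
  have hn' : (2 : ℝ) ≤ n := by exact_mod_cast hn
  have hn0 : (0 : ℝ) < n := by linarith
  have hn1 : (0 : ℝ) < n - 1 := by linarith
  set u := t * Real.sqrt (2 / (n * (n - 1) * s)) with hu
  have hu2 : u ^ 2 = t ^ 2 * (2 / (n * (n - 1) * s)) := by
    rw [hu, mul_pow, Real.sq_sqrt (by positivity)]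
  -- Z = 2n/(n-1) · t² is at most 4t² for n ≥ 2. The whole error is a polynomial in Z with the
  -- moment ratios as coefficients, and the stated constants come from inserting Z ≤ 4t².
  set Z := u ^ 2 * n ^ 2 * s with hZ
  have hZ0 : 0 ≤ Z := by positivity
  have hZle : Z ≤ 4 * t ^ 2 := by
    rw [hZ, hu2]
    have e : t ^ 2 * (2 / (n * (n - 1) * s)) * n ^ 2 * s = t ^ 2 * (2 * n / (n - 1)) := by
      field_simp
    rw [e, mul_comm 4]
    refine mul_le_mul_of_nonneg_left ?_ (sq_nonneg t)
    rw [div_le_iff₀ hn1]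
    linarith
  -- The choice N = δ n s makes the cost of the second AM-GM weight proportional to Zδ, like that of
  -- the first; together they give 9/2 · Zδ.
  have hmain := norm_pairCharFun_sub_le hX hindep hlaw hh u n hδ
    (show 0 < δ * (n * s) by positivity)
  have hexp : u ^ 2 / 2 * s * (n * (n - 1) / 2) = t ^ 2 / 2 := by
    rw [hu2]
    field_simp
  rw [hexp] at hmain
  refine hmain.trans ?_
  have e : n * (4 * (δ * (u ^ 2 * (n * s))
          + u ^ 4 * (n * fourthMoment P h + 3 * n ^ 2 * mixedMoment P h) / δ)
        + u ^ 2 / 2 * (δ * (n * s) + (8 * n ^ 2 * cycleMoment P h + 2 * n * mixedMoment P h)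
            / (δ * (n * s)))
        + (u ^ 2 / 2 * (n * s)) ^ 2)
      = 9 / 2 * Z * δ + ((4 * Z ^ 2 * (fourthMoment P h / (n ^ 2 * s ^ 2)
              + 3 * (mixedMoment P h / (n * s ^ 2)))
          + Z / 2 * (8 * (cycleMoment P h / s ^ 2) + 2 * (mixedMoment P h / (n * s ^ 2)))) / δ)
        + Z ^ 2 / 4 / n := by
    rw [hZ]
    field_simp
    ring
  rw [e]
  have hZ2 : Z ^ 2 ≤ 16 * t ^ 4 := by nlinarith
  have k1 : 9 / 2 * Z ≤ 18 * t ^ 2 := by linarith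
  have k2 : 4 * Z ^ 2 ≤ 64 * t ^ 4 := by linarith
  have k3 : Z / 2 ≤ 2 * t ^ 2 := by linarith
  have k4 : Z ^ 2 / 4 ≤ 4 * t ^ 4 := by linarith
  gcongr

end Degenerate

/-- **Central limit theorem for degenerate U-statistics** of order two with varying kernels. -/
theorem tendstoInDistribution_pairSum {Ω E : Type*} [MeasurableSpace Ω] [MeasurableSpace E]
    {μ : Measure Ω} [IsProbabilityMeasure μ] {P : Measure E} [IsProbabilityMeasure P]
    {X : ℕ → Ω → E} (hX : ∀ i, Measurable (X i)) (hindep : iIndepFun X μ)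
    (hlaw : ∀ i, μ.map (X i) = P) {h : ℕ → E → E → ℝ} (hh : ∀ n, IsDegenerate P (h n))
    (hs : ∀ᶠ n in atTop, 0 < secondMoment P (h n))
    (h4 : Tendsto (fun n : ℕ => fourthMoment P (h n) / (n ^ 2 * secondMoment P (h n) ^ 2))
      atTop (𝓝 0))
    (hm : Tendsto (fun n : ℕ => mixedMoment P (h n) / (n * secondMoment P (h n) ^ 2))
      atTop (𝓝 0))
    (hc : Tendsto (fun n : ℕ => cycleMoment P (h n) / secondMoment P (h n) ^ 2) atTop (𝓝 0)) :
    TendstoInDistribution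
      (fun (n : ℕ) ω => Real.sqrt (2 / (n * (n - 1) * secondMoment P (h n)))
        * pairSum (h n) n (fun i => X i ω))
      atTop (id : ℝ → ℝ) (fun _ => μ) (gaussianReal 0 1) where
  forall_aemeasurable n := (((isBddMeas_pairSum (hh n).isBddMeas n).measurable.comp
    (measurable_seq hX)).const_mul _).aemeasurable
  aemeasurable_limit := measurable_id.aemeasurable
  tendsto := by
    refine ProbabilityMeasure.tendsto_iff_tendsto_charFun.2 fun t => ?_
    have hlim : charFun ((gaussianReal 0 1).map id) t = (Real.exp (-(t ^ 2 / 2)) : ℂ) := by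
      rw [Measure.map_id, charFun_gaussianReal]
      push_cast
      congr 1
      simp
    have hcf : ∀ n : ℕ, charFun (μ.map fun ω => Real.sqrt (2 / (n * (n - 1)
          * secondMoment P (h n))) * pairSum (h n) n (fun i => X i ω)) t
        = pairCharFun μ X (h n) (t * Real.sqrt (2 / (n * (n - 1) * secondMoment P (h n)))) n := by
      intro n
      rw [charFun_apply_real, integral_map, pairCharFun]
      · refine integral_congr_ae (ae_of_all _ fun ω => ?_)
        simp only
        congr 2
        push_cast
        ring
      · exact (((isBddMeas_pairSum (hh n).isBddMeas n).measurable.comp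
          (measurable_seq hX)).const_mul _).aemeasurable
      · exact (by fun_prop : Measurable fun x : ℝ =>
          Complex.exp ((t : ℂ) * (x : ℂ) * Complex.I)).aestronglyMeasurable
    simp only [ProbabilityMeasure.coe_mk]
    rw [hlim]
    simp_rw [hcf]
    rw [Metric.tendsto_atTop']
    intro ε hε
    -- This makes 18t²δ ≤ ε/2, and the + 1 covers t = 0. With δ fixed, all other error terms vanish
    -- as n grows.
    set δ := ε / (2 * (18 * t ^ 2 + 1)) with hδ_def
    have hδ : 0 < δ := by positivity
    have hrest : Tendsto (fun n : ℕ => ((64 * t ^ 4 * (fourthMoment P (h n)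
              / (n ^ 2 * secondMoment P (h n) ^ 2)
              + 3 * (mixedMoment P (h n) / (n * secondMoment P (h n) ^ 2)))
          + 2 * t ^ 2 * (8 * (cycleMoment P (h n) / secondMoment P (h n) ^ 2)
              + 2 * (mixedMoment P (h n) / (n * secondMoment P (h n) ^ 2)))) / δ)
        + 4 * t ^ 4 / n) atTop (𝓝 0) := by
      have := ((((h4.add (hm.const_mul 3)).const_mul (64 * t ^ 4)).add
        (((hc.const_mul 8).add (hm.const_mul 2)).const_mul (2 * t ^ 2))).div_const δ).add
        (tendsto_const_div_atTop_nhds_zero_nat (4 * t ^ 4))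
      simpa using this
    have hev := hrest.eventually (gt_mem_nhds (half_pos hε))
    obtain ⟨n₀, hn₀⟩ := (hev.and (hs.and (eventually_ge_atTop 2))).exists_forall_of_atTop
    refine ⟨n₀, fun n hn => ?_⟩
    obtain ⟨h1, h2, h3⟩ := hn₀ n hn.le
    rw [dist_eq_norm]
    refine (norm_pairCharFun_sub_gaussian_le hX hindep hlaw (hh n) h2 t h3 hδ).trans_lt ?_
    have h5 : 18 * t ^ 2 * δ ≤ ε / 2 := by
      rw [hδ_def, ← mul_div_assoc, div_le_iff₀ (by positivity)]
      nlinarith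
    linarith

/-! ### Families of distinct indices -/

section Embeddings

variable {ι κ : Type} [Fintype ι] [DecidableEq ι] [Fintype κ] [DecidableEq κ] {n : ℕ}

/-- A permutation of `Fin n` that carries x to y acts by composition and exchanges the two sets of
extensions. -/
lemma card_embeddings_extending_eq (u : κ ↪ ι) (x y : κ ↪ Fin n) :
    (Finset.univ.filter fun e : ι ↪ Fin n => u.trans e = x).card
      = (Finset.univ.filter fun e : ι ↪ Fin n => u.trans e = y).card := by
  obtain ⟨σ, hσ⟩ := Equiv.Perm.exists_extending_pair x y x.injective y.injective
  refine Finset.card_bij' (fun e _ => e.trans σ.toEmbedding) (fun e _ => e.trans σ.symm.toEmbedding)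
    ?_ ?_ ?_ ?_
  · intro e he
    simp only [Finset.mem_filter, Finset.mem_univ, true_and] at he ⊢
    ext s
    have := DFunLike.congr_fun he s
    simp only [Function.Embedding.trans_apply] at this
    simp [this, ← hσ]
  · intro e he
    simp only [Finset.mem_filter, Finset.mem_univ, true_and] at he ⊢
    ext s
    have := DFunLike.congr_fun he s
    simp only [Function.Embedding.trans_apply] at this
    simp [this, ← hσ]
  · intro e _
    ext s
    simp
  · intro e _
    ext s
    simp

/-- Double counting: the fibres of restriction along u all have the same size. -/
lemma card_embeddings_extending_mul (u : κ ↪ ι) (x : κ ↪ Fin n) :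
    (Finset.univ.filter fun e : ι ↪ Fin n => u.trans e = x).card * n.descFactorial (Fintype.card κ)
      = n.descFactorial (Fintype.card ι) := by
  have h := Finset.card_eq_sum_card_fiberwise (f := fun e : ι ↪ Fin n => u.trans e)
    (s := Finset.univ) (t := Finset.univ) (fun _ _ => Finset.mem_coe.2 (Finset.mem_univ _))
  rw [Finset.sum_congr rfl fun y _ => card_embeddings_extending_eq u y x, Finset.sum_const,
    Finset.card_univ, Finset.card_univ, Fintype.card_embedding_eq, Fintype.card_embedding_eq,
    Fintype.card_fin, smul_eq_mul] at h
  rw [h, mul_comm]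

lemma factorial_ratio (h : Fintype.card ι ≤ n) :
    (((n - Fintype.card ι)! : ℝ) / (n ! : ℝ)) = ((n.descFactorial (Fintype.card ι) : ℕ) : ℝ)⁻¹ := by
  rw [← Nat.factorial_mul_descFactorial h]
  have : ((n - Fintype.card ι)! : ℝ) ≠ 0 := by exact_mod_cast Nat.factorial_ne_zero _
  push_cast
  field_simp

lemma uStat_eq (h : Fintype.card ι ≤ n) (f : (ι → Fin n) → ℝ) :
    uStat n f = ((n.descFactorial (Fintype.card ι) : ℕ) : ℝ)⁻¹ * ∑ i : ι ↪ Fin n, f i := by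
  rw [uStat, factorial_ratio h]

lemma descFactorial_pos {m : ℕ} (h : m ≤ n) : (0 : ℝ) < (n.descFactorial m : ℕ) := by
  exact_mod_cast Nat.pos_of_ne_zero fun h0 => by
    rw [Nat.descFactorial_eq_zero_iff_lt] at h0
    omega

/-- A U-statistic whose kernel depends only on some of its indices. -/
lemma uStat_comp (u : κ ↪ ι) (h : Fintype.card ι ≤ n) (f : (κ → Fin n) → ℝ) :
    uStat n (fun i : ι → Fin n => f (fun s => i (u s))) = uStat n f := by
  have hκ : Fintype.card κ ≤ n := (Fintype.card_le_of_embedding u).trans h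
  rw [uStat_eq h, uStat_eq hκ]
  have h1 : ∑ i : ι ↪ Fin n, f (fun s => i (u s)) = ∑ x : κ ↪ Fin n,
      (Finset.univ.filter fun e : ι ↪ Fin n => u.trans e = x).card * f x := by
    rw [← Finset.sum_fiberwise_of_maps_to (g := fun e : ι ↪ Fin n => u.trans e)
      (t := Finset.univ) (fun _ _ => Finset.mem_univ _)]
    refine Finset.sum_congr rfl fun x _ => ?_
    rw [← nsmul_eq_mul, ← Finset.sum_const]
    refine Finset.sum_congr rfl fun e he => ?_
    rw [Finset.mem_filter] at he
    rw [← he.2]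
    rfl
  rw [h1, Finset.mul_sum, Finset.mul_sum]
  refine Finset.sum_congr rfl fun x _ => ?_
  have h2 := card_embeddings_extending_mul u x
  have h3 := descFactorial_pos h
  have h4 := descFactorial_pos hκ
  rw [← h2] at h3 ⊢
  push_cast at h3 ⊢
  have h5 : ((Finset.univ.filter fun e : ι ↪ Fin n => u.trans e = x).card : ℝ) ≠ 0 := by
    intro h0
    rw [h0, zero_mul] at h3
    exact lt_irrefl _ h3
  field_simp

lemma uStat_add (f g : (ι → Fin n) → ℝ) :
    uStat n (fun i => f i + g i) = uStat n f + uStat n g := by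
  simp only [uStat, Finset.sum_add_distrib, mul_add]

lemma uStat_sub (f g : (ι → Fin n) → ℝ) :
    uStat n (fun i => f i - g i) = uStat n f - uStat n g := by
  simp only [uStat, Finset.sum_sub_distrib, mul_sub]

lemma uStat_const (h : Fintype.card ι ≤ n) (c : ℝ) : uStat n (fun _ : ι → Fin n => c) = c := by
  rw [uStat_eq h, Finset.sum_const, Finset.card_univ, Fintype.card_embedding_eq, Fintype.card_fin,
    nsmul_eq_mul, inv_mul_cancel_left₀ (descFactorial_pos h).ne']

/-- At least `r` of the indices in `e` occur in `e'`. -/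
def Overlap (r : ℕ) (e e' : ι ↪ Fin n) : Prop := ∃ v : Fin r ↪ ι, ∀ s, e (v s) ∈ Set.range e'

noncomputable instance (r : ℕ) (e e' : ι ↪ Fin n) : Decidable (Overlap r e e') :=
  Classical.propDecidable _

/-- Choosing which r places of e recur, and at which places of e', prescribes e' at r places. A
union bound over these choices shows that an overlap of order r has frequency O(n^{-r}). -/
lemma card_overlap_mul_le (r : ℕ) (e : ι ↪ Fin n) :
    (Finset.univ.filter fun e' : ι ↪ Fin n => Overlap r e e').card * n.descFactorial r
      ≤ Fintype.card (Fin r ↪ ι) ^ 2 * n.descFactorial (Fintype.card ι) := by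
  have hsub : (Finset.univ.filter fun e' : ι ↪ Fin n => Overlap r e e')
      ⊆ Finset.univ.biUnion fun q : (Fin r ↪ ι) × (Fin r ↪ ι) =>
        Finset.univ.filter fun e' : ι ↪ Fin n => q.2.trans e' = q.1.trans e := by
    intro e' he'
    rw [Finset.mem_filter] at he'
    obtain ⟨v, hv⟩ := he'.2
    choose w hw using hv
    have hwi : Function.Injective w := fun a b hab => by
      have h1 := hw a
      rw [hab, hw b] at h1
      exact (v.injective (e.injective h1)).symm
    rw [Finset.mem_biUnion]
    refine ⟨(v, ⟨w, hwi⟩), Finset.mem_univ _, ?_⟩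
    rw [Finset.mem_filter]
    refine ⟨Finset.mem_univ _, ?_⟩
    ext s
    simp [hw s]
  calc _ ≤ (∑ q : (Fin r ↪ ι) × (Fin r ↪ ι),
        (Finset.univ.filter fun e' : ι ↪ Fin n => q.2.trans e' = q.1.trans e).card)
          * n.descFactorial r :=
        Nat.mul_le_mul_right _ ((Finset.card_le_card hsub).trans Finset.card_biUnion_le)
    _ = ∑ q : (Fin r ↪ ι) × (Fin r ↪ ι), n.descFactorial (Fintype.card ι) := by
        rw [Finset.sum_mul]
        refine Finset.sum_congr rfl fun q _ => ?_
        have := card_embeddings_extending_mul q.2 (q.1.trans e)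
        rw [Fintype.card_fin] at this
        exact this
    _ = _ := by
        rw [Finset.sum_const, Finset.card_univ, Fintype.card_prod, smul_eq_mul, sq]

variable {Ω : Type*} [MeasurableSpace Ω] {μ : Measure Ω} [IsProbabilityMeasure μ]

lemma integral_uStat_le (h : Fintype.card ι ≤ n) {Y : (ι → Fin n) → Ω → ℝ}
    (hY : ∀ i, IsBddMeas (Y i)) {B : ℝ} (hB : ∀ i : ι ↪ Fin n, ∫ ω, Y i ω ∂μ ≤ B) :
    ∫ ω, uStat n (fun i => Y i ω) ∂μ ≤ B := by
  simp_rw [uStat_eq h]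
  rw [integral_const_mul, integral_finsetSum (f := fun (i : ι ↪ Fin n) ω => Y i ω) _
    fun i _ => (hY i).integrable μ]
  refine (mul_le_mul_of_nonneg_left (Finset.sum_le_sum fun i _ => hB i) (by positivity)).trans_eq ?_
  rw [Finset.sum_const, Finset.card_univ, Fintype.card_embedding_eq, Fintype.card_fin,
    nsmul_eq_mul, inv_mul_cancel_left₀ (descFactorial_pos h).ne']

/-- The second moment of a U-statistic for which the products of two terms have small expectation
unless they have many indices in common. -/
lemma integral_uStat_sq_le (h : Fintype.card ι ≤ n) {Y : (ι → Fin n) → Ω → ℝ}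
    (hY : ∀ i, IsBddMeas (Y i)) {r r' : ℕ} (hr : r ≤ n) (hr' : r' ≤ n) {B B' : ℝ}
    (hB0 : 0 ≤ B) (hB0' : 0 ≤ B')
    (hB : ∀ e e' : ι ↪ Fin n, ∫ ω, Y e ω * Y e' ω ∂μ
      ≤ (if Overlap r e e' then B else 0) + (if Overlap r' e e' then B' else 0)) :
    ∫ ω, uStat n (fun i => Y i ω) ^ 2 ∂μ
      ≤ B * (Fintype.card (Fin r ↪ ι) ^ 2 / n.descFactorial r)
        + B' * (Fintype.card (Fin r' ↪ ι) ^ 2 / n.descFactorial r') := by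
  set N : ℝ := ((n.descFactorial (Fintype.card ι) : ℕ) : ℝ) with hN
  have hN0 : 0 < N := descFactorial_pos h
  have key : ∀ {r : ℕ}, r ≤ n → ∀ {B : ℝ}, 0 ≤ B → ∀ e : ι ↪ Fin n,
      ∑ e' : ι ↪ Fin n, (if Overlap r e e' then B else 0)
        ≤ N * (B * (Fintype.card (Fin r ↪ ι) ^ 2 / n.descFactorial r)) := by
    intro r hr B hB e
    rw [← Finset.sum_filter, Finset.sum_const, nsmul_eq_mul]
    have h1 : ((Finset.univ.filter fun e' : ι ↪ Fin n => Overlap r e e').card : ℝ)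
        * n.descFactorial r ≤ Fintype.card (Fin r ↪ ι) ^ 2 * N := by
      rw [hN]
      exact_mod_cast card_overlap_mul_le r e
    have h2 := descFactorial_pos hr
    have h3 : ((Finset.univ.filter fun e' : ι ↪ Fin n => Overlap r e e').card : ℝ)
        ≤ Fintype.card (Fin r ↪ ι) ^ 2 * N / n.descFactorial r := by
      rwa [le_div_iff₀ h2]
    calc _ ≤ Fintype.card (Fin r ↪ ι) ^ 2 * N / n.descFactorial r * B :=
          mul_le_mul_of_nonneg_right h3 hB
      _ = _ := by ring
  have hsq : ∀ ω, uStat n (fun i => Y i ω) ^ 2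
      = (N⁻¹ * N⁻¹) * ∑ e : ι ↪ Fin n, ∑ e' : ι ↪ Fin n, Y e ω * Y e' ω := fun ω => by
    rw [uStat_eq h, mul_pow, sq, sq, Finset.sum_mul_sum]
  have hint : ∀ e : ι ↪ Fin n, Integrable (fun ω => ∑ e' : ι ↪ Fin n, Y e ω * Y e' ω) μ :=
    fun e => (IsBddMeas.sum (f := fun (e' : ι ↪ Fin n) ω => Y e ω * Y e' ω) _
      fun e' _ => (hY e).mul (hY e')).integrable μ
  simp_rw [hsq]
  rw [integral_const_mul, integral_finsetSum _ fun e _ => hint e]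
  have hle : ∑ e : ι ↪ Fin n, ∫ ω, ∑ e' : ι ↪ Fin n, Y e ω * Y e' ω ∂μ
      ≤ ∑ e : ι ↪ Fin n, (N * (B * (Fintype.card (Fin r ↪ ι) ^ 2 / n.descFactorial r))
        + N * (B' * (Fintype.card (Fin r' ↪ ι) ^ 2 / n.descFactorial r'))) := by
    refine Finset.sum_le_sum fun e _ => ?_
    rw [integral_finsetSum (f := fun (e' : ι ↪ Fin n) ω => Y e ω * Y e' ω) _
      fun e' _ => ((hY e).mul (hY e')).integrable μ]
    refine (Finset.sum_le_sum fun e' _ => hB e e').trans ?_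
    rw [Finset.sum_add_distrib]
    exact add_le_add (key hr hB0 e) (key hr' hB0' e)
  refine (mul_le_mul_of_nonneg_left hle (by positivity)).trans_eq ?_
  rw [Finset.sum_const, Finset.card_univ, Fintype.card_embedding_eq, Fintype.card_fin,
    nsmul_eq_mul, ← hN]
  field_simp

end Embeddings

/-! ### Gaussian kernels and characteristic functions -/

lemma gauss_nonneg {E : Type*} [NormedAddCommGroup E] (ν : ℝ) (x y : E) : 0 ≤ gauss ν x y :=
  (Real.exp_pos _).le

lemma gauss_le_one {E : Type*} [NormedAddCommGroup E] {ν : ℝ} (hν : 0 ≤ ν) (x y : E) :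
    gauss ν x y ≤ 1 := by
  refine Real.exp_le_one_iff.2 ?_
  have : 0 ≤ ν * ‖x - y‖ ^ 2 := by positivity
  linarith

lemma gauss_comm {E : Type*} [NormedAddCommGroup E] (ν : ℝ) (x y : E) :
    gauss ν x y = gauss ν y x := by
  rw [gauss, gauss, norm_sub_rev]

lemma gauss_sq {E : Type*} [NormedAddCommGroup E] (ν : ℝ) (x y : E) :
    gauss ν x y ^ 2 = gauss (2 * ν) x y := by
  rw [gauss, gauss, ← Real.exp_nat_mul]
  congr 1
  push_cast
  ring

section Fourier

variable {m : ℕ}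

lemma isBddMeas_gauss {ν : ℝ} (hν : 0 ≤ ν) : IsBddMeas fun p : EuclideanSpace ℝ (Fin m) ×
    EuclideanSpace ℝ (Fin m) => gauss ν p.1 p.2 :=
  ⟨by unfold gauss; fun_prop, 1, fun p => by
    rw [abs_of_nonneg (gauss_nonneg _ _ _)]; exact gauss_le_one hν _ _⟩

/-- The Gaussian weight `exp(-‖w‖² / (4ν))`. -/
noncomputable def gaussWeight (ν : ℝ) (w : EuclideanSpace ℝ (Fin m)) : ℝ := Real.exp
  (-(4 * ν)⁻¹ * ‖w‖ ^ 2)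

lemma gaussWeight_pos (ν : ℝ) (w : EuclideanSpace ℝ (Fin m)) : 0 < gaussWeight ν w := Real.exp_pos _

lemma gaussWeight_le_one {ν : ℝ} (hν : 0 < ν) (w : EuclideanSpace ℝ (Fin m)) : gaussWeight ν w ≤ 1
    := by
  refine Real.exp_le_one_iff.2 ?_
  have : 0 ≤ (4 * ν)⁻¹ * ‖w‖ ^ 2 := by positivity
  linarith

lemma gaussWeight_mono {ν ν' : ℝ} (hν : 0 < ν) (h : ν ≤ ν') (w : EuclideanSpace ℝ (Fin m)) :
    gaussWeight ν w ≤ gaussWeight ν' w := by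
  refine Real.exp_le_exp.2 ?_
  have : (4 * ν')⁻¹ ≤ (4 * ν)⁻¹ := by gcongr
  have := mul_le_mul_of_nonneg_right this (sq_nonneg ‖w‖)
  linarith

lemma measurable_gaussWeight (ν : ℝ) : Measurable (gaussWeight ν : EuclideanSpace ℝ (Fin m) → ℝ) :=
    by
  unfold gaussWeight
  fun_prop

lemma integrable_rexp_neg_mul_sq_norm {b : ℝ} (hb : 0 < b) :
    Integrable fun w : EuclideanSpace ℝ (Fin m) => Real.exp (-b * ‖w‖ ^ 2) := by
  have h := (GaussianFourier.integrable_cexp_neg_mul_sq_norm_add (V := EuclideanSpace ℝ (Fin m))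
    (show 0 < (b : ℂ).re from hb) 0 0).norm
  refine h.congr (ae_of_all _ fun w => ?_)
  simp only [Complex.norm_exp]
  norm_cast
  simp

lemma integrable_gaussWeight {ν : ℝ} (hν : 0 < ν) : Integrable
    (gaussWeight ν : EuclideanSpace ℝ (Fin m) → ℝ) :=
  integrable_rexp_neg_mul_sq_norm (by positivity)

lemma integral_gaussWeight_sq {ν : ℝ} (hν : 0 < ν) :
    Integrable (fun w : EuclideanSpace ℝ (Fin m) => gaussWeight ν w ^ 2) ∧
    ∫ w : EuclideanSpace ℝ (Fin m), gaussWeight ν w ^ 2 = (2 * Real.pi * ν) ^ ((m : ℝ) / 2) := by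
  have e : ∀ w : EuclideanSpace ℝ (Fin m), gaussWeight ν w ^ 2 = Real.exp (-(2 * ν)⁻¹ * ‖w‖ ^ 2) :=
      fun w => by
    rw [gaussWeight, ← Real.exp_nat_mul]
    congr 1
    push_cast
    field_simp
    ring
  simp_rw [e]
  refine ⟨integrable_rexp_neg_mul_sq_norm (by positivity), ?_⟩
  rw [GaussianFourier.integral_rexp_neg_mul_sq_norm (by positivity)]
  simp only [finrank_euclideanSpace, Fintype.card_fin]
  congr 1
  field_simp

/-- The Gaussian kernel as a Fourier transform. -/
lemma integral_gaussWeight_mul_cexp {ν : ℝ} (hν : 0 < ν) (x : EuclideanSpace ℝ (Fin m)) :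
    ∫ w : EuclideanSpace ℝ (Fin m), (gaussWeight ν w : ℂ) * Complex.exp
      (((inner ℝ x w : ℝ) : ℂ) * Complex.I)
      = (((4 * Real.pi * ν) ^ ((m : ℝ) / 2) * Real.exp (-ν * ‖x‖ ^ 2) : ℝ) : ℂ) := by
  have h := GaussianFourier.integral_cexp_neg_mul_sq_norm_add (V := EuclideanSpace ℝ (Fin m))
    (b := (((4 * ν)⁻¹ : ℝ) : ℂ)) (by rw [Complex.ofReal_re]; positivity) Complex.I x
  have e : ∀ w : EuclideanSpace ℝ (Fin m), (gaussWeight ν w : ℂ) * Complex.exp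
      (((inner ℝ x w : ℝ) : ℂ) * Complex.I)
      = Complex.exp (-(((4 * ν)⁻¹ : ℝ) : ℂ) * ‖w‖ ^ 2 + Complex.I * ((inner ℝ x w : ℝ) : ℂ)) :=
    fun w => by
      rw [gaussWeight, Complex.ofReal_exp, ← Complex.exp_add]
      congr 1
      push_cast
      ring
  simp_rw [e]
  rw [h, Complex.ofReal_mul, Complex.ofReal_exp, Complex.ofReal_cpow (by positivity)]
  simp only [finrank_euclideanSpace, Fintype.card_fin]
  have hν' : (ν : ℂ) ≠ 0 := by exact_mod_cast hν.ne'
  congr 1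
  · congr 1
    · push_cast
      field_simp
    · push_cast
      ring
  · congr 1
    rw [Complex.I_sq]
    push_cast
    field_simp

variable {Q : Measure (EuclideanSpace ℝ (Fin m))} [IsProbabilityMeasure Q]

lemma measurable_charFun' : Measurable (charFun Q : EuclideanSpace ℝ (Fin m) → ℂ) := by
  have : Continuous (charFun Q) := by fun_prop
  exact this.measurable

lemma norm_charFun_le_one' (w : EuclideanSpace ℝ (Fin m)) : ‖charFun Q w‖ ≤ 1 := by
  simpa using norm_charFun_le_one (μ := Q) w

/-- Write the Gaussian kernel as a Fourier integral and apply Fubini; integrating the phase in y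
against Q produces the characteristic function. -/
lemma integral_gauss_eq {ν : ℝ} (hν : 0 < ν) (x : EuclideanSpace ℝ (Fin m)) :
    (((4 * Real.pi * ν) ^ ((m : ℝ) / 2) * ∫ y, gauss ν x y ∂Q : ℝ) : ℂ)
      = ∫ w : EuclideanSpace ℝ (Fin m), (gaussWeight ν w : ℂ) *
        (Complex.exp (((inner ℝ (-x) w : ℝ) : ℂ) * Complex.I)
        * charFun Q w) := by
  have h1 : ∀ y : EuclideanSpace ℝ (Fin m), (((4 * Real.pi * ν) ^ ((m : ℝ) / 2) * gauss ν x y : ℝ) :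
      ℂ)
      = ∫ w : EuclideanSpace ℝ (Fin m), (gaussWeight ν w : ℂ)
        * Complex.exp (((inner ℝ (y - x) w : ℝ) : ℂ) * Complex.I) := fun y => by
    rw [integral_gaussWeight_mul_cexp hν, gauss, norm_sub_rev]
  rw [← integral_const_mul, ← integral_complex_ofReal]
  simp_rw [h1]
  rw [integral_integral_swap]
  · refine integral_congr_ae (ae_of_all _ fun w => ?_)
    simp only
    have e : ∀ y, Complex.exp (((inner ℝ (y - x) w : ℝ) : ℂ) * Complex.I)
        = Complex.exp (((inner ℝ (-x) w : ℝ) : ℂ) * Complex.I)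
          * Complex.exp (((inner ℝ y w : ℝ) : ℂ) * Complex.I) := fun y => by
      rw [← Complex.exp_add, sub_eq_add_neg, inner_add_left]
      congr 1
      push_cast
      ring
    simp_rw [e]
    rw [integral_const_mul, integral_const_mul, charFun_apply]
  · refine Integrable.mono' (g := fun p => 1 * gaussWeight ν p.2)
      ((integrable_const (1 : ℝ)).mul_prod (integrable_gaussWeight hν)) ?_ (ae_of_all _ fun p => ?_)
    · refine Measurable.aestronglyMeasurable ?_
      refine Measurable.mul ?_ ?_
      · exact Complex.measurable_ofReal.comp ((measurable_gaussWeight ν).comp measurable_snd)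
      · fun_prop
    · simp only [Function.uncurry, norm_mul, Complex.norm_exp_ofReal_mul_I, mul_one, one_mul,
        Complex.norm_real, Real.norm_eq_abs, abs_of_pos (gaussWeight_pos ν p.2), le_refl]

/-- The point x enters the Fourier formula only through a phase, so the triangle inequality gives a
bound uniform in x. -/
lemma integral_gauss_le {ν : ℝ} (hν : 0 < ν) (x : EuclideanSpace ℝ (Fin m)) :
    (4 * Real.pi * ν) ^ ((m : ℝ) / 2) * ∫ y, gauss ν x y ∂Q
      ≤ ∫ w : EuclideanSpace ℝ (Fin m), gaussWeight ν w * ‖charFun Q w‖ := by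
  have h0 : 0 ≤ (4 * Real.pi * ν) ^ ((m : ℝ) / 2) * ∫ y, gauss ν x y ∂Q :=
    mul_nonneg (by positivity) (integral_nonneg fun y => gauss_nonneg _ _ _)
  rw [← abs_of_nonneg h0, ← Real.norm_eq_abs, ← Complex.norm_real, integral_gauss_eq hν]
  refine (norm_integral_le_integral_norm _).trans_eq ?_
  simp only [norm_mul, Complex.norm_exp_ofReal_mul_I, one_mul, Complex.norm_real,
    Real.norm_eq_abs, abs_of_pos (gaussWeight_pos ν _)]

/-- Integrating the remaining phase gives the conjugate characteristic function, hence its squared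
modulus. -/
lemma integral_integral_gauss_eq {ν : ℝ} (hν : 0 < ν) :
    (4 * Real.pi * ν) ^ ((m : ℝ) / 2) * ∫ x, ∫ y, gauss ν x y ∂Q ∂Q
      = ∫ w : EuclideanSpace ℝ (Fin m), gaussWeight ν w * ‖charFun Q w‖ ^ 2 := by
  rw [← Complex.ofReal_inj, ← integral_const_mul, ← integral_complex_ofReal,
    ← integral_complex_ofReal]
  simp_rw [integral_gauss_eq hν]
  rw [integral_integral_swap]
  · refine integral_congr_ae (ae_of_all _ fun w => ?_)
    simp only
    rw [integral_const_mul, integral_mul_const]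
    have : ∫ x, Complex.exp (((inner ℝ (-x) w : ℝ) : ℂ) * Complex.I) ∂Q
        = (starRingEnd ℂ) (charFun Q w) := by
      rw [← charFun_neg, charFun_apply]
      simp only [inner_neg_left, inner_neg_right]
    rw [this, mul_comm ((starRingEnd ℂ) _), Complex.mul_conj, Complex.normSq_eq_norm_sq]
    push_cast
    rfl
  · refine Integrable.mono' (g := fun p => 1 * gaussWeight ν p.2)
      ((integrable_const (1 : ℝ)).mul_prod (integrable_gaussWeight hν)) ?_ (ae_of_all _ fun p => ?_)
    · refine Measurable.aestronglyMeasurable ?_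
      refine Measurable.mul ?_ (Measurable.mul ?_ ?_)
      · exact Complex.measurable_ofReal.comp ((measurable_gaussWeight ν).comp measurable_snd)
      · fun_prop
      · exact measurable_charFun'.comp measurable_snd
    · simp only [Function.uncurry, norm_mul, Complex.norm_exp_ofReal_mul_I, one_mul,
        Complex.norm_real, Real.norm_eq_abs, abs_of_pos (gaussWeight_pos ν p.2)]
      exact mul_le_of_le_one_right (gaussWeight_pos ν _).le (norm_charFun_le_one' _)

/-- The expectation of a Gaussian kernel is of exact order `ν^{-m/2}` if the characteristic function
is square integrable. -/
lemma exists_bounds_integral_gauss (hQ : Integrable fun w : EuclideanSpace ℝ (Fin m) => ‖charFun Q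
    w‖ ^ 2) :
    ∃ c C : ℝ, 0 < c ∧ 0 < C ∧ ∀ ν : ℝ, 1 ≤ ν →
      c ≤ ν ^ ((m : ℝ) / 2) * ∫ x, ∫ y, gauss ν x y ∂Q ∂Q ∧
      ν ^ ((m : ℝ) / 2) * ∫ x, ∫ y, gauss ν x y ∂Q ∂Q ≤ C := by
  have hπ : 0 < (4 * Real.pi) ^ ((m : ℝ) / 2) := by positivity
  have key : ∀ ν : ℝ, 0 < ν → ν ^ ((m : ℝ) / 2) * ∫ x, ∫ y, gauss ν x y ∂Q ∂Q
      = ((4 * Real.pi) ^ ((m : ℝ) / 2))⁻¹ * ∫ w : EuclideanSpace ℝ (Fin m), gaussWeight ν w *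
        ‖charFun Q w‖ ^ 2 := by
    intro ν hν
    rw [← integral_integral_gauss_eq hν, Real.mul_rpow (by positivity) hν.le]
    field_simp
  have hint : ∀ ν : ℝ, 0 < ν → Integrable fun w : EuclideanSpace ℝ (Fin m) => gaussWeight ν w *
      ‖charFun Q w‖ ^ 2 := by
    intro ν hν
    refine hQ.mono' ((measurable_gaussWeight ν).mul
      (measurable_charFun'.norm.pow_const 2)).aestronglyMeasurable (ae_of_all _ fun w => ?_)
    rw [Real.norm_eq_abs, abs_of_nonneg (mul_nonneg (gaussWeight_pos ν w).le (sq_nonneg _))]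
    exact mul_le_of_le_one_left (sq_nonneg _) (gaussWeight_le_one hν w)
  -- By `key` the rescaled mean is nondecreasing in ν, since the Gaussian weight is. Its value at ν
  -- = 1 is therefore a lower bound, positive because the kernel is. The + 1 only secures a positive
  -- upper constant.
  refine ⟨∫ x, ∫ y, gauss 1 x y ∂Q ∂Q, ((4 * Real.pi) ^ ((m : ℝ) / 2))⁻¹
    * (∫ w : EuclideanSpace ℝ (Fin m), ‖charFun Q w‖ ^ 2) + 1, ?_, ?_, fun ν hν => ⟨?_, ?_⟩⟩
  · have hb := isBddMeas_gauss (m := m) zero_le_one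
    have hb' : IsBddMeas fun x : EuclideanSpace ℝ (Fin m) => ∫ y, gauss 1 x y ∂Q :=
        IsBddMeas.integral hb Q
    have hp : ∀ x : EuclideanSpace ℝ (Fin m), 0 < ∫ y, gauss 1 x y ∂Q := fun x => by
      rw [integral_pos_iff_support_of_nonneg (fun y => gauss_nonneg _ _ _)
        ((IsBddMeas.left (f := fun x y : EuclideanSpace ℝ (Fin m) => gauss 1 x y) hb x).integrable
          Q)]
      have : Function.support (fun y : EuclideanSpace ℝ (Fin m) => gauss 1 x y) = Set.univ :=
        Set.eq_univ_of_forall fun y => (Real.exp_pos _).ne'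
      simp [this]
    rw [integral_pos_iff_support_of_nonneg (fun x => (hp x).le) (hb'.integrable Q)]
    have : Function.support (fun x : EuclideanSpace ℝ (Fin m) => ∫ y, gauss 1 x y ∂Q) = Set.univ :=
      Set.eq_univ_of_forall fun x => (hp x).ne'
    simp [this]
  · have : 0 ≤ ∫ w : EuclideanSpace ℝ (Fin m), ‖charFun Q w‖ ^ 2 := integral_nonneg fun w =>
    sq_nonneg _
    positivity
  · have h1 := key 1 one_pos
    rw [Real.one_rpow, one_mul] at h1
    rw [h1, key ν (by linarith)]
    refine mul_le_mul_of_nonneg_left (integral_mono (hint 1 one_pos) (hint ν (by linarith))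
      fun w => ?_) (by positivity)
    exact mul_le_mul_of_nonneg_right (gaussWeight_mono one_pos hν w) (sq_nonneg _)
  · rw [key ν (by linarith)]
    refine (mul_le_mul_of_nonneg_left (integral_mono (hint ν (by linarith)) hQ
      fun w => mul_le_of_le_one_left (sq_nonneg _) (gaussWeight_le_one (by linarith) w))
      (by positivity)).trans (by linarith)

/-- The supremum of a Gaussian mean embedding is `o(ν^{-m/4})` if the characteristic function is
square integrable. -/
lemma exists_bound_integral_gauss (hm : 1 ≤ m) (hQ : Integrable fun w : EuclideanSpace ℝ (Fin m) =>
    ‖charFun Q w‖ ^ 2) :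
    ∃ b : ℝ → ℝ, (∀ ν, 0 < ν → ∀ x : EuclideanSpace ℝ (Fin m), ∫ y, gauss ν x y ∂Q ≤ b ν) ∧
      Tendsto (fun ν : ℝ => ν ^ ((m : ℝ) / 4) * b ν) atTop (𝓝 0) := by
  have hm' : (1 : ℝ) ≤ m := by exact_mod_cast hm
  refine ⟨fun ν => ((4 * Real.pi * ν) ^ ((m : ℝ) / 2))⁻¹ * ∫ w : EuclideanSpace ℝ (Fin m),
    gaussWeight ν w * ‖charFun Q w‖,
    fun ν hν x => ?_, ?_⟩
  · have h := integral_gauss_le (Q := Q) hν x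
    have hp : 0 < (4 * Real.pi * ν) ^ ((m : ℝ) / 2) := by positivity
    simp only [inv_mul_eq_div]
    rw [le_div_iff₀ hp]
    linarith
  suffices H : Tendsto (fun ν : ℝ => ν ^ (-((m : ℝ) / 4)) * ∫ w : EuclideanSpace ℝ (Fin m),
      gaussWeight ν w * ‖charFun Q w‖)
      atTop (𝓝 0) by
    have := H.const_mul ((4 * Real.pi) ^ ((m : ℝ) / 2))⁻¹
    rw [mul_zero] at this
    refine this.congr' ?_
    filter_upwards [eventually_gt_atTop 0] with ν hν
    rw [Real.mul_rpow (by positivity) hν.le, mul_inv, ← Real.rpow_neg hν.le]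
    have : ν ^ (-((m : ℝ) / 4)) = ν ^ ((m : ℝ) / 4) * ν ^ (-((m : ℝ) / 2)) := by
      rw [← Real.rpow_add hν]
      congr 1
      ring
    rw [this]
    ring
  -- Cauchy-Schwarz on the whole space would give only O(ν^{-m/4}). To gain the little-o, a ball is
  -- removed: inside it the integral stays bounded as ν grows, and outside it the characteristic
  -- function has small L² norm.
  have htail : Tendsto (fun R : ℕ => ∫ w in (Metric.ball (0 : EuclideanSpace ℝ (Fin m)) R)ᶜ,
      ‖charFun Q w‖ ^ 2) atTop
      (𝓝 0) := by
    have h := tendsto_setIntegral_of_antitone (μ := (volume : Measure (EuclideanSpace ℝ (Fin m))))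
      (f := fun w => ‖charFun Q w‖ ^ 2) (s := fun R : ℕ =>
        (Metric.ball (0 : EuclideanSpace ℝ (Fin m)) R)ᶜ)
      (fun R => Metric.isOpen_ball.measurableSet.compl)
      (fun R S hRS => Set.compl_subset_compl.2 (Metric.ball_subset_ball (by exact_mod_cast hRS)))
      ⟨0, hQ.integrableOn⟩
    have he : ⋂ R : ℕ, (Metric.ball (0 : EuclideanSpace ℝ (Fin m)) R)ᶜ = ∅ := by
      rw [← Set.compl_iUnion, Metric.iUnion_ball_nat, Set.compl_univ]
    rw [he] at h
    simpa using h
  rw [Metric.tendsto_atTop]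
  intro ε hε
  -- With q = ν^{m/4}, the squared L² norm of the Gaussian weight is Kq². The AM-GM weight η and the
  -- radius R are chosen so that each of the two terms from outside the ball is at most ε/4; the
  -- ball itself contributes less than ε/2.
  set K := (2 * Real.pi) ^ ((m : ℝ) / 2) with hK
  have hK0 : 0 < K := by positivity
  set η := ε / (2 * K) with hη
  have hη0 : 0 < η := by positivity
  obtain ⟨R, hR⟩ := (htail.eventually (gt_mem_nhds (show 0 < ε * η / 2 by positivity))).exists
  have hvol : Tendsto (fun ν : ℝ => ν ^ (-((m : ℝ) / 4))
      * (volume : Measure (EuclideanSpace ℝ (Fin m))).real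
        (Metric.ball (0 : EuclideanSpace ℝ (Fin m)) R)) atTop (𝓝 0) := by
    have := (tendsto_rpow_neg_atTop (show 0 < (m : ℝ) / 4 by positivity)).mul_const
      ((volume : Measure (EuclideanSpace ℝ (Fin m))).real
        (Metric.ball (0 : EuclideanSpace ℝ (Fin m)) R))
    rwa [zero_mul] at this
  obtain ⟨ν₀, hν₀⟩ := ((hvol.eventually (gt_mem_nhds (show 0 < ε / 2 by positivity))).and
    (eventually_gt_atTop 0)).exists_forall_of_atTop
  refine ⟨ν₀, fun ν hν => ?_⟩
  obtain ⟨h1, hνpos⟩ := hν₀ ν hν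
  have hball : MeasurableSet (Metric.ball (0 : EuclideanSpace ℝ (Fin m)) R) :=
      Metric.isOpen_ball.measurableSet
  set q := ν ^ ((m : ℝ) / 4) with hq
  have hq0 : 0 < q := by positivity
  have hqinv : ν ^ (-((m : ℝ) / 4)) = q⁻¹ := Real.rpow_neg hνpos.le _
  have hqq : ν ^ ((m : ℝ) / 2) = q * q := by
    rw [hq, ← Real.rpow_add hνpos]
    congr 1
    ring
  obtain ⟨hW2i, hW2⟩ := integral_gaussWeight_sq (m := m) hνpos
  have hWφ : Integrable fun w : EuclideanSpace ℝ (Fin m) => gaussWeight ν w * ‖charFun Q w‖ := by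
    refine (integrable_gaussWeight hνpos).mono' ((measurable_gaussWeight ν).mul
      measurable_charFun'.norm).aestronglyMeasurable (ae_of_all _ fun w => ?_)
    rw [Real.norm_eq_abs, abs_of_nonneg (mul_nonneg (gaussWeight_pos ν w).le (norm_nonneg _))]
    exact mul_le_of_le_one_right (gaussWeight_pos ν w).le (norm_charFun_le_one' w)
  have hin : ∫ w in Metric.ball (0 : EuclideanSpace ℝ (Fin m)) R, gaussWeight ν w * ‖charFun Q w‖
      ≤ (volume : Measure (EuclideanSpace ℝ (Fin m))).real
        (Metric.ball (0 : EuclideanSpace ℝ (Fin m)) R) := by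
    calc _ ≤ ∫ w in Metric.ball (0 : EuclideanSpace ℝ (Fin m)) R, (1 : ℝ) := by
          refine setIntegral_mono hWφ.integrableOn
            (integrableOn_const measure_ball_lt_top.ne) fun w => ?_
          exact mul_le_one₀ (gaussWeight_le_one hνpos w) (norm_nonneg _) (norm_charFun_le_one' w)
      _ = _ := by simp
  have hout : ∫ w in (Metric.ball (0 : EuclideanSpace ℝ (Fin m)) R)ᶜ, gaussWeight ν w * ‖charFun Q
      w‖
      ≤ q / (2 * η) * (∫ w in (Metric.ball (0 : EuclideanSpace ℝ (Fin m)) R)ᶜ, ‖charFun Q w‖ ^ 2)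
        + η / (2 * q) * (K * (q * q)) := by
    have hK2 : K * (q * q) = ∫ w : EuclideanSpace ℝ (Fin m), gaussWeight ν w ^ 2 := by
      rw [hW2, Real.mul_rpow (by positivity) hνpos.le, hqq]
    calc _ ≤ ∫ w in (Metric.ball (0 : EuclideanSpace ℝ (Fin m)) R)ᶜ,
      (q / (2 * η) * ‖charFun Q w‖ ^ 2
            + η / (2 * q) * gaussWeight ν w ^ 2) := by
          refine setIntegral_mono hWφ.integrableOn ((hQ.const_mul _).add
            (hW2i.const_mul _)).integrableOn fun w => ?_
          have : 0 ≤ (q * ‖charFun Q w‖ - η * gaussWeight ν w) ^ 2 / (2 * η * q) := by positivity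
          have e : (q * ‖charFun Q w‖ - η * gaussWeight ν w) ^ 2 / (2 * η * q)
              = q / (2 * η) * ‖charFun Q w‖ ^ 2 + η / (2 * q) * gaussWeight ν w ^ 2
                - gaussWeight ν w * ‖charFun Q w‖ := by
            field_simp
            ring
          simp only
          linarith
      _ = q / (2 * η) * (∫ w in (Metric.ball (0 : EuclideanSpace ℝ (Fin m)) R)ᶜ, ‖charFun Q w‖ ^ 2)
          + η / (2 * q) * ∫ w in (Metric.ball (0 : EuclideanSpace ℝ (Fin m)) R)ᶜ, gaussWeight ν w ^
            2 := by
          rw [integral_add (hQ.const_mul _).integrableOn (hW2i.const_mul _).integrableOn,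
            integral_const_mul, integral_const_mul]
      _ ≤ _ := by
          rw [hK2]
          exact add_le_add le_rfl (mul_le_mul_of_nonneg_left
            (setIntegral_le_integral hW2i (ae_of_all _ fun w => sq_nonneg _)) (by positivity))
  have hsplit := integral_add_compl hball hWφ
  rw [Real.dist_eq, sub_zero, abs_of_nonneg (mul_nonneg (by positivity)
    (integral_nonneg fun w => mul_nonneg (gaussWeight_pos ν w).le (norm_nonneg _))), ← hsplit,
    hqinv]
  rw [hqinv] at h1
  have h2 : q⁻¹ * ∫ w in (Metric.ball (0 : EuclideanSpace ℝ (Fin m)) R)ᶜ, gaussWeight ν w * ‖charFun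
      Q w‖
      ≤ (∫ w in (Metric.ball (0 : EuclideanSpace ℝ (Fin m)) R)ᶜ, ‖charFun Q w‖ ^ 2) / (2 * η) + η /
        2 * K := by
    refine (mul_le_mul_of_nonneg_left hout (by positivity)).trans_eq ?_
    field_simp
  have h3 : (∫ w in (Metric.ball (0 : EuclideanSpace ℝ (Fin m)) R)ᶜ, ‖charFun Q w‖ ^ 2) / (2 * η) <
      ε / 4 := by
    rw [div_lt_iff₀ (by positivity)]
    linarith
  have h4 : η / 2 * K = ε / 4 := by
    rw [hη]
    field_simp
    ring
  have h5 := mul_le_mul_of_nonneg_left hin (inv_nonneg.2 hq0.le)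
  rw [mul_add]
  linarith

/-- The characteristic function of a distribution with a density in a Sobolev ball of non-negative
order is square integrable. -/
lemma integrable_norm_charFun_sq {p : EuclideanSpace ℝ (Fin m) → ℝ} {s M : ℝ} (hs : 0 ≤ s)
    (hp : IsDensity Q p) (hpM : MemSobolevBall s M p) :
    Integrable fun w : EuclideanSpace ℝ (Fin m) => ‖charFun Q w‖ ^ 2 := by
  set r : ℝ := (2 * Real.pi) ^ (-((m : ℝ) / 2)) with hr
  have hr0 : 0 < r := by positivity
  -- The sign conventions differ: up to the factor r, the transform of the density at w is the
  -- characteristic function at -w, that is, the conjugate of its value at w.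
  have hF : ∀ w : EuclideanSpace ℝ (Fin m), ‖fourierTransform p w‖ = r * ‖charFun Q w‖ := fun w =>
      by
    have h1 : charFun Q (-w) = ∫ x, (p x : ℂ) * Complex.exp (-Complex.I * ((inner ℝ x w : ℝ) : ℂ))
        := by
      rw [charFun_apply, hp.eq_withDensity, integral_withDensity_eq_integral_toReal_smul₀
        hp.aemeasurable.ennreal_ofReal (ae_of_all _ fun x => ENNReal.ofReal_lt_top)]
      refine integral_congr_ae (ae_of_all _ fun x => ?_)
      simp only [ENNReal.toReal_ofReal (hp.nonneg x), inner_neg_right]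
      rw [Complex.real_smul]
      congr 2
      push_cast
      ring
    rw [fourierTransform, ← h1, charFun_neg, norm_mul, Complex.norm_real, Real.norm_eq_abs,
      abs_of_pos hr0, RCLike.norm_conj]
  have hfin : ∫⁻ w : EuclideanSpace ℝ (Fin m), ENNReal.ofReal
      ((1 + ‖w‖ ^ 2) ^ s * ‖fourierTransform p w‖ ^ 2) < ∞ := by
    have h := hpM.norm_le.trans_lt ENNReal.ofReal_lt_top
    rw [sobolevNorm] at h
    by_contra hcon
    rw [not_lt, top_le_iff] at hcon
    rw [hcon, ENNReal.top_rpow_of_pos (by norm_num)] at h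
    exact lt_irrefl _ h
  have hlt : ∫⁻ w : EuclideanSpace ℝ (Fin m), ENNReal.ofReal (r ^ 2 * ‖charFun Q w‖ ^ 2) < ∞ := by
    refine (lintegral_mono fun w => ENNReal.ofReal_le_ofReal ?_).trans_lt hfin
    rw [hF, mul_pow]
    -- The Sobolev weight is at least one because s ≥ 0.
    refine le_mul_of_one_le_left (by positivity) (Real.one_le_rpow ?_ hs)
    have := sq_nonneg ‖w‖
    linarith
  have hint : Integrable fun w : EuclideanSpace ℝ (Fin m) => r ^ 2 * ‖charFun Q w‖ ^ 2 := by
    refine ⟨((measurable_charFun'.norm.pow_const 2).const_mul _).aestronglyMeasurable, ?_⟩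
    rw [hasFiniteIntegral_iff_ofReal (ae_of_all _ fun w => by positivity)]
    exact hlt
  have := hint.const_mul (r ^ 2)⁻¹
  refine this.congr (ae_of_all _ fun w => ?_)
  field_simp

end Fourier

/-! ### Centred kernels -/

/-- A measurable symmetric kernel with values in `[0, 1]`. -/
structure IsUnitKernel {E : Type*} [MeasurableSpace E] (G : E → E → ℝ) : Prop where
  measurable : Measurable fun p : E × E => G p.1 p.2
  symm : ∀ x y, G x y = G y x
  nonneg : ∀ x y, 0 ≤ G x y
  le_one : ∀ x y, G x y ≤ 1

section Kernel

variable {E : Type*} [MeasurableSpace E] {P : Measure E} [IsProbabilityMeasure P] {G : E → E → ℝ}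

lemma IsUnitKernel.isBddMeas (hG : IsUnitKernel G) : IsBddMeas fun p : E × E => G p.1 p.2 :=
  ⟨hG.measurable, 1, fun p => by rw [abs_of_nonneg (hG.nonneg _ _)]; exact hG.le_one _ _⟩

/-- The kernel, its mean embedding in the first and the second variable, and its mean: the four
components of the centred kernel. -/
noncomputable def kernelPart (P : Measure E) (G : E → E → ℝ) : Bool → Bool → E → E → ℝ
  | true, true => G
  | true, false => fun x _ => ∫ z, G x z ∂P
  | false, true => fun _ y => ∫ z, G y z ∂P
  | false, false => fun _ _ => ∫ x, ∫ y, G x y ∂P ∂P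

/-- The kernel centred at the mean embedding of `P`. -/
noncomputable def centered (P : Measure E) (G : E → E → ℝ) (x y : E) : ℝ :=
  G x y - ∫ z, G x z ∂P - ∫ z, G y z ∂P + ∫ x, ∫ y, G x y ∂P ∂P

/-- The mean of a kernel. -/
noncomputable def kernelMean (P : Measure E) (G : E → E → ℝ) : ℝ := ∫ x, ∫ y, G x y ∂P ∂P

namespace IsUnitKernel

lemma embed_isBddMeas (hG : IsUnitKernel G) : IsBddMeas fun x => ∫ z, G x z ∂P :=
  IsBddMeas.integral hG.isBddMeas P

lemma part_isBddMeas (hG : IsUnitKernel G) (t t' : Bool) :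
    IsBddMeas fun p : E × E => kernelPart P G t t' p.1 p.2 := by
  cases t <;> cases t'
  · exact IsBddMeas.const _
  · exact hG.embed_isBddMeas.comp measurable_snd
  · exact hG.embed_isBddMeas.comp measurable_fst
  · exact hG.isBddMeas

lemma part_nonneg (hG : IsUnitKernel G) (t t' : Bool) (x y : E) : 0 ≤ kernelPart P G t t' x y := by
  cases t <;> cases t'
  · exact integral_nonneg fun x => integral_nonneg fun y => hG.nonneg _ _
  · exact integral_nonneg fun y => hG.nonneg _ _
  · exact integral_nonneg fun y => hG.nonneg _ _
  · exact hG.nonneg _ _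

lemma kernelMean_nonneg (hG : IsUnitKernel G) : 0 ≤ kernelMean P G :=
  hG.part_nonneg (P := P) false false (nonempty_of_isProbabilityMeasure P).some
    (nonempty_of_isProbabilityMeasure P).some

lemma kernelMean_le {m : ℝ} (hG : IsUnitKernel G) (hm : ∀ x, ∫ z, G x z ∂P ≤ m) :
    kernelMean P G ≤ m := by
  have := IsBddMeas.integral_mono (hG.embed_isBddMeas (P := P)) (IsBddMeas.const m) P hm
  simpa [kernelMean] using this

lemma integral_part_right_le {m : ℝ} (hG : IsUnitKernel G) (hm : ∀ x, ∫ z, G x z ∂P ≤ m)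
    (t t' : Bool) (x : E) : ∫ z, kernelPart P G t t' x z ∂P ≤ m := by
  cases t <;> cases t'
  · simpa [kernelPart, kernelMean] using hG.kernelMean_le hm
  · simpa [kernelPart, kernelMean] using hG.kernelMean_le hm
  · simpa [kernelPart] using hm x
  · simpa [kernelPart] using hm x

lemma part_swap (hG : IsUnitKernel G) (t t' : Bool) (x y : E) :
    kernelPart P G t t' x y = kernelPart P G t' t y x := by
  cases t <;> cases t' <;> simp [kernelPart, hG.symm x y]

lemma integral_part_left_le {m : ℝ} (hG : IsUnitKernel G) (hm : ∀ x, ∫ z, G x z ∂P ≤ m)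
    (t t' : Bool) (y : E) : ∫ z, kernelPart P G t t' z y ∂P ≤ m := by
  simp_rw [fun z => hG.part_swap (P := P) t t' z y]
  exact hG.integral_part_right_le hm t' t y

lemma _root_.GaussianDHSIC.integral_integral_kernelPart (t t' : Bool) :
    ∫ x, ∫ y, kernelPart P G t t' x y ∂P ∂P = kernelMean P G := by
  cases t <;> cases t' <;> simp [kernelPart, kernelMean]

/-- Jensen's inequality: averaging a kernel over a variable does not increase its second moment. -/
lemma secondMoment_part_le (hG : IsUnitKernel G) (t t' : Bool) :
    secondMoment P (kernelPart P G t t') ≤ secondMoment P G := by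
  have h1 : ∫ x, (∫ y, G x y ∂P) ^ 2 ∂P ≤ secondMoment P G :=
    IsBddMeas.integral_mono (hG.embed_isBddMeas.pow 2)
      (IsBddMeas.integral (f := fun x y => G x y ^ 2) (hG.isBddMeas.pow 2) P) P
      fun x => sq_integral_le (IsBddMeas.left (f := fun x y => G x y) hG.isBddMeas x) P
  have h0 : (∫ x, ∫ y, G x y ∂P ∂P) ^ 2 ≤ secondMoment P G :=
    (sq_integral_le hG.embed_isBddMeas P).trans h1
  cases t <;> cases t'
  · simpa [kernelPart, secondMoment] using h0
  · simpa [kernelPart, secondMoment] using h1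
  · simpa [kernelPart, secondMoment] using h1
  · exact le_rfl

/-- For a product kernel the centred kernel does not factorise over the components, but each of the
four parts does. Dropping the signs costs only constants and keeps every bound a product over
components. -/
lemma abs_centered_le (hG : IsUnitKernel G) (x y : E) :
    |centered P G x y| ≤ ∑ t : Bool, ∑ t' : Bool, kernelPart P G t t' x y := by
  simp only [Fintype.sum_bool]
  have h1 := hG.part_nonneg (P := P) true true x y
  have h2 := hG.part_nonneg (P := P) true false x y
  have h3 := hG.part_nonneg (P := P) false true x y
  have h4 := hG.part_nonneg (P := P) false false x y
  simp only [kernelPart] at h1 h2 h3 h4 ⊢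
  rw [centered, abs_le]
  constructor <;> linarith

lemma centered_isBddMeas (hG : IsUnitKernel G) :
    IsBddMeas fun p : E × E => centered P G p.1 p.2 :=
  ((hG.isBddMeas.sub (hG.embed_isBddMeas.comp measurable_fst)).sub
    (hG.embed_isBddMeas.comp measurable_snd)).add (IsBddMeas.const _)

lemma isDegenerate_centered (hG : IsUnitKernel G) : IsDegenerate P (centered P G) where
  isBddMeas := hG.centered_isBddMeas
  symm x y := by
    simp only [centered, hG.symm x y]
    ring
  integral_eq_zero x := by
    simp only [centered]
    have hl := IsBddMeas.left (f := fun x y => G x y) hG.isBddMeas x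
    rw [((hl.sub (IsBddMeas.const _)).sub hG.embed_isBddMeas).integral_add (IsBddMeas.const _),
      (hl.sub (IsBddMeas.const _)).integral_sub hG.embed_isBddMeas,
      hl.integral_sub (IsBddMeas.const _)]
    simp

lemma abs_centered_le_two (hG : IsUnitKernel G) (x y : E) : |centered P G x y| ≤ 2 := by
  have h1 : ∀ x, 0 ≤ ∫ z, G x z ∂P := fun x => integral_nonneg fun y => hG.nonneg _ _
  have h2 : ∀ x, ∫ z, G x z ∂P ≤ 1 := fun x => by
    have := IsBddMeas.integral_mono (IsBddMeas.left (f := fun x y => G x y) hG.isBddMeas x)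
      (IsBddMeas.const 1) P (hG.le_one x)
    simpa using this
  have h3 : 0 ≤ ∫ x, ∫ y, G x y ∂P ∂P := hG.kernelMean_nonneg
  have h4 : ∫ x, ∫ y, G x y ∂P ∂P ≤ 1 := hG.kernelMean_le h2
  have := hG.nonneg x y
  have := hG.le_one x y
  have := h1 x
  have := h1 y
  have := h2 x
  have := h2 y
  rw [centered, abs_le]
  constructor <;> linarith

lemma integral_abs_centered_le {m : ℝ} (hG : IsUnitKernel G) (hm : ∀ x, ∫ z, G x z ∂P ≤ m)
    (x : E) : ∫ y, |centered P G x y| ∂P ≤ 4 * m := by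
  have hb : ∀ t t', IsBddMeas fun y => kernelPart P G t t' x y := fun t t' =>
    IsBddMeas.left (f := fun x y => kernelPart P G t t' x y) (hG.part_isBddMeas t t') x
  calc ∫ y, |centered P G x y| ∂P
      ≤ ∫ y, ∑ t : Bool, ∑ t' : Bool, kernelPart P G t t' x y ∂P :=
        IsBddMeas.integral_mono
          (IsBddMeas.left (f := fun x y => centered P G x y) hG.centered_isBddMeas x).abs
          (IsBddMeas.sum _ fun t _ => IsBddMeas.sum _ fun t' _ => hb t t') P
          (hG.abs_centered_le x)
    _ = ∑ t : Bool, ∑ t' : Bool, ∫ y, kernelPart P G t t' x y ∂P := by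
        rw [integral_finsetSum _ fun t _ => (IsBddMeas.sum _ fun t' _ => hb t t').integrable P]
        exact Finset.sum_congr rfl fun t _ => integral_finsetSum _ fun t' _ => (hb t t').integrable
          P
    _ ≤ ∑ _t : Bool, ∑ _t' : Bool, m :=
        Finset.sum_le_sum fun t _ => Finset.sum_le_sum fun t' _ =>
          hG.integral_part_right_le hm t t' x
    _ = 4 * m := by simp; ring

lemma integral_integral_abs_centered_le (hG : IsUnitKernel G) :
    ∫ x, ∫ y, |centered P G x y| ∂P ∂P ≤ 4 * kernelMean P G := by
  have hb : ∀ t t', IsBddMeas fun p : E × E => kernelPart P G t t' p.1 p.2 := hG.part_isBddMeas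
  have hb1 : ∀ t t' x, IsBddMeas fun y => kernelPart P G t t' x y := fun t t' x =>
    IsBddMeas.left (f := fun x y => kernelPart P G t t' x y) (hb t t') x
  have hb2 : ∀ t t', IsBddMeas fun x => ∫ y, kernelPart P G t t' x y ∂P := fun t t' =>
    IsBddMeas.integral (f := fun x y => kernelPart P G t t' x y) (hb t t') P
  calc ∫ x, ∫ y, |centered P G x y| ∂P ∂P
      ≤ ∫ x, ∑ t : Bool, ∑ t' : Bool, ∫ y, kernelPart P G t t' x y ∂P ∂P := by
        refine IsBddMeas.integral_mono (IsBddMeas.integral (f := fun x y => |centered P G x y|)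
          hG.centered_isBddMeas.abs P)
          (IsBddMeas.sum _ fun t _ => IsBddMeas.sum _ fun t' _ => hb2 t t') P fun x => ?_
        refine (IsBddMeas.integral_mono
          (IsBddMeas.left (f := fun x y => centered P G x y) hG.centered_isBddMeas x).abs
          (IsBddMeas.sum _ fun t _ => IsBddMeas.sum _ fun t' _ => hb1 t t' x) P
          (hG.abs_centered_le x)).trans_eq ?_
        rw [integral_finsetSum _ fun t _ => (IsBddMeas.sum _ fun t' _ => hb1 t t' x).integrable P]
        exact Finset.sum_congr rfl fun t _ =>
          integral_finsetSum _ fun t' _ => (hb1 t t' x).integrable P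
    _ = ∑ t : Bool, ∑ t' : Bool, ∫ x, ∫ y, kernelPart P G t t' x y ∂P ∂P := by
        rw [integral_finsetSum _ fun t _ => (IsBddMeas.sum _ fun t' _ => hb2 t t').integrable P]
        exact Finset.sum_congr rfl fun t _ =>
          integral_finsetSum _ fun t' _ => (hb2 t t').integrable P
    _ = 4 * kernelMean P G := by
        simp only [integral_integral_kernelPart, Fintype.sum_bool]
        ring

/-- Centring changes the second moment of a kernel by little. -/
lemma abs_secondMoment_centered_sub_le {m : ℝ} (hG : IsUnitKernel G)
    (hm : ∀ x, ∫ z, G x z ∂P ≤ m) :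
    |secondMoment P (centered P G) - secondMoment P G| ≤ 2 * (m * kernelMean P G) := by
  set g := kernelMean P G with hg
  have hg0 : 0 ≤ g := hG.kernelMean_nonneg
  have hgm : g ≤ m := hG.kernelMean_le hm
  have he := hG.embed_isBddMeas (P := P)
  set e : E → ℝ := fun x => ∫ z, G x z ∂P with he_def
  have he0 : ∀ x, 0 ≤ e x := fun x => integral_nonneg fun y => hG.nonneg _ _
  have hie : ∫ x, e x ∂P = g := rfl
  have hl : ∀ x, IsBddMeas (G x) := fun x => IsBddMeas.left (f := fun x y => G x y) hG.isBddMeas x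
  have hG2 : IsBddMeas fun x => ∫ y, G x y ^ 2 ∂P :=
    IsBddMeas.integral (f := fun x y => G x y ^ 2) (hG.isBddMeas.pow 2) P
  have hGe : IsBddMeas fun x => ∫ y, G x y * e y ∂P :=
    IsBddMeas.integral (f := fun x y => G x y * e y) (hG.isBddMeas.mul (he.comp measurable_snd)) P
  have hswap : ∫ x, ∫ y, G x y * e y ∂P ∂P = ∫ x, e x ^ 2 ∂P := by
    rw [IsBddMeas.integral_swap (f := fun x y => G x y * e y)
      (hG.isBddMeas.mul (he.comp measurable_snd))]
    refine integral_congr_ae (ae_of_all _ fun y => ?_)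
    simp only
    rw [integral_mul_const, sq]
    simp_rw [fun x => hG.symm x y]
    rfl
  have hinner : ∀ x, ∫ y, centered P G x y ^ 2 ∂P
      = ∫ y, G x y ^ 2 ∂P - 2 * ∫ y, G x y * e y ∂P - e x ^ 2 + ∫ y, e y ^ 2 ∂P
        + 2 * g * e x - g ^ 2 := by
    intro x
    have e1 : ∀ y, centered P G x y ^ 2 = (G x y ^ 2 - 2 * (G x y * e y)
        + (2 * (g - e x)) * G x y) + (e y ^ 2 - (2 * (g - e x)) * e y + (g - e x) ^ 2) := by
      intro y
      simp only [centered]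
      change (G x y - e x - e y + g) ^ 2 = _
      ring
    simp_rw [e1]
    have hp := (hl x).mul he
    rw [IsBddMeas.integral_add ((((hl x).pow 2).sub (hp.const_mul 2)).add ((hl x).const_mul _))
        (((he.pow 2).sub (he.const_mul _)).add (IsBddMeas.const _)),
      IsBddMeas.integral_add (((hl x).pow 2).sub (hp.const_mul 2)) ((hl x).const_mul _),
      IsBddMeas.integral_sub ((hl x).pow 2) (hp.const_mul 2),
      IsBddMeas.integral_add ((he.pow 2).sub (he.const_mul _)) (IsBddMeas.const _),
      IsBddMeas.integral_sub (he.pow 2) (he.const_mul _),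
      integral_const_mul, integral_const_mul, integral_const_mul, hie]
    have : ∫ y, G x y ∂P = e x := rfl
    rw [this]
    simp
    ring
  -- Both corrections in this identity are controlled: the mean of e² and the number g² lie between
  -- 0 and m g.
  have hexact : secondMoment P (centered P G)
      = secondMoment P G - 2 * ∫ x, e x ^ 2 ∂P + g ^ 2 := by
    simp only [secondMoment]
    simp_rw [hinner]
    rw [IsBddMeas.integral_sub ((((hG2.sub (hGe.const_mul 2)).sub (he.pow 2)).add
        (IsBddMeas.const _)).add (he.const_mul _)) (IsBddMeas.const _),
      IsBddMeas.integral_add (((hG2.sub (hGe.const_mul 2)).sub (he.pow 2)).add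
        (IsBddMeas.const _)) (he.const_mul _),
      IsBddMeas.integral_add ((hG2.sub (hGe.const_mul 2)).sub (he.pow 2)) (IsBddMeas.const _),
      IsBddMeas.integral_sub (hG2.sub (hGe.const_mul 2)) (he.pow 2),
      IsBddMeas.integral_sub hG2 (hGe.const_mul 2), integral_const_mul, integral_const_mul,
      hswap, hie]
    simp
    ring
  have hb : ∫ x, e x ^ 2 ∂P ≤ m * g := by
    have := IsBddMeas.integral_mono (he.pow 2) (he.const_mul m) P fun x => by
      nlinarith [he0 x, hm x]
    rwa [integral_const_mul, hie] at this
  have hb0 : 0 ≤ ∫ x, e x ^ 2 ∂P := integral_nonneg fun x => sq_nonneg _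
  have hc : g ^ 2 ≤ m * g := by nlinarith
  rw [hexact, abs_le]
  constructor <;> nlinarith [sq_nonneg g]

/-- The centred kernel is bounded by 2 in absolute value. -/
lemma fourthMoment_centered_le (hG : IsUnitKernel G) :
    fourthMoment P (centered P G) ≤ 4 * secondMoment P (centered P G) := by
  have hb := hG.centered_isBddMeas (P := P)
  rw [fourthMoment, secondMoment, ← integral_const_mul]
  refine IsBddMeas.integral_mono
    (IsBddMeas.integral (f := fun x y => centered P G x y ^ 4) (hb.pow 4) P)
    ((IsBddMeas.integral (f := fun x y => centered P G x y ^ 2) (hb.pow 2) P).const_mul 4) P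
    fun x => ?_
  rw [← integral_const_mul]
  have hl := IsBddMeas.left (f := fun x y => centered P G x y) hb x
  refine IsBddMeas.integral_mono (hl.pow 4) ((hl.pow 2).const_mul 4) P fun y => ?_
  have := sq_le_sq' (by linarith [(abs_le.1 (hG.abs_centered_le_two (P := P) x y)).1])
    (abs_le.1 (hG.abs_centered_le_two (P := P) x y)).2
  nlinarith [sq_nonneg (centered P G x y)]

/-- One inner factor is bounded uniformly: with |H| ≤ 2, ∫H² ≤ 2∫|H| ≤ 8m. -/
lemma mixedMoment_centered_le {m : ℝ} (hG : IsUnitKernel G) (hm : ∀ x, ∫ z, G x z ∂P ≤ m) :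
    mixedMoment P (centered P G) ≤ 8 * m * secondMoment P (centered P G) := by
  have hb := hG.centered_isBddMeas (P := P)
  have hi : IsBddMeas fun x => ∫ y, centered P G x y ^ 2 ∂P :=
    IsBddMeas.integral (f := fun x y => centered P G x y ^ 2) (hb.pow 2) P
  rw [mixedMoment, secondMoment, ← integral_const_mul]
  refine IsBddMeas.integral_mono (hi.pow 2) (hi.const_mul _) P fun x => ?_
  have hl := IsBddMeas.left (f := fun x y => centered P G x y) hb x
  have h0 : 0 ≤ ∫ y, centered P G x y ^ 2 ∂P := integral_nonneg fun y => sq_nonneg _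
  have h8 : ∫ y, centered P G x y ^ 2 ∂P ≤ 8 * m := by
    have h1 : ∫ y, centered P G x y ^ 2 ∂P ≤ ∫ y, 2 * |centered P G x y| ∂P := by
      refine IsBddMeas.integral_mono (hl.pow 2) (hl.abs.const_mul 2) P fun y => ?_
      rw [← sq_abs]
      nlinarith [hG.abs_centered_le_two (P := P) x y, abs_nonneg (centered P G x y)]
    rw [integral_const_mul] at h1
    linarith [hG.integral_abs_centered_le hm x]
  nlinarith

/-- Let K be the iterated kernel of H. Then ∫∫K² ≤ sup|K| · ∫∫|K|, where sup|K| ≤ 8m and ∫∫|K| ≤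
4m∫∫|H| ≤ 16 m g, with g the kernel mean. -/
lemma cycleMoment_centered_le {m : ℝ} (hG : IsUnitKernel G) (hm : ∀ x, ∫ z, G x z ∂P ≤ m) :
    cycleMoment P (centered P G) ≤ 128 * m ^ 2 * kernelMean P G := by
  have hd := hG.isDegenerate_centered (P := P)
  have hb := hd.isBddMeas
  have hK := hd.kernelSq_isBddMeas
  have hl : ∀ x, IsBddMeas (centered P G x) :=
    fun x => IsBddMeas.left (f := fun x y => centered P G x y) hb x
  have hg0 : 0 ≤ kernelMean P G := hG.kernelMean_nonneg
  have hm0 : 0 ≤ m := hg0.trans (hG.kernelMean_le hm)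
  have hKle : ∀ x y, |kernelSq P (centered P G) x y|
      ≤ ∫ z, |centered P G x z| * |centered P G y z| ∂P := fun x y => by
    refine (abs_integral_le_integral_abs).trans_eq ?_
    simp only [abs_mul]
  have hK8 : ∀ x y, |kernelSq P (centered P G) x y| ≤ 8 * m := fun x y => by
    refine (hKle x y).trans ?_
    have : ∫ z, |centered P G x z| * |centered P G y z| ∂P ≤ ∫ z, 2 * |centered P G x z| ∂P := by
      refine IsBddMeas.integral_mono ((hl x).abs.mul (hl y).abs) ((hl x).abs.const_mul 2) P
        fun z => ?_
      nlinarith [hG.abs_centered_le_two (P := P) y z, abs_nonneg (centered P G x z)]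
    rw [integral_const_mul] at this
    linarith [hG.integral_abs_centered_le hm x]
  have habs : IsBddMeas fun p : E × E => |centered P G p.1 p.2| := hb.abs
  have hin : ∀ x, ∫ y, |kernelSq P (centered P G) x y| ∂P ≤ 4 * m * ∫ z, |centered P G x z| ∂P := by
    intro x
    have hprod : IsBddMeas fun p : E × E => |centered P G x p.2| * |centered P G p.1 p.2| :=
      ((hl x).abs.comp measurable_snd).mul hb.abs
    calc ∫ y, |kernelSq P (centered P G) x y| ∂P
        ≤ ∫ y, ∫ z, |centered P G x z| * |centered P G y z| ∂P ∂P :=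
          IsBddMeas.integral_mono (IsBddMeas.left
            (f := fun x y => kernelSq P (centered P G) x y) hK x).abs
            (IsBddMeas.integral (f := fun y z => |centered P G x z| * |centered P G y z|) hprod P) P
            (hKle x)
      _ = ∫ z, |centered P G x z| * ∫ y, |centered P G y z| ∂P ∂P := by
          rw [IsBddMeas.integral_swap
            (f := fun y z => |centered P G x z| * |centered P G y z|) hprod]
          simp_rw [integral_const_mul]
      _ ≤ ∫ z, 4 * m * |centered P G x z| ∂P := by
          refine IsBddMeas.integral_mono ((hl x).abs.mul (IsBddMeas.integral
            (f := fun z y => |centered P G y z|) (habs.comp measurable_swap) P))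
            ((hl x).abs.const_mul _) P fun z => ?_
          have : ∫ y, |centered P G y z| ∂P ≤ 4 * m := by
            simp_rw [fun y => hd.symm y z]
            exact hG.integral_abs_centered_le hm z
          nlinarith [abs_nonneg (centered P G x z)]
      _ = _ := integral_const_mul _ _
  have hKi : IsBddMeas fun x => ∫ y, |kernelSq P (centered P G) x y| ∂P :=
    IsBddMeas.integral (f := fun x y => |kernelSq P (centered P G) x y|) hK.abs P
  have hci : IsBddMeas fun x => ∫ z, |centered P G x z| ∂P :=
    IsBddMeas.integral (f := fun x z => |centered P G x z|) habs P
  calc cycleMoment P (centered P G)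
      ≤ ∫ x, 8 * m * ∫ y, |kernelSq P (centered P G) x y| ∂P ∂P := by
        rw [cycleMoment, secondMoment]
        refine IsBddMeas.integral_mono (IsBddMeas.integral
          (f := fun x y => kernelSq P (centered P G) x y ^ 2) (hK.pow 2) P) (hKi.const_mul _) P
          fun x => ?_
        rw [← integral_const_mul]
        have hKx := IsBddMeas.left (f := fun x y => kernelSq P (centered P G) x y) hK x
        refine IsBddMeas.integral_mono (hKx.pow 2) (hKx.abs.const_mul _) P fun y => ?_
        rw [← sq_abs]
        nlinarith [hK8 x y, abs_nonneg (kernelSq P (centered P G) x y)]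
    _ ≤ ∫ x, 8 * m * (4 * m * ∫ z, |centered P G x z| ∂P) ∂P := by
        refine IsBddMeas.integral_mono (hKi.const_mul _) ((hci.const_mul _).const_mul _) P
          fun x => ?_
        exact mul_le_mul_of_nonneg_left (hin x) (by positivity)
    _ = 32 * m ^ 2 * ∫ x, ∫ z, |centered P G x z| ∂P ∂P := by
        rw [integral_const_mul, integral_const_mul]
        ring
    _ ≤ 32 * m ^ 2 * (4 * kernelMean P G) :=
        mul_le_mul_of_nonneg_left hG.integral_integral_abs_centered_le (by positivity)
    _ = _ := by ring

end IsUnitKernel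

end Kernel

/-! ### Independent copies of a vector with independent components -/

section Array

variable {k : ℕ} {E : Fin k → Type*} [∀ l, MeasurableSpace (E l)] {Q : ∀ l, Measure (E l)}
  [∀ l, IsProbabilityMeasure (Q l)] {Ω : Type*} [MeasurableSpace Ω] {μ : Measure Ω}
  [IsProbabilityMeasure μ] {X : ℕ → Ω → ∀ l, E l}

/-- The observation composed of the components `X_{a l}^l`. -/
def mixed (X : ℕ → Ω → ∀ l, E l) (a : Fin k → ℕ) (ω : Ω) : ∀ l, E l := fun l => X (a l) ω l

lemma measurable_mixed (hX : ∀ i, Measurable (X i)) (a : Fin k → ℕ) : Measurable (mixed X a) :=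
  measurable_pi_lambda _ fun l => (measurable_pi_apply l).comp (hX (a l))

lemma measurable_component (hX : ∀ i, Measurable (X i)) (i : ℕ) (l : Fin k) :
    Measurable fun ω => X i ω l := (measurable_pi_apply l).comp (hX i)

lemma map_component (hX : ∀ i, Measurable (X i)) (hlaw : ∀ i, μ.map (X i) = Measure.pi Q) (i : ℕ)
    (l : Fin k) : μ.map (fun ω => X i ω l) = Q l := by
  have h := Measure.map_map (μ := μ) (measurable_pi_apply l) (hX i)
  rw [hlaw, (measurePreserving_eval Q l).map_eq] at h
  exact h.symm

lemma iIndepFun_components (hX : ∀ i, Measurable (X i)) (hindep : iIndepFun X μ)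
    (hlaw : ∀ i, μ.map (X i) = Measure.pi Q) :
    iIndepFun (fun (p : (_ : ℕ) × Fin k) ω => X p.1 ω p.2) μ := by
  refine iIndepFun_uncurry (X := fun i l ω => X i ω l) (fun i l => measurable_component hX i l)
    hindep fun i => ?_
  rw [iIndepFun_iff_map_fun_eq_pi_map fun l => (measurable_component hX i l).aemeasurable]
  simp_rw [map_component hX hlaw]
  exact hlaw i

/-- All entries of the array are independent, so they may be regrouped by component instead of by
observation. The infinite columns are handled by identifying the joint law with an infinite product,
curried along the component. -/
lemma iIndepFun_columns (hX : ∀ i, Measurable (X i)) (hindep : iIndepFun X μ)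
    (hlaw : ∀ i, μ.map (X i) = Measure.pi Q) :
    iIndepFun (fun l ω (i : ℕ) => X i ω l) μ := by
  have hm := measurable_component hX
  have h1 : iIndepFun (fun (p : (_ : Fin k) × ℕ) ω => X p.2 ω p.1) μ :=
    (iIndepFun_components hX hindep hlaw).precomp
      (g := fun p : (_ : Fin k) × ℕ => (⟨p.2, p.1⟩ : (_ : ℕ) × Fin k)) (by
        rintro ⟨a, b⟩ ⟨c, d⟩ h
        simpa [and_comm] using h)
  have : ∀ (l : Fin k) (i : ℕ), IsProbabilityMeasure (μ.map fun ω => X i ω l) :=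
    fun l i => Measure.isProbabilityMeasure_map (hm i l).aemeasurable
  rw [iIndepFun_iff_map_fun_eq_infinitePi_map fun l => measurable_pi_lambda _ fun i => hm i l]
  have h2 : (MeasurableEquiv.piCurry fun (l : Fin k) (_ : ℕ) => E l)
      ∘ (fun ω (p : (_ : Fin k) × ℕ) => X p.2 ω p.1) = fun ω l i => X i ω l := by
    ext; simp [Sigma.curry]
  rw [← h2, ← Measure.map_map (MeasurableEquiv.measurable _)
      (measurable_pi_lambda _ fun p : (_ : Fin k) × ℕ => hm p.2 p.1),
    (iIndepFun_iff_map_fun_eq_infinitePi_map fun p => hm p.2 p.1).1 h1,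
    Measure.infinitePi_map_piCurry (fun (l : Fin k) (i : ℕ) => μ.map fun ω => X i ω l)]
  congr 1
  ext1 l
  have h3 : iIndepFun (fun (i : ℕ) ω => X i ω l) μ :=
    h1.precomp (g := fun i : ℕ => (⟨l, i⟩ : (_ : Fin k) × ℕ)) (by
      intro a b h
      simpa using h)
  rw [(iIndepFun_iff_map_fun_eq_infinitePi_map fun i => hm i l).1 h3]

lemma iIndepFun_column (hindep : iIndepFun X μ) (l : Fin k) :
    iIndepFun (fun (i : ℕ) ω => X i ω l) μ :=
  hindep.comp (fun _ x => x l) fun _ => measurable_pi_apply l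

/-- Under independence of the components, recombining entries of different observations does not
change the law. Hence a kernel degenerate for P stays degenerate in mixed observations. -/
lemma map_mixed (hX : ∀ i, Measurable (X i)) (hindep : iIndepFun X μ)
    (hlaw : ∀ i, μ.map (X i) = Measure.pi Q) (a : Fin k → ℕ) :
    μ.map (mixed X a) = Measure.pi Q := by
  have h : iIndepFun (fun l ω => X (a l) ω l) μ :=
    (iIndepFun_columns hX hindep hlaw).comp (fun l x => x (a l)) fun l => measurable_pi_apply _
  have := h.map_fun_eq_pi_map fun l => (measurable_component hX (a l) l).aemeasurable
  simp_rw [map_component hX hlaw] at this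
  exact this

/-- Products over the components have product expectations. -/
lemma integral_prod_columns (hX : ∀ i, Measurable (X i)) (hindep : iIndepFun X μ)
    (hlaw : ∀ i, μ.map (X i) = Measure.pi Q) {f : ∀ l, (ℕ → E l) → ℝ}
    (hf : ∀ l, IsBddMeas (f l)) :
    ∫ ω, ∏ l, f l (fun i => X i ω l) ∂μ = ∏ l, ∫ ω, f l (fun i => X i ω l) ∂μ :=
  (iIndepFun_columns hX hindep hlaw).integral_fun_prod_comp
    (fun l => (measurable_pi_lambda _ fun i => measurable_component hX i l).aemeasurable)
    fun l => (hf l).measurable.aestronglyMeasurable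

/-- A degenerate kernel at a pair of mixed observations is orthogonal to functions of mixed
observations that have no component in common with its second argument. -/
lemma integral_mul_eq_zero (hX : ∀ i, Measurable (X i)) (hindep : iIndepFun X μ)
    (hlaw : ∀ i, μ.map (X i) = Measure.pi Q) {H : (∀ l, E l) → (∀ l, E l) → ℝ}
    (hH : IsDegenerate (Measure.pi Q) H) {a b a' b' : Fin k → ℕ} (h1 : ∀ l, b l ≠ a l)
    (h2 : ∀ l, b l ≠ a' l) (h3 : ∀ l, b l ≠ b' l) :
    ∫ ω, H (mixed X a ω) (mixed X b ω) * H (mixed X a' ω) (mixed X b' ω) ∂μ = 0 := by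
  classical
  have hm := measurable_component hX
  let idx : (Fin k → ℕ) → Finset ((_ : ℕ) × Fin k) := fun c =>
    Finset.univ.image fun l => ⟨c l, l⟩
  have hidx : ∀ c l, (⟨c l, l⟩ : (_ : ℕ) × Fin k) ∈ idx c := fun c l =>
    Finset.mem_image.2 ⟨l, Finset.mem_univ _, rfl⟩
  set S := idx a ∪ idx a' ∪ idx b' with hS
  have hdisj : Disjoint S (idx b) := by
    rw [Finset.disjoint_left]
    intro p hp hpb
    obtain ⟨l, _, rfl⟩ := Finset.mem_image.1 hpb
    simp only [hS, Finset.mem_union, idx, Finset.mem_image, Finset.mem_univ, true_and,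
      Sigma.mk.injEq] at hp
    rcases hp with (⟨l', h, h'⟩ | ⟨l', h, h'⟩) | ⟨l', h, h'⟩ <;> simp only [heq_eq_eq] at h' <;>
      subst h'
    · exact h1 l' h.symm
    · exact h2 l' h.symm
    · exact h3 l' h.symm
  have hind := (iIndepFun_components hX hindep hlaw).indepFun_finset S (idx b) hdisj
    fun p => hm p.1 p.2
  have hSa : ∀ l, (⟨a l, l⟩ : (_ : ℕ) × Fin k) ∈ S := fun l =>
    Finset.mem_union_left _ (Finset.mem_union_left _ (hidx a l))
  have hSa' : ∀ l, (⟨a' l, l⟩ : (_ : ℕ) × Fin k) ∈ S := fun l =>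
    Finset.mem_union_left _ (Finset.mem_union_right _ (hidx a' l))
  have hSb' : ∀ l, (⟨b' l, l⟩ : (_ : ℕ) × Fin k) ∈ S := fun l =>
    Finset.mem_union_right _ (hidx b' l)
  -- The entries at b occur in none of the other three arguments, so `mixed X b` can be integrated
  -- out first, where degeneracy gives zero.
  have hind2 : IndepFun (fun ω => (mixed X a ω, mixed X a' ω, mixed X b' ω)) (mixed X b) μ := by
    have hu : Measurable fun q : (∀ p : S, E p.1.2) =>
        ((fun l => q ⟨⟨a l, l⟩, hSa l⟩ : ∀ l, E l), (fun l => q ⟨⟨a' l, l⟩, hSa' l⟩ : ∀ l, E l),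
          (fun l => q ⟨⟨b' l, l⟩, hSb' l⟩ : ∀ l, E l)) :=
      (measurable_pi_lambda _ fun l => measurable_pi_apply _).prodMk
        ((measurable_pi_lambda _ fun l => measurable_pi_apply _).prodMk
          (measurable_pi_lambda _ fun l => measurable_pi_apply _))
    have hv : Measurable fun q : (∀ p : idx b, E p.1.2) =>
        (fun l => q ⟨⟨b l, l⟩, hidx b l⟩ : ∀ l, E l) :=
      measurable_pi_lambda _ fun l => measurable_pi_apply _
    exact hind.comp hu hv
  have ha := measurable_mixed hX a
  have ha' := measurable_mixed hX a'
  have hb' := measurable_mixed hX b'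
  have hF : IsBddMeas fun p : ((∀ l, E l) × (∀ l, E l) × (∀ l, E l)) × (∀ l, E l) =>
      H p.1.1 p.2 * H p.1.2.1 p.1.2.2 :=
    (hH.isBddMeas.comp ((measurable_fst.comp measurable_fst).prodMk measurable_snd)).mul
      (hH.isBddMeas.comp (u := fun p : ((∀ l, E l) × (∀ l, E l) × (∀ l, E l)) × (∀ l, E l) =>
        (p.1.2.1, p.1.2.2)) (by fun_prop))
  obtain ⟨C, hC⟩ := hF.bdd
  have h := integral_comp_of_indepFun hind2 (ha.prodMk (ha'.prodMk hb')) (measurable_mixed hX b)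
    hF.measurable.stronglyMeasurable hC
  rw [map_mixed hX hindep hlaw] at h
  simp only at h
  rw [h]
  simp_rw [integral_mul_const, hH.integral_eq_zero]
  simp

end Array

/-! ### Products of kernels at few independent variables -/

section Column

variable {E Ω : Type*} [MeasurableSpace E] [MeasurableSpace Ω] {P : Measure E}
  [IsProbabilityMeasure P] {μ : Measure Ω} [IsProbabilityMeasure μ] {X : ℕ → Ω → E}

lemma integral_pair (hX : ∀ i, Measurable (X i)) (hindep : iIndepFun X μ)
    (hlaw : ∀ i, μ.map (X i) = P) {f : E → E → ℝ} (hf : IsBddMeas fun p : E × E => f p.1 p.2)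
    {a b : ℕ} (hab : a ≠ b) : ∫ ω, f (X a ω) (X b ω) ∂μ = ∫ x, ∫ y, f x y ∂P ∂P := by
  obtain ⟨C, hC⟩ := hf.bdd
  have h := integral_comp_of_indepFun (hindep.indepFun hab) (hX a) (hX b)
    hf.measurable.stronglyMeasurable hC
  simp only [hlaw] at h
  have hmap := integral_map (μ := μ) (hX a).aemeasurable (f := fun x => ∫ y, f x y ∂P)
    (IsBddMeas.integral hf P).measurable.aestronglyMeasurable
  rw [hlaw a] at hmap
  rw [h, hmap]

/-- The variable with index b' occurs only once. Integrating it out bounds the second factor by m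
and leaves the mean of f; a' may coincide with a or b. -/
lemma integral_pair_mul_pair_le_of_right (hX : ∀ i, Measurable (X i)) (hindep : iIndepFun X μ)
    (hlaw : ∀ i, μ.map (X i) = P) {f f' : E → E → ℝ} (hf : IsBddMeas fun p : E × E => f p.1 p.2)
    (hf' : IsBddMeas fun p : E × E => f' p.1 p.2) (hf0 : ∀ x y, 0 ≤ f x y) {m : ℝ}
    (hm : ∀ x, ∫ y, f' x y ∂P ≤ m) {a b a' b' : ℕ} (hab : a ≠ b) (h1 : b' ≠ a) (h2 : b' ≠ b)
    (h3 : b' ≠ a') :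
    ∫ ω, f (X a ω) (X b ω) * f' (X a' ω) (X b' ω) ∂μ ≤ m * ∫ x, ∫ y, f x y ∂P ∂P := by
  have hind := hindep.indepFun_finset {a, b, a'} {b'} (by
    rw [Finset.disjoint_singleton_right]
    simp [h1, h2, h3]) hX
  have hind2 : IndepFun (fun ω => (X a ω, X b ω, X a' ω)) (X b') μ := by
    have hu : Measurable fun q : (({a, b, a'} : Finset ℕ) → E) =>
        (q ⟨a, by simp⟩, q ⟨b, by simp⟩, q ⟨a', by simp⟩) :=
      (measurable_pi_apply _).prodMk ((measurable_pi_apply _).prodMk (measurable_pi_apply _))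
    exact hind.comp hu (measurable_pi_apply (⟨b', by simp⟩ : ({b'} : Finset ℕ)))
  have hF : IsBddMeas fun p : (E × E × E) × E => f p.1.1 p.1.2.1 * f' p.1.2.2 p.2 :=
    (hf.comp (u := fun p : (E × E × E) × E => (p.1.1, p.1.2.1)) (by fun_prop)).mul
      (hf'.comp (u := fun p : (E × E × E) × E => (p.1.2.2, p.2)) (by fun_prop))
  obtain ⟨C, hC⟩ := hF.bdd
  have h := integral_comp_of_indepFun hind2 ((hX a).prodMk ((hX b).prodMk (hX a'))) (hX b')
    hF.measurable.stronglyMeasurable hC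
  rw [hlaw] at h
  simp only [integral_const_mul] at h
  rw [h, ← integral_pair hX hindep hlaw hf hab, ← integral_const_mul]
  have hfX := hf.comp ((hX a).prodMk (hX b))
  refine IsBddMeas.integral_mono (hfX.mul ((IsBddMeas.integral hf' P).comp (hX a')))
    (hfX.const_mul m) μ fun ω => ?_
  rw [mul_comm m]
  exact mul_le_mul_of_nonneg_left (hm _) (hf0 _ _)

/-- The expectation of a product of two kernels at pairs of variables that do not coincide. -/
lemma integral_pair_mul_pair_le (hX : ∀ i, Measurable (X i)) (hindep : iIndepFun X μ)
    (hlaw : ∀ i, μ.map (X i) = P) {f f' : E → E → ℝ} (hf : IsBddMeas fun p : E × E => f p.1 p.2)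
    (hf' : IsBddMeas fun p : E × E => f' p.1 p.2) (hf0 : ∀ x y, 0 ≤ f x y) {m : ℝ}
    (hm : ∀ x, ∫ y, f' x y ∂P ≤ m) (hm' : ∀ y, ∫ x, f' x y ∂P ≤ m) {a b a' b' : ℕ} (hab : a ≠ b)
    (hab' : a' ≠ b') (h : ¬ ((a' = a ∨ a' = b) ∧ (b' = a ∨ b' = b))) :
    ∫ ω, f (X a ω) (X b ω) * f' (X a' ω) (X b' ω) ∂μ ≤ m * ∫ x, ∫ y, f x y ∂P ∂P := by
  by_cases hb : b' = a ∨ b' = b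
  · have ha : ¬ (a' = a ∨ a' = b) := fun ha => h ⟨ha, hb⟩
    push Not at ha
    exact integral_pair_mul_pair_le_of_right hX hindep hlaw hf (f' := fun x y => f' y x)
      (hf'.comp measurable_swap) hf0 hm' hab ha.1 ha.2 hab'
  · push Not at hb
    exact integral_pair_mul_pair_le_of_right hX hindep hlaw hf hf' hf0 hm hab hb.1 hb.2 hab'.symm

/-- From 2xy ≤ x² + y², however the two pairs overlap. -/
lemma integral_pair_mul_pair_le_secondMoment (hX : ∀ i, Measurable (X i)) (hindep : iIndepFun X μ)
    (hlaw : ∀ i, μ.map (X i) = P) {f f' : E → E → ℝ} (hf : IsBddMeas fun p : E × E => f p.1 p.2)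
    (hf' : IsBddMeas fun p : E × E => f' p.1 p.2) {A : ℝ} (hA : secondMoment P f ≤ A)
    (hA' : secondMoment P f' ≤ A) {a b a' b' : ℕ} (hab : a ≠ b) (hab' : a' ≠ b') :
    ∫ ω, f (X a ω) (X b ω) * f' (X a' ω) (X b' ω) ∂μ ≤ A := by
  have h1 := integral_pair hX hindep hlaw (f := fun x y => f x y ^ 2) (hf.pow 2) hab
  have h2 := integral_pair hX hindep hlaw (f := fun x y => f' x y ^ 2) (hf'.pow 2) hab'
  have hfX := hf.comp ((hX a).prodMk (hX b))
  have hfX' := hf'.comp ((hX a').prodMk (hX b'))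
  have h := IsBddMeas.integral_mono (hfX.mul hfX')
    (((hfX.pow 2).const_mul 2⁻¹).add ((hfX'.pow 2).const_mul 2⁻¹)) μ fun ω => by
      nlinarith [sq_nonneg (f (X a ω) (X b ω) - f' (X a' ω) (X b' ω))]
  rw [((hfX.pow 2).const_mul 2⁻¹).integral_add ((hfX'.pow 2).const_mul 2⁻¹), integral_const_mul,
    integral_const_mul] at h
  simp only at h h1 h2
  rw [h1, h2] at h
  simp only [secondMoment] at hA hA'
  linarith

end Column

/-! ### Product kernels -/

section Product

variable {k : ℕ} {E : Fin k → Type*} [∀ l, MeasurableSpace (E l)] {Q : ∀ l, Measure (E l)}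
  [∀ l, IsProbabilityMeasure (Q l)] {G : ∀ l, E l → E l → ℝ}

/-- The product of kernels on the components. -/
def prodKernel (G : ∀ l, E l → E l → ℝ) (x y : ∀ l, E l) : ℝ := ∏ l, G l (x l) (y l)

lemma measurable_prodKernel (hG : ∀ l, Measurable fun p : E l × E l => G l p.1 p.2) :
    Measurable fun p : (∀ l, E l) × (∀ l, E l) => prodKernel G p.1 p.2 :=
  Finset.measurable_prod _ fun l _ => (hG l).comp
    (((measurable_pi_apply l).comp measurable_fst).prodMk
      ((measurable_pi_apply l).comp measurable_snd))

lemma isUnitKernel_prodKernel (hG : ∀ l, IsUnitKernel (G l)) : IsUnitKernel (prodKernel G) where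
  measurable := measurable_prodKernel fun l => (hG l).measurable
  symm _ _ := Finset.prod_congr rfl fun l _ => (hG l).symm _ _
  nonneg _ _ := Finset.prod_nonneg fun l _ => (hG l).nonneg _ _
  le_one _ _ := Finset.prod_le_one (fun l _ => (hG l).nonneg _ _) fun l _ => (hG l).le_one _ _

lemma integral_prodKernel (x : ∀ l, E l) :
    ∫ y, prodKernel G x y ∂(Measure.pi Q) = ∏ l, ∫ y, G l (x l) y ∂(Q l) :=
  integral_fintype_prod_eq_prod (fun l y => G l (x l) y)

lemma kernelMean_prodKernel :
    kernelMean (Measure.pi Q) (prodKernel G) = ∏ l, kernelMean (Q l) (G l) := by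
  simp_rw [kernelMean, integral_prodKernel]
  exact integral_fintype_prod_eq_prod (fun l x => ∫ y, G l x y ∂(Q l))

lemma secondMoment_prodKernel :
    secondMoment (Measure.pi Q) (prodKernel G) = ∏ l, secondMoment (Q l) (G l) := by
  simp_rw [secondMoment, prodKernel, ← Finset.prod_pow]
  have h : ∀ x : ∀ l, E l, ∫ y, ∏ l, G l (x l) (y l) ^ 2 ∂(Measure.pi Q)
      = ∏ l, ∫ y, G l (x l) y ^ 2 ∂(Q l) := fun x =>
    integral_fintype_prod_eq_prod (fun l y => G l (x l) y ^ 2)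
  simp_rw [h]
  exact integral_fintype_prod_eq_prod (fun l x => ∫ y, G l x y ^ 2 ∂(Q l))

/-- Integrals of a product kernel against a product measure factorise; this lets all estimates be
done one component at a time. -/
lemma kernelPart_prodKernel (t t' : Bool) (x y : ∀ l, E l) :
    kernelPart (Measure.pi Q) (prodKernel G) t t' x y
      = ∏ l, kernelPart (Q l) (G l) t t' (x l) (y l) := by
  cases t <;> cases t'
  · exact kernelMean_prodKernel
  · exact integral_prodKernel y
  · exact integral_prodKernel x
  · rfl

lemma integral_prodKernel_le (hG : ∀ l, IsUnitKernel (G l)) {m : Fin k → ℝ}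
    (hm : ∀ l x, ∫ z, G l x z ∂(Q l) ≤ m l) (x : ∀ l, E l) :
    ∫ z, prodKernel G x z ∂(Measure.pi Q) ≤ ∏ l, m l := by
  rw [integral_prodKernel]
  exact Finset.prod_le_prod (fun l _ => integral_nonneg fun y => (hG l).nonneg _ _)
    fun l _ => hm l _

variable {Ω : Type*} [MeasurableSpace Ω] {μ : Measure Ω}
  [IsProbabilityMeasure μ] {X : ℕ → Ω → ∀ l, E l}

/-- Each centred kernel is dominated by four nonnegative parts, which gives 16 products. Each
product factorises over the independent columns, so componentwise bounds multiply. -/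
lemma integral_centered_mul_centered_le_prod (hX : ∀ i, Measurable (X i)) (hindep : iIndepFun X μ)
    (hlaw : ∀ i, μ.map (X i) = Measure.pi Q) (hG : ∀ l, IsUnitKernel (G l))
    {a b a' b' : Fin k → ℕ} {c : Fin k → ℝ}
    (hc : ∀ l t t' u u', ∫ ω, kernelPart (Q l) (G l) t t' (X (a l) ω l) (X (b l) ω l)
      * kernelPart (Q l) (G l) u u' (X (a' l) ω l) (X (b' l) ω l) ∂μ ≤ c l) :
    ∫ ω, centered (Measure.pi Q) (prodKernel G) (mixed X a ω) (mixed X b ω)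
      * centered (Measure.pi Q) (prodKernel G) (mixed X a' ω) (mixed X b' ω) ∂μ
      ≤ 16 * ∏ l, c l := by
  have hGJ := isUnitKernel_prodKernel hG
  set P := Measure.pi Q with hP
  have hm := measurable_mixed hX
  have hcb := hGJ.centered_isBddMeas (P := P)
  have hpb := fun t t' => hGJ.part_isBddMeas (P := P) t t'
  have hpX : ∀ t t' a b, IsBddMeas fun ω =>
      kernelPart P (prodKernel G) t t' (mixed X a ω) (mixed X b ω) := fun t t' a b =>
    (hpb t t').comp ((hm a).prodMk (hm b))
  have hterm : ∀ t t' u u', IsBddMeas fun ω =>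
      kernelPart P (prodKernel G) t t' (mixed X a ω) (mixed X b ω)
        * kernelPart P (prodKernel G) u u' (mixed X a' ω) (mixed X b' ω) := fun t t' u u' =>
    (hpX t t' a b).mul (hpX u u' a' b')
  have hle : ∀ t t' u u', ∫ ω, kernelPart P (prodKernel G) t t' (mixed X a ω) (mixed X b ω)
        * kernelPart P (prodKernel G) u u' (mixed X a' ω) (mixed X b' ω) ∂μ ≤ ∏ l, c l := by
    intro t t' u u'
    simp_rw [hP, kernelPart_prodKernel, ← Finset.prod_mul_distrib]
    refine (integral_prod_columns hX hindep hlaw (f := fun l x =>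
      kernelPart (Q l) (G l) t t' (x (a l)) (x (b l))
        * kernelPart (Q l) (G l) u u' (x (a' l)) (x (b' l))) fun l => ?_).trans_le ?_
    · exact (((hG l).part_isBddMeas t t').comp (u := fun x : ℕ → E l => (x (a l), x (b l)))
        (by fun_prop)).mul (((hG l).part_isBddMeas u u').comp
          (u := fun x : ℕ → E l => (x (a' l), x (b' l))) (by fun_prop))
    · exact Finset.prod_le_prod (fun l _ => integral_nonneg fun ω =>
        mul_nonneg ((hG l).part_nonneg _ _ _ _) ((hG l).part_nonneg _ _ _ _))
        fun l _ => hc l t t' u u'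
  have h1 : ∫ ω, centered P (prodKernel G) (mixed X a ω) (mixed X b ω)
      * centered P (prodKernel G) (mixed X a' ω) (mixed X b' ω) ∂μ
      ≤ ∫ ω, ∑ p : (Bool × Bool) × (Bool × Bool),
        kernelPart P (prodKernel G) p.1.1 p.1.2 (mixed X a ω) (mixed X b ω)
        * kernelPart P (prodKernel G) p.2.1 p.2.2 (mixed X a' ω) (mixed X b' ω) ∂μ := by
    refine IsBddMeas.integral_mono ((hcb.comp ((hm a).prodMk (hm b))).mul
      (hcb.comp ((hm a').prodMk (hm b')))) (IsBddMeas.sum _ fun p _ => hterm _ _ _ _) μ fun ω => ?_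
    refine (le_abs_self _).trans ?_
    rw [abs_mul]
    refine (mul_le_mul (hGJ.abs_centered_le _ _) (hGJ.abs_centered_le _ _) (abs_nonneg _)
      ((abs_nonneg _).trans (hGJ.abs_centered_le _ _))).trans_eq ?_
    rw [← Fintype.sum_prod_type', ← Fintype.sum_prod_type', Finset.sum_mul_sum,
      ← Fintype.sum_prod_type']
  refine h1.trans ?_
  rw [integral_finsetSum (f := fun (p : (Bool × Bool) × (Bool × Bool)) ω =>
    kernelPart P (prodKernel G) p.1.1 p.1.2 (mixed X a ω) (mixed X b ω)
        * kernelPart P (prodKernel G) p.2.1 p.2.2 (mixed X a' ω) (mixed X b' ω)) _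
    fun p _ => (hterm _ _ _ _).integrable μ]
  refine (Finset.sum_le_sum fun p _ => hle _ _ _ _).trans_eq ?_
  simp

lemma integral_centered_mul_centered_le (hX : ∀ i, Measurable (X i)) (hindep : iIndepFun X μ)
    (hlaw : ∀ i, μ.map (X i) = Measure.pi Q) (hG : ∀ l, IsUnitKernel (G l))
    {a b a' b' : Fin k → ℕ} (hab : ∀ l, a l ≠ b l) (hab' : ∀ l, a' l ≠ b' l) :
    ∫ ω, centered (Measure.pi Q) (prodKernel G) (mixed X a ω) (mixed X b ω)
      * centered (Measure.pi Q) (prodKernel G) (mixed X a' ω) (mixed X b' ω) ∂μ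
      ≤ 16 * ∏ l, secondMoment (Q l) (G l) :=
  integral_centered_mul_centered_le_prod hX hindep hlaw hG fun l t t' u u' =>
    integral_pair_mul_pair_le_secondMoment (X := fun i ω => X i ω l)
      (fun i => measurable_component hX i l) (iIndepFun_column hindep l)
      (fun i => map_component hX hlaw i l) ((hG l).part_isBddMeas t t')
      ((hG l).part_isBddMeas u u') ((hG l).secondMoment_part_le t t')
      ((hG l).secondMoment_part_le u u') (hab l) (hab' l)

/-- One component with noncoinciding pairs is enough: there the second moment is replaced by m times
the kernel mean, which gains ε. All other components keep the crude bound. -/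
lemma integral_centered_mul_centered_le_of_not (hX : ∀ i, Measurable (X i))
    (hindep : iIndepFun X μ) (hlaw : ∀ i, μ.map (X i) = Measure.pi Q)
    (hG : ∀ l, IsUnitKernel (G l)) {m : Fin k → ℝ} (hm : ∀ l x, ∫ z, G l x z ∂(Q l) ≤ m l) {ε : ℝ}
    (hε : ∀ l, m l * kernelMean (Q l) (G l) ≤ ε * secondMoment (Q l) (G l))
    {a b a' b' : Fin k → ℕ} (hab : ∀ l, a l ≠ b l) (hab' : ∀ l, a' l ≠ b' l) {l₀ : Fin k}
    (h : ¬ ((a' l₀ = a l₀ ∨ a' l₀ = b l₀) ∧ (b' l₀ = a l₀ ∨ b' l₀ = b l₀))) :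
    ∫ ω, centered (Measure.pi Q) (prodKernel G) (mixed X a ω) (mixed X b ω)
      * centered (Measure.pi Q) (prodKernel G) (mixed X a' ω) (mixed X b' ω) ∂μ
      ≤ 16 * (ε * ∏ l, secondMoment (Q l) (G l)) := by
  refine (integral_centered_mul_centered_le_prod hX hindep hlaw hG
    (c := fun l => (if l = l₀ then ε else 1) * secondMoment (Q l) (G l))
    fun l t t' u u' => ?_).trans_eq ?_
  · by_cases hl : l = l₀
    · subst hl
      rw [if_pos rfl]
      refine le_trans ?_ (hε l)
      have := integral_pair_mul_pair_le (X := fun i ω => X i ω l)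
        (fun i => measurable_component hX i l) (iIndepFun_column hindep l)
        (fun i => map_component hX hlaw i l) ((hG l).part_isBddMeas (P := Q l) t t')
        ((hG l).part_isBddMeas (P := Q l) u u') ((hG l).part_nonneg t t')
        ((hG l).integral_part_right_le (hm l) u u') ((hG l).integral_part_left_le (hm l) u u')
        (hab l) (hab' l) h
      rwa [integral_integral_kernelPart] at this
    · rw [if_neg hl, one_mul]
      exact integral_pair_mul_pair_le_secondMoment (X := fun i ω => X i ω l)
        (fun i => measurable_component hX i l) (iIndepFun_column hindep l)
        (fun i => map_component hX hlaw i l) ((hG l).part_isBddMeas t t')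
        ((hG l).part_isBddMeas u u') ((hG l).secondMoment_part_le t t')
        ((hG l).secondMoment_part_le u u') (hab l) (hab' l)
  · rw [Finset.prod_mul_distrib, Finset.prod_ite_eq' Finset.univ l₀ fun _ => ε]
    simp

/-! ### Higher-order terms of the statistic -/

/-- The second moment of the average of a degenerate product kernel over pairs of observations
composed of the components of distinct observations. -/
lemma integral_uStat_centered_sq_le {ι : Type} [Fintype ι] [DecidableEq ι]
    (hX : ∀ i, Measurable (X i)) (hindep : iIndepFun X μ)
    (hlaw : ∀ i, μ.map (X i) = Measure.pi Q) (hG : ∀ l, IsUnitKernel (G l)) {m : Fin k → ℝ}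
    (hm : ∀ l x, ∫ z, G l x z ∂(Q l) ≤ m l) {ε : ℝ} (hε0 : 0 ≤ ε)
    (hε : ∀ l, m l * kernelMean (Q l) (G l) ≤ ε * secondMoment (Q l) (G l)) {α β : Fin k → ι}
    (hαβ : ∀ l l', α l ≠ β l') {v : Fin 3 ↪ ι} (hv : ∀ s, (∃ l, α l = v s) ∨ ∃ l, β l = v s)
    {n : ℕ} (hn : Fintype.card ι ≤ n) (hn3 : 3 ≤ n) :
    ∫ ω, uStat n (fun i : ι → Fin n => centered (Measure.pi Q) (prodKernel G)
        (fun l => X (i (α l)) ω l) (fun l => X (i (β l)) ω l)) ^ 2 ∂μ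
      ≤ 16 * (ε * ∏ l, secondMoment (Q l) (G l))
          * (Fintype.card (Fin 2 ↪ ι) ^ 2 / n.descFactorial 2)
        + 16 * (∏ l, secondMoment (Q l) (G l))
          * (Fintype.card (Fin 3 ↪ ι) ^ 2 / n.descFactorial 3) := by
  have hGJ := isUnitKernel_prodKernel hG
  have hH := hGJ.isDegenerate_centered (P := Measure.pi Q)
  have hA : 0 ≤ ∏ l, secondMoment (Q l) (G l) := Finset.prod_nonneg fun l _ =>
    integral_nonneg fun x => integral_nonneg fun y => sq_nonneg _
  refine integral_uStat_sq_le hn (fun i => hH.isBddMeas.comp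
    ((measurable_mixed hX fun l => i (α l)).prodMk (measurable_mixed hX fun l => i (β l))))
    (by omega) hn3 (by positivity) (by positivity) fun e e' => ?_
  have hne : ∀ (e : ι ↪ Fin n) l l', (e (α l) : ℕ) ≠ e (β l') := fun e l l' h =>
    hαβ l l' (e.injective (Fin.ext h))
  -- Three shared indices are rare, so the crude bound without ε suffices.
  by_cases h3 : Overlap 3 e e'
  · rw [if_pos h3]
    refine (integral_centered_mul_centered_le hX hindep hlaw hG (a := fun l => e (α l))
      (b := fun l => e (β l)) (a' := fun l => e' (α l)) (b' := fun l => e' (β l))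
        (fun l => hne e l l) (fun l => hne e' l l)).trans ?_
    split_ifs <;> linarith [mul_nonneg hε0 hA]
  rw [if_neg h3, add_zero]
  by_cases h2 : Overlap 2 e e'
  · rw [if_pos h2]
    -- If the pairs coincided in every component, all indices of e used by α and β would occur in
    -- e'. The family v lists three of them, which would be an overlap of order three.
    have : ∃ l, ¬ (((e' (α l) : ℕ) = e (α l) ∨ (e' (α l) : ℕ) = e (β l))
        ∧ ((e' (β l) : ℕ) = e (α l) ∨ (e' (β l) : ℕ) = e (β l))) := by
      by_contra! hall
      refine h3 ⟨v, fun s => ?_⟩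
      have hne' := hne e'
      have hall' : ∀ l, e (α l) ∈ Set.range e' ∧ e (β l) ∈ Set.range e' := fun l => by
        obtain ⟨h | h, h' | h'⟩ := hall l
        · exact (hne' l l (h.trans h'.symm)).elim
        · exact ⟨⟨_, Fin.ext h⟩, ⟨_, Fin.ext h'⟩⟩
        · exact ⟨⟨_, Fin.ext h'⟩, ⟨_, Fin.ext h⟩⟩
        · exact (hne' l l (h.trans h'.symm)).elim
      obtain ⟨l, hl⟩ | ⟨l, hl⟩ := hv s
      · rw [← hl]
        exact (hall' l).1
      · rw [← hl]
        exact (hall' l).2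
    obtain ⟨l₀, hl₀⟩ := this
    exact integral_centered_mul_centered_le_of_not hX hindep hlaw hG hm hε
      (a := fun l => e (α l)) (b := fun l => e (β l)) (a' := fun l => e' (α l))
      (b' := fun l => e' (β l)) (fun l => hne e l l) (fun l => hne e' l l) hl₀
  rw [if_neg h2]
  -- Otherwise some index from α and some index from β are both shared. They are distinct, which
  -- would be an overlap of order two. So one whole argument of the first kernel involves only fresh
  -- variables, and degeneracy applies to it.
  have hdisj : (∀ l, e (β l) ∉ Set.range e') ∨ ∀ l, e (α l) ∉ Set.range e' := by
    by_contra! h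
    obtain ⟨⟨l, hl⟩, l', hl'⟩ := h
    refine h2 ⟨⟨![α l', β l], ?_⟩, ?_⟩
    · intro s s'
      have := hαβ l' l
      fin_cases s <;> fin_cases s' <;> simp [this, this.symm]
    · intro s
      fin_cases s
      · exact hl'
      · exact hl
  refine le_of_eq ?_
  obtain h | h := hdisj
  · exact integral_mul_eq_zero hX hindep hlaw hH (a := fun l => e (α l)) (b := fun l => e (β l))
      (a' := fun l => e' (α l)) (b' := fun l => e' (β l)) (fun l => (hne e l l).symm)
      (fun l h' => h l ⟨_, Fin.ext h'.symm⟩) (fun l h' => h l ⟨_, Fin.ext h'.symm⟩)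
  · have := integral_mul_eq_zero hX hindep hlaw hH (a := fun l => e (β l))
      (b := fun l => e (α l)) (a' := fun l => e' (α l)) (b' := fun l => e' (β l))
      (fun l => hne e l l)
      (fun l h' => h l ⟨_, Fin.ext h'.symm⟩) (fun l h' => h l ⟨_, Fin.ext h'.symm⟩)
    rw [← this]
    refine integral_congr_ae (ae_of_all _ fun ω => ?_)
    simp only
    rw [hH.symm (mixed X (fun l => e (β l)) ω)]

end Product

/-! ### The Hoeffding-type decomposition -/

section Decomposition

variable {k : ℕ} {E : Fin k → Type*} [∀ l, MeasurableSpace (E l)]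

lemma uStat_centered {α : Type*} {ι : Type} [Fintype ι] [DecidableEq ι] [MeasurableSpace α]
    (P : Measure α) (G : α → α → ℝ) {n : ℕ} (hn : Fintype.card ι ≤ n) (u v : (ι → Fin n) → α) :
    uStat n (fun i => centered P G (u i) (v i)) = uStat n (fun i => G (u i) (v i))
      - uStat n (fun i => ∫ z, G (u i) z ∂P) - uStat n (fun i => ∫ z, G (v i) z ∂P)
      + kernelMean P G := by
  rw [← uStat_const hn (kernelMean P G), ← uStat_sub, ← uStat_sub, ← uStat_add]
  rfl

/-- Every mean-embedding average reduces, by forgetting unused indices, to one over a single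
observation or over a mixed one. The first statistic contributes two of the former, the second two
of the latter, and the third, with weight -2, cancels them all. The constants cancel as 1 + 1 - 2.
Neither independence nor degeneracy is involved. -/
lemma uStat_sub_eq_centered (hk : 2 ≤ k) (P : Measure (∀ l, E l))
    (G : (∀ l, E l) → (∀ l, E l) → ℝ) {n : ℕ} (hn : 2 * k ≤ n) (x : Fin n → ∀ l, E l) :
    uStat n (fun i : Fin 2 → Fin n => G (x (i 0)) (x (i 1)))
      + uStat n (fun i : Fin k ⊕ Fin k → Fin n =>
        G (fun j => x (i (Sum.inl j)) j) (fun j => x (i (Sum.inr j)) j))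
      - 2 * uStat n (fun i : Option (Fin k) → Fin n =>
        G (x (i none)) (fun j => x (i (some j)) j))
    = uStat n (fun i : Fin 2 → Fin n => centered P G (x (i 0)) (x (i 1)))
      + uStat n (fun i : Fin k ⊕ Fin k → Fin n =>
        centered P G (fun j => x (i (Sum.inl j)) j) (fun j => x (i (Sum.inr j)) j))
      - 2 * uStat n (fun i : Option (Fin k) → Fin n =>
        centered P G (x (i none)) (fun j => x (i (some j)) j)) := by
  have h2 : Fintype.card (Fin 2) ≤ n := by simp; omega
  have hs : Fintype.card (Fin k ⊕ Fin k) ≤ n := by simp; omega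
  have ho : Fintype.card (Option (Fin k)) ≤ n := by simp; omega
  rw [uStat_centered P G h2, uStat_centered P G hs, uStat_centered P G ho]
  have e0 : uStat n (fun i : Fin 2 → Fin n => ∫ z, G (x (i 0)) z ∂P)
      = uStat n fun i : Unit → Fin n => ∫ z, G (x (i ())) z ∂P :=
    uStat_comp ⟨fun _ => 0, fun _ _ _ => rfl⟩ h2 fun i => ∫ z, G (x (i ())) z ∂P
  have e1 : uStat n (fun i : Fin 2 → Fin n => ∫ z, G (x (i 1)) z ∂P)
      = uStat n fun i : Unit → Fin n => ∫ z, G (x (i ())) z ∂P :=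
    uStat_comp ⟨fun _ => 1, fun _ _ _ => rfl⟩ h2 fun i => ∫ z, G (x (i ())) z ∂P
  have e2 : uStat n (fun i : Option (Fin k) → Fin n => ∫ z, G (x (i none)) z ∂P)
      = uStat n fun i : Unit → Fin n => ∫ z, G (x (i ())) z ∂P :=
    uStat_comp ⟨fun _ => none, fun _ _ _ => rfl⟩ ho fun i => ∫ z, G (x (i ())) z ∂P
  have e3 : uStat n (fun i : Option (Fin k) → Fin n => ∫ z, G (fun j => x (i (some j)) j) z ∂P)
      = uStat n fun i : Fin k → Fin n => ∫ z, G (fun j => x (i j) j) z ∂P :=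
    uStat_comp ⟨some, Option.some_injective _⟩ ho fun i => ∫ z, G (fun j => x (i j) j) z ∂P
  have e4 : uStat n (fun i : Fin k ⊕ Fin k → Fin n => ∫ z, G (fun j => x (i (Sum.inl j)) j) z ∂P)
      = uStat n fun i : Fin k → Fin n => ∫ z, G (fun j => x (i j) j) z ∂P :=
    uStat_comp Function.Embedding.inl hs fun i => ∫ z, G (fun j => x (i j) j) z ∂P
  have e5 : uStat n (fun i : Fin k ⊕ Fin k → Fin n => ∫ z, G (fun j => x (i (Sum.inr j)) j) z ∂P)
      = uStat n fun i : Fin k → Fin n => ∫ z, G (fun j => x (i j) j) z ∂P :=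
    uStat_comp Function.Embedding.inr hs fun i => ∫ z, G (fun j => x (i j) j) z ∂P
  rw [e0, e1, e2, e3, e4, e5]
  ring

/-- The U-statistic of order two of a symmetric kernel as a sum over unordered pairs. -/
lemma uStat_two_eq {α : Type*} [MeasurableSpace α] {h : α → α → ℝ} (hs : ∀ x y, h x y = h y x)
    {n : ℕ} (hn : 2 ≤ n) (x : ℕ → α) :
    uStat n (fun i : Fin 2 → Fin n => h (x (i 0)) (x (i 1)))
      = 2 / ((n : ℝ) * (n - 1)) * pairSum h n x := by
  have hc : Fintype.card (Fin 2) ≤ n := by simpa using hn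
  have h1 : ∑ e : Fin 2 ↪ Fin n, h (x (e 0)) (x (e 1))
      = ∑ p ∈ (Finset.univ : Finset (Fin n × Fin n)).filter (fun p => p.1 ≠ p.2),
        h (x p.1) (x p.2) := by
    refine Finset.sum_bij' (fun e _ => (e 0, e 1)) (fun p hp => ⟨![p.1, p.2], ?_⟩) ?_ ?_ ?_ ?_ ?_
    · rw [Finset.mem_filter] at hp
      intro s s'
      fin_cases s <;> fin_cases s' <;> simp [hp.2, hp.2.symm]
    · intro e _
      simp
    · intro p _
      simp
    · intro e _
      ext s
      fin_cases s <;> rfl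
    · intro p _
      rfl
    · intro e _
      rfl
  have h2 : ∑ p ∈ (Finset.univ : Finset (Fin n × Fin n)).filter (fun p => p.1 ≠ p.2),
        h (x p.1) (x p.2) = ∑ j : Fin n, ∑ i : Fin n, (if i < j then h (x i) (x j) else 0)
          + ∑ j : Fin n, ∑ i : Fin n, (if i < j then h (x i) (x j) else 0) := by
    nth_rewrite 2 [Finset.sum_comm]
    rw [Finset.sum_filter, Fintype.sum_prod_type, ← Finset.sum_add_distrib]
    refine Finset.sum_congr rfl fun j _ => ?_
    rw [← Finset.sum_add_distrib]
    refine Finset.sum_congr rfl fun i _ => ?_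
    rcases lt_trichotomy i j with hij | hij | hij
    · simp [hij, hij.ne', hij.not_gt, hs (x j)]
    · simp [hij]
    · simp [hij, hij.ne, hij.not_gt]
  have h3 : ∑ j : Fin n, ∑ i : Fin n, (if i < j then h (x i) (x j) else 0) = pairSum h n x := by
    simp only [pairSum, colSum]
    rw [Finset.sum_range fun j => ∑ i ∈ Finset.range j, h (x i) (x j)]
    refine Finset.sum_congr rfl fun j _ => ?_
    have h4 : ∑ i : Fin n, (if i < j then h (x i) (x j) else 0)
        = ∑ i ∈ Finset.range n, if i < (j : ℕ) then h (x i) (x j) else 0 := by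
      rw [Finset.sum_range]
      rfl
    rw [h4, ← Finset.sum_filter]
    refine Finset.sum_congr (Finset.ext fun i => ?_) fun _ _ => rfl
    simp only [Finset.mem_filter, Finset.mem_range]
    omega
  rw [uStat_eq hc, h1, h2, h3, Fintype.card_fin, Nat.descFactorial_succ, Nat.descFactorial_one,
    Nat.cast_mul, Nat.cast_sub (by omega)]
  push_cast
  rw [mul_comm ((n : ℝ) - 1)]
  ring

end Decomposition

/-! ### Convergence in measure to constants -/

section Convergence

variable {Ω : Type*} [MeasurableSpace Ω] {μ : Measure Ω}

lemma tendstoInMeasure_pi {ι : Type*} [Fintype ι] {f : ℕ → Ω → ι → ℝ} {c : ι → ℝ}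
    (h : ∀ j, TendstoInMeasure μ (fun n ω => f n ω j) atTop fun _ => c j) :
    TendstoInMeasure μ f atTop fun _ => c := by
  intro ε hε
  have hsum : Tendsto (fun n => ∑ j, μ {ω | ε ≤ edist (f n ω j) (c j)}) atTop (𝓝 0) := by
    simpa using tendsto_finsetSum Finset.univ fun j _ => h j ε hε
  refine tendsto_of_tendsto_of_tendsto_of_le_of_le tendsto_const_nhds hsum (fun _ => zero_le)
    fun n => ?_
  refine (measure_mono fun ω hω => ?_).trans (measure_iUnion_fintype_le μ _)
  by_contra hn
  simp only [Set.mem_iUnion, Set.mem_ofPred_eq, not_exists, not_le] at hn hω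
  rw [edist_pi_def] at hω
  exact absurd hω (not_le.2 ((Finset.sup_lt_iff (by simpa using hε)).2 fun j _ => hn j))

lemma tendstoInMeasure_comp {T T' : Type*} [PseudoEMetricSpace T] [PseudoEMetricSpace T']
    {f : ℕ → Ω → T} {c : T} (h : TendstoInMeasure μ f atTop fun _ => c) {F : T → T'}
    (hF : ContinuousAt F c) : TendstoInMeasure μ (fun n ω => F (f n ω)) atTop fun _ => F c := by
  intro ε hε
  obtain ⟨δ, hδ, hδε⟩ := EMetric.continuousAt_iff.1 hF ε hε
  refine tendsto_of_tendsto_of_tendsto_of_le_of_le tendsto_const_nhds (h δ hδ) (fun _ => zero_le)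
    fun n => measure_mono fun ω hω => ?_
  by_contra hn
  simp only [Set.mem_ofPred_eq, not_le] at hn hω
  exact absurd hω (not_le.2 (hδε hn))

lemma tendstoInMeasure_of_tendsto {u : ℕ → ℝ} {c : ℝ} (h : Tendsto u atTop (𝓝 c)) :
    TendstoInMeasure μ (fun n (_ : Ω) => u n) atTop fun _ => c := by
  intro ε hε
  refine tendsto_const_nhds.congr' ?_
  filter_upwards [EMetric.tendsto_nhds.1 h ε hε] with n hn
  simp [not_le.2 hn]

lemma tendstoInMeasure_of_integral [IsProbabilityMeasure μ] {Y : ℕ → Ω → ℝ}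
    (h0 : ∀ n ω, 0 ≤ Y n ω) (hY : ∀ n, Integrable (Y n) μ)
    (h : Tendsto (fun n => ∫ ω, Y n ω ∂μ) atTop (𝓝 0)) :
    TendstoInMeasure μ Y atTop fun _ => 0 := by
  rw [tendstoInMeasure_iff_measureReal_norm]
  intro ε hε
  have h2 : Tendsto (fun n => (∫ ω, Y n ω ∂μ) / ε) atTop (𝓝 0) := by
    simpa using h.div_const ε
  refine squeeze_zero (fun _ => measureReal_nonneg) (fun n => ?_) h2
  rw [le_div_iff₀ hε, mul_comm]
  have := mul_meas_ge_le_integral_of_nonneg (ae_of_all _ (h0 n)) (hY n) ε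
  simpa [abs_of_nonneg (h0 n _)] using this

lemma tendstoInMeasure_of_integral_sq [IsProbabilityMeasure μ] {Y : ℕ → Ω → ℝ}
    (hY : ∀ n, Integrable (fun ω => Y n ω ^ 2) μ)
    (h : Tendsto (fun n => ∫ ω, Y n ω ^ 2 ∂μ) atTop (𝓝 0)) :
    TendstoInMeasure μ Y atTop fun _ => 0 := by
  have h1 := tendstoInMeasure_of_integral (fun n ω => sq_nonneg (Y n ω)) hY h
  rw [tendstoInMeasure_iff_norm] at h1 ⊢
  intro ε hε
  convert h1 (ε ^ 2) (by positivity) using 5 with n ω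
  simp only [sub_zero, Real.norm_eq_abs]
  rw [abs_of_nonneg (sq_nonneg (Y n ω)), ← sq_abs (Y n ω)]
  exact (pow_le_pow_iff_left₀ hε.le (abs_nonneg _) two_ne_zero).symm

lemma tendstoInDistribution_congr_eventually {Ω' : Type*} [MeasurableSpace Ω'] {μ' : Measure Ω'}
    [IsProbabilityMeasure μ] [IsProbabilityMeasure μ'] {Z : Ω' → ℝ} {S T : ℕ → Ω → ℝ}
    (hS : TendstoInDistribution S atTop Z (fun _ => μ) μ') (hT : ∀ n, AEMeasurable (T n) μ)
    (h : ∀ᶠ n in atTop, S n = T n) : TendstoInDistribution T atTop Z (fun _ => μ) μ' := by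
  refine tendstoInDistribution_of_tendstoInMeasure_sub T Z hS ?_ hT
  intro ε hε
  refine tendsto_const_nhds.congr' ?_
  filter_upwards [h] with n hn
  simp [hn, hε.ne']

end Convergence

/-! ### The estimates of the marginal moments -/

section Column

variable {E Ω : Type*} [MeasurableSpace E] [MeasurableSpace Ω] {P : Measure E}
  [IsProbabilityMeasure P] {μ : Measure Ω} [IsProbabilityMeasure μ] {X : ℕ → Ω → E}
  {G : E → E → ℝ} {m : ℝ} {n : ℕ}

lemma integral_uStat_path_le (hX : ∀ i, Measurable (X i)) (hindep : iIndepFun X μ)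
    (hlaw : ∀ i, μ.map (X i) = P) (hG : IsUnitKernel G) (hm : ∀ x, ∫ z, G x z ∂P ≤ m)
    (hn : 3 ≤ n) :
    ∫ ω, uStat n (fun i : Fin 3 → Fin n =>
      G (X (i 0) ω) (X (i 1) ω) * G (X (i 0) ω) (X (i 2) ω)) ∂μ ≤ m * kernelMean P G := by
  refine integral_uStat_le (by simpa using hn) (Y := fun (i : Fin 3 → Fin n) ω =>
    G (X (i 0) ω) (X (i 1) ω) * G (X (i 0) ω) (X (i 2) ω)) (fun i =>
    (hG.isBddMeas.comp ((hX (i 0)).prodMk (hX (i 1)))).mul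
      (hG.isBddMeas.comp ((hX (i 0)).prodMk (hX (i 2))))) fun i => ?_
  have hi : ∀ {s t : Fin 3}, s ≠ t → (i s : ℕ) ≠ i t := fun hst h =>
    hst (i.injective (Fin.ext h))
  exact integral_pair_mul_pair_le_of_right hX hindep hlaw hG.isBddMeas hG.isBddMeas hG.nonneg hm
    (hi (by decide)) (hi (by decide)) (hi (by decide)) (hi (by decide))

lemma integral_uStat_disjoint_le (hX : ∀ i, Measurable (X i)) (hindep : iIndepFun X μ)
    (hlaw : ∀ i, μ.map (X i) = P) (hG : IsUnitKernel G) (hm : ∀ x, ∫ z, G x z ∂P ≤ m)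
    (hn : 4 ≤ n) :
    ∫ ω, uStat n (fun i : Fin 4 → Fin n =>
      G (X (i 0) ω) (X (i 1) ω) * G (X (i 2) ω) (X (i 3) ω)) ∂μ ≤ m * kernelMean P G := by
  refine integral_uStat_le (by simpa using hn) (Y := fun (i : Fin 4 → Fin n) ω =>
    G (X (i 0) ω) (X (i 1) ω) * G (X (i 2) ω) (X (i 3) ω)) (fun i =>
    (hG.isBddMeas.comp ((hX (i 0)).prodMk (hX (i 1)))).mul
      (hG.isBddMeas.comp ((hX (i 2)).prodMk (hX (i 3))))) fun i => ?_
  have hi : ∀ {s t : Fin 4}, s ≠ t → (i s : ℕ) ≠ i t := fun hst h =>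
    hst (i.injective (Fin.ext h))
  exact integral_pair_mul_pair_le_of_right hX hindep hlaw hG.isBddMeas hG.isBddMeas hG.nonneg hm
    (hi (by decide)) (hi (by decide)) (hi (by decide)) (hi (by decide))

lemma integral_pair_mul_pair_eq (hX : ∀ i, Measurable (X i)) (hindep : iIndepFun X μ)
    (hlaw : ∀ i, μ.map (X i) = P) {f : E → E → ℝ} (hf : IsBddMeas fun p : E × E => f p.1 p.2)
    {a b a' b' : ℕ} (hab : a ≠ b) (hab' : a' ≠ b') (h1 : a ≠ a') (h2 : a ≠ b') (h3 : b ≠ a')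
    (h4 : b ≠ b') :
    ∫ ω, f (X a ω) (X b ω) * f (X a' ω) (X b' ω) ∂μ = (∫ x, ∫ y, f x y ∂P ∂P) ^ 2 := by
  have hind := hindep.indepFun_finset {a, b} {a', b'} (by
    simp [h1.symm, h2.symm, h3.symm, h4.symm]) hX
  have hind2 : IndepFun (fun ω => f (X a ω) (X b ω)) (fun ω => f (X a' ω) (X b' ω)) μ := by
    have hu : Measurable fun q : (({a, b} : Finset ℕ) → E) =>
        f (q ⟨a, by simp⟩) (q ⟨b, by simp⟩) :=
      hf.measurable.comp ((measurable_pi_apply _).prodMk (measurable_pi_apply _) :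
        Measurable fun q : (({a, b} : Finset ℕ) → E) =>
          (q ⟨a, by simp⟩, q ⟨b, by simp⟩))
    have hv : Measurable fun q : (({a', b'} : Finset ℕ) → E) =>
        f (q ⟨a', by simp⟩) (q ⟨b', by simp⟩) :=
      hf.measurable.comp ((measurable_pi_apply _).prodMk (measurable_pi_apply _) :
        Measurable fun q : (({a', b'} : Finset ℕ) → E) =>
          (q ⟨a', by simp⟩, q ⟨b', by simp⟩))
    exact hind.comp hu hv
  rw [hind2.integral_fun_mul_eq_mul_integral
    (hf.comp ((hX a).prodMk (hX b))).measurable.aestronglyMeasurable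
    (hf.comp ((hX a').prodMk (hX b'))).measurable.aestronglyMeasurable,
    integral_pair hX hindep hlaw hf hab, integral_pair hX hindep hlaw hf hab', sq]

/-- Covariances by overlap: disjoint pairs are uncorrelated, pairs with one common index contribute
at most m a because one variable can be integrated out, and coinciding pairs contribute at most a
since G⁴ ≤ G². Here a is the second moment of G. -/
lemma integral_uStat_sq_sub_secondMoment_le (hX : ∀ i, Measurable (X i)) (hindep : iIndepFun X μ)
    (hlaw : ∀ i, μ.map (X i) = P) (hG : IsUnitKernel G) (hm : ∀ x, ∫ z, G x z ∂P ≤ m)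
    (hn : 2 ≤ n) :
    ∫ ω, (uStat n (fun i : Fin 2 → Fin n => G (X (i 0) ω) (X (i 1) ω) ^ 2)
      - secondMoment P G) ^ 2 ∂μ
      ≤ m * secondMoment P G * (Fintype.card (Fin 1 ↪ Fin 2) ^ 2 / n.descFactorial 1)
        + secondMoment P G * (Fintype.card (Fin 2 ↪ Fin 2) ^ 2 / n.descFactorial 2) := by
  set a := secondMoment P G with ha
  have hc : Fintype.card (Fin 2) ≤ n := by simpa using hn
  have ha0 : 0 ≤ a := integral_nonneg fun x => integral_nonneg fun y => sq_nonneg _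
  have hm0 : 0 ≤ m := hG.kernelMean_nonneg.trans (hG.kernelMean_le hm)
  have hb : IsBddMeas fun p : E × E => G p.1 p.2 ^ 2 := hG.isBddMeas.pow 2
  have hle : ∀ x y, G x y ^ 2 ≤ G x y := fun x y => by
    nlinarith [hG.nonneg x y, hG.le_one x y]
  have hm2 : ∀ x, ∫ y, G x y ^ 2 ∂P ≤ m := fun x =>
    (IsBddMeas.integral_mono (IsBddMeas.left (f := fun x y => G x y ^ 2) hb x)
      (IsBddMeas.left (f := fun x y => G x y) hG.isBddMeas x) P fun y => hle x y).trans (hm x)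
  have hm2' : ∀ y, ∫ x, G x y ^ 2 ∂P ≤ m := fun y => by
    simp_rw [fun x => hG.symm x y]
    exact hm2 y
  have hA : secondMoment P (fun x y => G x y ^ 2) ≤ a := by
    refine IsBddMeas.integral_mono (IsBddMeas.integral (f := fun x y => (G x y ^ 2) ^ 2)
      (hb.pow 2) P) (IsBddMeas.integral (f := fun x y => G x y ^ 2) hb P) P fun x => ?_
    refine IsBddMeas.integral_mono (IsBddMeas.left (f := fun x y => (G x y ^ 2) ^ 2)
      (hb.pow 2) x) (IsBddMeas.left (f := fun x y => G x y ^ 2) hb x) P fun y => ?_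
    nlinarith [hG.nonneg x y, hG.le_one x y, hle x y, sq_nonneg (G x y)]
  have hbX : ∀ i j, IsBddMeas fun ω => G (X i ω) (X j ω) ^ 2 := fun i j =>
    hb.comp ((hX i).prodMk (hX j))
  have hsub : ∀ ω, uStat n (fun i : Fin 2 → Fin n => G (X (i 0) ω) (X (i 1) ω) ^ 2) - a
      = uStat n (fun i : Fin 2 → Fin n => G (X (i 0) ω) (X (i 1) ω) ^ 2 - a) := fun ω => by
    rw [uStat_sub, uStat_const hc]
  simp_rw [hsub]
  refine integral_uStat_sq_le hc (Y := fun (i : Fin 2 → Fin n) ω =>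
    G (X (i 0) ω) (X (i 1) ω) ^ 2 - a) (fun i => (hbX _ _).sub (IsBddMeas.const _))
    (by omega) hn (by positivity) ha0 fun e e' => ?_
  have hne : ∀ e : Fin 2 ↪ Fin n, (e 0 : ℕ) ≠ e 1 := fun e h => by
    have := e.injective (Fin.ext h)
    simp at this
  have hexp : ∫ ω, (G (X (e 0) ω) (X (e 1) ω) ^ 2 - a) * (G (X (e' 0) ω) (X (e' 1) ω) ^ 2 - a) ∂μ
      = ∫ ω, G (X (e 0) ω) (X (e 1) ω) ^ 2 * G (X (e' 0) ω) (X (e' 1) ω) ^ 2 ∂μ - a ^ 2 := by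
    have e1 := integral_pair hX hindep hlaw (f := fun x y => G x y ^ 2) hb (hne e)
    have e2 := integral_pair hX hindep hlaw (f := fun x y => G x y ^ 2) hb (hne e')
    have e3 : ∀ ω, (G (X (e 0) ω) (X (e 1) ω) ^ 2 - a) * (G (X (e' 0) ω) (X (e' 1) ω) ^ 2 - a)
        = (G (X (e 0) ω) (X (e 1) ω) ^ 2 * G (X (e' 0) ω) (X (e' 1) ω) ^ 2 + a ^ 2)
          - (a * G (X (e 0) ω) (X (e 1) ω) ^ 2 + a * G (X (e' 0) ω) (X (e' 1) ω) ^ 2) :=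
      fun ω => by ring
    simp_rw [e3]
    rw [(((hbX _ _).mul (hbX _ _)).add (IsBddMeas.const _)).integral_sub
      (((hbX _ _).const_mul a).add ((hbX _ _).const_mul a)),
      ((hbX _ _).mul (hbX _ _)).integral_add (IsBddMeas.const _),
      ((hbX _ _).const_mul a).integral_add ((hbX _ _).const_mul a), integral_const_mul,
      integral_const_mul]
    rw [e1, e2]
    simp only [integral_const, probReal_univ, one_smul]
    simp only [ha, secondMoment]
    ring
  rw [hexp]
  by_cases h2 : Overlap 2 e e'
  · rw [if_pos h2]
    have := integral_pair_mul_pair_le_secondMoment hX hindep hlaw (f := fun x y => G x y ^ 2)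
      (f' := fun x y => G x y ^ 2) hb hb hA hA (hne e) (hne e')
    split_ifs <;> nlinarith [mul_nonneg hm0 ha0]
  rw [if_neg h2, add_zero]
  by_cases h1 : Overlap 1 e e'
  · rw [if_pos h1]
    have := integral_pair_mul_pair_le hX hindep hlaw (f := fun x y => G x y ^ 2)
      (f' := fun x y => G x y ^ 2) hb hb (fun x y => sq_nonneg _) hm2 hm2' (hne e) (hne e') (by
        rintro ⟨h, h'⟩
        refine h2 ⟨Function.Embedding.refl _, fun s => ?_⟩
        have hne' := hne e'
        obtain h | h := h <;> obtain h' | h' := h'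
        · exact (hne' (h.trans h'.symm)).elim
        · fin_cases s
          · exact ⟨0, Fin.ext h⟩
          · exact ⟨1, Fin.ext h'⟩
        · fin_cases s
          · exact ⟨1, Fin.ext h'⟩
          · exact ⟨0, Fin.ext h⟩
        · exact (hne' (h.trans h'.symm)).elim)
    simp only [ha, secondMoment] at this ⊢
    nlinarith [sq_nonneg (∫ x, ∫ y, G x y ^ 2 ∂P ∂P)]
  rw [if_neg h1]
  have hd : ∀ s t, (e s : ℕ) ≠ e' t := fun s t h =>
    h1 ⟨⟨fun _ => s, fun _ _ _ => Subsingleton.elim _ _⟩, fun _ => ⟨t, (Fin.ext h).symm⟩⟩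
  have := integral_pair_mul_pair_eq hX hindep hlaw (f := fun x y => G x y ^ 2) hb (hne e) (hne e')
    (hd _ _) (hd _ _) (hd _ _) (hd _ _)
  rw [this]
  simp [ha, secondMoment]

end Column

/-! ### The variance formula -/

section VarianceFormula

variable {k : ℕ}

/-- Every monomial of the formula contains exactly one of the three moments of each component. -/
lemma varianceFormula_mul (r a b c : Fin k → ℝ) :
    varianceFormula (fun l => r l * a l) (fun l => r l * b l) (fun l => r l * c l)
      = (∏ l, r l) * varianceFormula a b c := by
  have h1 : ∀ (x : Fin k → ℝ), ∏ l, r l * x l = (∏ l, r l) * ∏ l, x l := fun x =>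
    Finset.prod_mul_distrib
  have h2 : ∀ (j : Fin k) (x : Fin k → ℝ) (t : ℝ), r j * t * ∏ l ∈ Finset.univ.erase j, r l * x l
      = (∏ l, r l) * (t * ∏ l ∈ Finset.univ.erase j, x l) := fun j x t => by
    rw [Finset.prod_mul_distrib, ← Finset.mul_prod_erase _ r (Finset.mem_univ j)]
    ring
  have h3 : ∀ (i j : Fin k), i ≠ j → ∀ (x : Fin k → ℝ) (t t' : ℝ),
      r i * t * (r j * t') * ∏ l ∈ (Finset.univ.erase i).erase j, r l * x l
      = (∏ l, r l) * (t * t' * ∏ l ∈ (Finset.univ.erase i).erase j, x l) := fun i j hij x t t' => by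
    rw [Finset.prod_mul_distrib, ← Finset.mul_prod_erase _ r (Finset.mem_univ i),
      ← Finset.mul_prod_erase _ r (Finset.mem_erase.2 ⟨hij.symm, Finset.mem_univ j⟩)]
    ring
  have h4 : ∑ j, (r j * a j * ∏ l ∈ Finset.univ.erase j, r l * b l - ∏ l, r l * b l
      - r j * b j * ∏ l ∈ Finset.univ.erase j, r l * c l + ∏ l, r l * c l)
      = (∏ l, r l) * ∑ j, (a j * ∏ l ∈ Finset.univ.erase j, b l - ∏ l, b l
      - b j * ∏ l ∈ Finset.univ.erase j, c l + ∏ l, c l) := by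
    rw [Finset.mul_sum]
    refine Finset.sum_congr rfl fun j _ => ?_
    rw [h1, h1, h2, h2]
    ring
  have h5 : (∑ i, ∑ j, if i = j then
        (r i * a i - 2 * (r i * b i) + r i * c i) * ∏ l ∈ Finset.univ.erase i, r l * c l
      else
        (r i * b i - r i * c i) * (r j * b j - r j * c j)
          * ∏ l ∈ (Finset.univ.erase i).erase j, r l * c l)
      = (∏ l, r l) * ∑ i, ∑ j, if i = j then
        (a i - 2 * b i + c i) * ∏ l ∈ Finset.univ.erase i, c l
      else (b i - c i) * (b j - c j) * ∏ l ∈ (Finset.univ.erase i).erase j, c l := by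
    rw [Finset.mul_sum]
    refine Finset.sum_congr rfl fun i _ => ?_
    rw [Finset.mul_sum]
    refine Finset.sum_congr rfl fun j _ => ?_
    split_ifs with h
    · rw [← h2]
      ring
    · rw [← h3 i j h]
      ring
  simp only [varianceFormula]
  rw [h4, h5, h1, h1, h1]
  ring

/-- Only the product of the a's survives: for k ≥ 2 every other monomial contains a factor b or c.
For k = 1 the value would be 0. -/
lemma varianceFormula_one_zero_zero (hk : 2 ≤ k) :
    varianceFormula (fun _ : Fin k => (1 : ℝ)) (fun _ => 0) (fun _ => 0) = 1 := by
  have h0 : k ≠ 0 := by omega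
  have h1 : k - 1 ≠ 0 := by omega
  simp [varianceFormula, h0, h1]

lemma continuous_varianceFormula :
    Continuous fun p : Fin k × Fin 3 → ℝ =>
      varianceFormula (fun l => p (l, 0)) (fun l => p (l, 1)) (fun l => p (l, 2)) := by
  unfold varianceFormula
  refine ((by fun_prop : Continuous _).sub (by fun_prop)).add ?_
  refine continuous_finsetSum _ fun i _ => continuous_finsetSum _ fun j _ => ?_
  split_ifs <;> fun_prop

end VarianceFormula

/-! ### Regularity of U-statistics and elementary limits -/

lemma measurable_uStat {ι : Type} [Fintype ι] [DecidableEq ι] {Ω : Type*} [MeasurableSpace Ω]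
    {n : ℕ} {Y : (ι → Fin n) → Ω → ℝ} (hY : ∀ i, Measurable (Y i)) :
    Measurable fun ω => uStat n fun i => Y i ω := by
  unfold uStat
  exact (Finset.measurable_fun_sum _ fun (i : ι ↪ Fin n) _ => hY i).const_mul _

lemma isBddMeas_uStat {ι : Type} [Fintype ι] [DecidableEq ι] {Ω : Type*} [MeasurableSpace Ω]
    {n : ℕ} {Y : (ι → Fin n) → Ω → ℝ} (hY : ∀ i, IsBddMeas (Y i)) :
    IsBddMeas fun ω => uStat n fun i => Y i ω := by
  unfold uStat
  exact (IsBddMeas.sum _ fun (i : ι ↪ Fin n) _ => hY i).const_mul _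

/-- The quotient is the geometric mean of the two sequences assumed to vanish. -/
lemma tendsto_div_nat_mul {m a : ℕ → ℝ} (hm : ∀ n, 0 ≤ m n) (ha : ∀ n, 0 < a n)
    (h1 : Tendsto (fun n => m n ^ 2 / a n) atTop (𝓝 0))
    (h2 : Tendsto (fun n : ℕ => 1 / ((n : ℝ) ^ 2 * a n)) atTop (𝓝 0)) :
    Tendsto (fun n : ℕ => m n / (n * a n)) atTop (𝓝 0) := by
  have h := (h1.mul h2).sqrt
  rw [mul_zero, Real.sqrt_zero] at h
  refine h.congr fun n => ?_
  have h0 : 0 ≤ m n / (n * a n) := div_nonneg (hm n) (mul_nonneg n.cast_nonneg (ha n).le)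
  rw [← Real.sqrt_sq h0]
  congr 1
  have := (ha n).ne'
  field_simp

lemma sq_div_descFactorial_two_le {n : ℕ} (hn : 3 ≤ n) :
    (n : ℝ) ^ 2 / n.descFactorial 2 ≤ 2 := by
  have h : (3 : ℝ) ≤ n := by exact_mod_cast hn
  rw [div_le_iff₀ (descFactorial_pos (by omega)), Nat.descFactorial_succ, Nat.descFactorial_one,
    Nat.cast_mul, Nat.cast_sub (by omega)]
  push_cast
  nlinarith

lemma sq_div_descFactorial_three_le {n : ℕ} (hn : 3 ≤ n) :
    (n : ℝ) ^ 2 / n.descFactorial 3 ≤ 6 / n := by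
  have h : (3 : ℝ) ≤ n := by exact_mod_cast hn
  rw [div_le_div_iff₀ (descFactorial_pos hn) (by linarith), Nat.descFactorial_succ,
    Nat.descFactorial_succ, Nat.descFactorial_one,
    Nat.cast_mul, Nat.cast_mul, Nat.cast_sub (by omega), Nat.cast_sub (by omega)]
  push_cast
  have h1 : (n : ℝ) ^ 2 ≤ 6 * ((n - 2) * (n - 1)) := by nlinarith
  nlinarith [mul_le_mul_of_nonneg_right h1 (by linarith : (0 : ℝ) ≤ n)]

/-! ### Consistency of the estimates of the marginal moments -/

/-- The estimates of the three marginal moments in the variance formula. -/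
noncomputable def momentStat {E : Type*} (G : E → E → ℝ) {n : ℕ} (x : Fin n → E) : Fin 3 → ℝ :=
  ![uStat n (fun i : Fin 2 → Fin n => G (x (i 0)) (x (i 1)) ^ 2),
    uStat n (fun i : Fin 3 → Fin n => G (x (i 0)) (x (i 1)) * G (x (i 0)) (x (i 2))),
    uStat n (fun i : Fin 4 → Fin n => G (x (i 0)) (x (i 1)) * G (x (i 2)) (x (i 3)))]

lemma momentStat_zero {E : Type*} (G : E → E → ℝ) {n : ℕ} (x : Fin n → E) :
    momentStat G x 0 = uStat n (fun i : Fin 2 → Fin n => G (x (i 0)) (x (i 1)) ^ 2) := rfl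

lemma momentStat_one {E : Type*} (G : E → E → ℝ) {n : ℕ} (x : Fin n → E) :
    momentStat G x 1
      = uStat n (fun i : Fin 3 → Fin n => G (x (i 0)) (x (i 1)) * G (x (i 0)) (x (i 2))) := rfl

lemma momentStat_two {E : Type*} (G : E → E → ℝ) {n : ℕ} (x : Fin n → E) :
    momentStat G x 2
      = uStat n (fun i : Fin 4 → Fin n => G (x (i 0)) (x (i 1)) * G (x (i 2)) (x (i 3))) := rfl

section Column

variable {E Ω : Type*} [MeasurableSpace E] [MeasurableSpace Ω] {P : Measure E}
  [IsProbabilityMeasure P] {μ : Measure Ω} [IsProbabilityMeasure μ] {X : ℕ → Ω → E}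
  {G : ℕ → E → E → ℝ} {m : ℕ → ℝ}

/-- The statistic is nonnegative with mean at most m², so Markov's inequality suffices. The same
argument serves for disjoint pairs. -/
lemma tendstoInMeasure_uStat_path (hX : ∀ i, Measurable (X i)) (hindep : iIndepFun X μ)
    (hlaw : ∀ i, μ.map (X i) = P) (hG : ∀ n, IsUnitKernel (G n))
    (hm : ∀ n x, ∫ z, G n x z ∂P ≤ m n) (ha : ∀ n, 0 < secondMoment P (G n))
    (h1 : Tendsto (fun n => m n ^ 2 / secondMoment P (G n)) atTop (𝓝 0)) :
    TendstoInMeasure μ (fun n ω => (secondMoment P (G n))⁻¹ * uStat n (fun i : Fin 3 → Fin n =>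
      G n (X (i 0) ω) (X (i 1) ω) * G n (X (i 0) ω) (X (i 2) ω))) atTop fun _ => 0 := by
  have hb : ∀ n, IsBddMeas fun ω => uStat n (fun i : Fin 3 → Fin n =>
      G n (X (i 0) ω) (X (i 1) ω) * G n (X (i 0) ω) (X (i 2) ω)) := fun n =>
    (IsBddMeas.sum _ fun i _ => ((hG n).isBddMeas.comp ((hX (i 0)).prodMk (hX (i 1)))).mul
      ((hG n).isBddMeas.comp ((hX (i 0)).prodMk (hX (i 2))))).const_mul _
  have h0 : ∀ n ω, 0 ≤ (secondMoment P (G n))⁻¹ * uStat n (fun i : Fin 3 → Fin n =>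
      G n (X (i 0) ω) (X (i 1) ω) * G n (X (i 0) ω) (X (i 2) ω)) := fun n ω =>
    mul_nonneg (inv_nonneg.2 (ha n).le) (mul_nonneg (by positivity) (Finset.sum_nonneg fun i _ =>
      mul_nonneg ((hG n).nonneg _ _) ((hG n).nonneg _ _)))
  refine tendstoInMeasure_of_integral h0 (fun n => ((hb n).const_mul _).integrable μ) ?_
  refine squeeze_zero' (Eventually.of_forall fun n => integral_nonneg (h0 n)) ?_ h1
  filter_upwards [eventually_ge_atTop 3] with n hn
  rw [integral_const_mul, div_eq_inv_mul, sq]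
  refine mul_le_mul_of_nonneg_left ((integral_uStat_path_le hX hindep hlaw (hG n) (hm n) hn).trans
    (mul_le_mul_of_nonneg_left ((hG n).kernelMean_le (hm n)) ?_)) (inv_nonneg.2 (ha n).le)
  exact (hG n).kernelMean_nonneg.trans ((hG n).kernelMean_le (hm n))

lemma tendstoInMeasure_uStat_disjoint (hX : ∀ i, Measurable (X i)) (hindep : iIndepFun X μ)
    (hlaw : ∀ i, μ.map (X i) = P) (hG : ∀ n, IsUnitKernel (G n))
    (hm : ∀ n x, ∫ z, G n x z ∂P ≤ m n) (ha : ∀ n, 0 < secondMoment P (G n))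
    (h1 : Tendsto (fun n => m n ^ 2 / secondMoment P (G n)) atTop (𝓝 0)) :
    TendstoInMeasure μ (fun n ω => (secondMoment P (G n))⁻¹ * uStat n (fun i : Fin 4 → Fin n =>
      G n (X (i 0) ω) (X (i 1) ω) * G n (X (i 2) ω) (X (i 3) ω))) atTop fun _ => 0 := by
  have hb : ∀ n, IsBddMeas fun ω => uStat n (fun i : Fin 4 → Fin n =>
      G n (X (i 0) ω) (X (i 1) ω) * G n (X (i 2) ω) (X (i 3) ω)) := fun n =>
    (IsBddMeas.sum _ fun i _ => ((hG n).isBddMeas.comp ((hX (i 0)).prodMk (hX (i 1)))).mul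
      ((hG n).isBddMeas.comp ((hX (i 2)).prodMk (hX (i 3))))).const_mul _
  have h0 : ∀ n ω, 0 ≤ (secondMoment P (G n))⁻¹ * uStat n (fun i : Fin 4 → Fin n =>
      G n (X (i 0) ω) (X (i 1) ω) * G n (X (i 2) ω) (X (i 3) ω)) := fun n ω =>
    mul_nonneg (inv_nonneg.2 (ha n).le) (mul_nonneg (by positivity) (Finset.sum_nonneg fun i _ =>
      mul_nonneg ((hG n).nonneg _ _) ((hG n).nonneg _ _)))
  refine tendstoInMeasure_of_integral h0 (fun n => ((hb n).const_mul _).integrable μ) ?_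
  refine squeeze_zero' (Eventually.of_forall fun n => integral_nonneg (h0 n)) ?_ h1
  filter_upwards [eventually_ge_atTop 4] with n hn
  rw [integral_const_mul, div_eq_inv_mul, sq]
  refine mul_le_mul_of_nonneg_left ((integral_uStat_disjoint_le hX hindep hlaw (hG n) (hm n)
    hn).trans (mul_le_mul_of_nonneg_left ((hG n).kernelMean_le (hm n)) ?_))
    (inv_nonneg.2 (ha n).le)
  exact (hG n).kernelMean_nonneg.trans ((hG n).kernelMean_le (hm n))

/-- Chebyshev's inequality: relative to a², the variance is of order m/(na) + 1/(n²a), where a is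
the second moment of G. -/
lemma tendstoInMeasure_uStat_sq (hX : ∀ i, Measurable (X i)) (hindep : iIndepFun X μ)
    (hlaw : ∀ i, μ.map (X i) = P) (hG : ∀ n, IsUnitKernel (G n))
    (hm : ∀ n x, ∫ z, G n x z ∂P ≤ m n) (ha : ∀ n, 0 < secondMoment P (G n))
    (h1 : Tendsto (fun n => m n ^ 2 / secondMoment P (G n)) atTop (𝓝 0))
    (h2 : Tendsto (fun n : ℕ => 1 / ((n : ℝ) ^ 2 * secondMoment P (G n))) atTop (𝓝 0)) :
    TendstoInMeasure μ (fun n ω => (secondMoment P (G n))⁻¹ * uStat n (fun i : Fin 2 → Fin n =>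
      G n (X (i 0) ω) (X (i 1) ω) ^ 2)) atTop fun _ => 1 := by
  have hm0 : ∀ n, 0 ≤ m n := fun n => (hG n).kernelMean_nonneg.trans ((hG n).kernelMean_le (hm n))
  set S : ℕ → Ω → ℝ := fun n ω => uStat n (fun i : Fin 2 → Fin n =>
      G n (X (i 0) ω) (X (i 1) ω) ^ 2) with hS
  have hb : ∀ n, IsBddMeas (S n) := fun n =>
    (IsBddMeas.sum _ fun i _ =>
      ((hG n).isBddMeas.comp ((hX (i 0)).prodMk (hX (i 1)))).pow 2).const_mul _
  have h3 : TendstoInMeasure μ (fun n ω => (secondMoment P (G n))⁻¹ * (S n ω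
      - secondMoment P (G n))) atTop fun _ => 0 := by
    refine tendstoInMeasure_of_integral_sq (fun n => ((((hb n).sub
      (IsBddMeas.const _)).const_mul _).pow 2).integrable μ) ?_
    set c : ℝ := (Fintype.card (Fin 1 ↪ Fin 2) : ℝ) ^ 2 with hc
    set c' : ℝ := (Fintype.card (Fin 2 ↪ Fin 2) : ℝ) ^ 2 with hc'
    have hlim : Tendsto (fun n : ℕ => c * (m n / (n * secondMoment P (G n)))
        + 2 * c' * (1 / ((n : ℝ) ^ 2 * secondMoment P (G n)))) atTop (𝓝 0) := by
      simpa using ((tendsto_div_nat_mul hm0 ha h1 h2).const_mul c).add (h2.const_mul (2 * c'))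
    refine squeeze_zero' (Eventually.of_forall fun n => integral_nonneg fun ω => sq_nonneg _) ?_
      hlim
    filter_upwards [eventually_ge_atTop 3] with n hn
    simp_rw [mul_pow]
    rw [integral_const_mul]
    refine (mul_le_mul_of_nonneg_left (integral_uStat_sq_sub_secondMoment_le hX hindep hlaw (hG n)
      (hm n) (by omega)) (sq_nonneg _)).trans ?_
    have h4 := sq_div_descFactorial_two_le hn
    have ha' := ha n
    set a := secondMoment P (G n)
    have hn0 : (0 : ℝ) < n := by exact_mod_cast (by omega : 0 < n)
    rw [Nat.descFactorial_one, mul_add]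
    refine add_le_add (le_of_eq ?_) ?_
    · rw [← hc]
      field_simp
    · rw [← hc']
      have h5 : a⁻¹ ^ 2 * (a * (c' / n.descFactorial 2))
          = c' * (1 / ((n : ℝ) ^ 2 * a)) * ((n : ℝ) ^ 2 / n.descFactorial 2) := by
        field_simp
      rw [h5]
      have h6 : 0 ≤ c' * (1 / ((n : ℝ) ^ 2 * a)) := by positivity
      nlinarith [mul_le_mul_of_nonneg_left h4 h6]
  have h7 := tendstoInMeasure_comp h3 (F := fun x : ℝ => x + 1)
    (by fun_prop : Continuous fun x : ℝ => x + 1).continuousAt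
  simp only [zero_add] at h7
  convert h7 using 3 with n ω
  have := (ha n).ne'
  field_simp
  ring

lemma tendstoInMeasure_momentStat (hX : ∀ i, Measurable (X i)) (hindep : iIndepFun X μ)
    (hlaw : ∀ i, μ.map (X i) = P) (hG : ∀ n, IsUnitKernel (G n))
    (hm : ∀ n x, ∫ z, G n x z ∂P ≤ m n) (ha : ∀ n, 0 < secondMoment P (G n))
    (h1 : Tendsto (fun n => m n ^ 2 / secondMoment P (G n)) atTop (𝓝 0))
    (h2 : Tendsto (fun n : ℕ => 1 / ((n : ℝ) ^ 2 * secondMoment P (G n))) atTop (𝓝 0))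
    (t : Fin 3) :
    TendstoInMeasure μ (fun n ω => (secondMoment P (G n))⁻¹
      * momentStat (G n) (fun i : Fin n => X i ω) t) atTop
      fun _ => (![1, 0, 0] : Fin 3 → ℝ) t := by
  fin_cases t <;> simp only [Fin.zero_eta, Fin.mk_one, Fin.reduceFinMk, momentStat_zero,
    momentStat_one, momentStat_two, Matrix.cons_val]
  · exact tendstoInMeasure_uStat_sq hX hindep hlaw hG hm ha h1 h2
  · exact tendstoInMeasure_uStat_path hX hindep hlaw hG hm ha h1
  · exact tendstoInMeasure_uStat_disjoint hX hindep hlaw hG hm ha h1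

end Column

/-! ### The studentised statistic for product kernels -/

section Main

variable {k : ℕ} {E : Fin k → Type*} [∀ l, MeasurableSpace (E l)] {Q : ∀ l, Measure (E l)}
  [∀ l, IsProbabilityMeasure (Q l)] {Ω : Type*} [MeasurableSpace Ω] {μ : Measure Ω}
  [IsProbabilityMeasure μ] {X : ℕ → Ω → ∀ l, E l}

/-- The truncated variance estimate for a product kernel. -/
noncomputable def varianceStat (G : ∀ l, E l → E l → ℝ) {n : ℕ} (x : Fin n → ∀ l, E l) : ℝ :=
  max (varianceFormula (fun l => momentStat (G l) (fun i => x i l) 0)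
    (fun l => momentStat (G l) (fun i => x i l) 1) (fun l => momentStat (G l) (fun i => x i l) 2))
    (1 / (n : ℝ) ^ 2)

/-- The second term of the statistic, for a general kernel. -/
noncomputable def productStat (H : (∀ l, E l) → (∀ l, E l) → ℝ) {n : ℕ}
    (x : Fin n → ∀ l, E l) : ℝ :=
  uStat n (fun i : Fin k ⊕ Fin k → Fin n =>
    H (fun j => x (i (Sum.inl j)) j) (fun j => x (i (Sum.inr j)) j))

/-- The third term of the statistic, for a general kernel. -/
noncomputable def crossStat (H : (∀ l, E l) → (∀ l, E l) → ℝ) {n : ℕ}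
    (x : Fin n → ∀ l, E l) : ℝ :=
  uStat n (fun i : Option (Fin k) → Fin n => H (x (i none)) (fun j => x (i (some j)) j))

/-- The studentised statistic for a product kernel. -/
noncomputable def studentStat (G : ∀ l, E l → E l → ℝ) {n : ℕ} (x : Fin n → ∀ l, E l) : ℝ :=
  (n : ℝ) / Real.sqrt 2 * (Real.sqrt (varianceStat G x))⁻¹ *
    (uStat n (fun i : Fin 2 → Fin n => prodKernel G (x (i 0)) (x (i 1)))
      + productStat (prodKernel G) x - 2 * crossStat (prodKernel G) x)

lemma measurable_momentStat (hX : ∀ i, Measurable (X i)) {G : ∀ l, E l → E l → ℝ}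
    (hG : ∀ l, Measurable fun p : E l × E l => G l p.1 p.2) (n : ℕ) (l : Fin k) (t : Fin 3) :
    Measurable fun ω => momentStat (G l) (fun i : Fin n => X i ω l) t := by
  have h : ∀ i j, Measurable fun ω => G l (X i ω l) (X j ω l) := fun i j =>
    (hG l).comp ((measurable_component hX i l).prodMk (measurable_component hX j l))
  fin_cases t
  · exact measurable_uStat (ι := Fin 2) (Y := fun i ω => G l (X (i 0) ω l) (X (i 1) ω l) ^ 2)
      fun i => (h (i 0) (i 1)).pow_const 2
  · exact measurable_uStat (ι := Fin 3)
      (Y := fun i ω => G l (X (i 0) ω l) (X (i 1) ω l) * G l (X (i 0) ω l) (X (i 2) ω l))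
      fun i => (h (i 0) (i 1)).mul (h (i 0) (i 2))
  · exact measurable_uStat (ι := Fin 4)
      (Y := fun i ω => G l (X (i 0) ω l) (X (i 1) ω l) * G l (X (i 2) ω l) (X (i 3) ω l))
      fun i => (h (i 0) (i 1)).mul (h (i 2) (i 3))

lemma measurable_varianceStat (hX : ∀ i, Measurable (X i)) {G : ∀ l, E l → E l → ℝ}
    (hG : ∀ l, Measurable fun p : E l × E l => G l p.1 p.2) (n : ℕ) :
    Measurable fun ω => varianceStat G (fun i : Fin n => X i ω) :=
  (continuous_varianceFormula.measurable.comp (measurable_pi_lambda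
    (fun ω (p : Fin k × Fin 3) => momentStat (G p.1) (fun i : Fin n => X i ω p.1) p.2)
    fun p => measurable_momentStat hX hG n p.1 p.2)).max measurable_const

lemma measurable_productStat (hX : ∀ i, Measurable (X i)) {H : (∀ l, E l) → (∀ l, E l) → ℝ}
    (hH : Measurable fun p : (∀ l, E l) × (∀ l, E l) => H p.1 p.2) (n : ℕ) :
    Measurable fun ω => productStat H (fun i : Fin n => X i ω) :=
  measurable_uStat fun i => hH.comp ((measurable_mixed hX fun l => i (Sum.inl l)).prodMk
    (measurable_mixed hX fun l => i (Sum.inr l)))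

lemma measurable_crossStat (hX : ∀ i, Measurable (X i)) {H : (∀ l, E l) → (∀ l, E l) → ℝ}
    (hH : Measurable fun p : (∀ l, E l) × (∀ l, E l) => H p.1 p.2) (n : ℕ) :
    Measurable fun ω => crossStat H (fun i : Fin n => X i ω) :=
  measurable_uStat fun i => hH.comp ((hX (i none)).prodMk
    (measurable_mixed hX fun l => i (some l)))

lemma measurable_studentStat (hX : ∀ i, Measurable (X i)) {G : ∀ l, E l → E l → ℝ}
    (hG : ∀ l, Measurable fun p : E l × E l => G l p.1 p.2) (n : ℕ) :
    Measurable fun ω => studentStat G (fun i : Fin n => X i ω) := by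
  have hJ := measurable_prodKernel hG
  refine ((measurable_varianceStat hX hG n).sqrt.inv.const_mul _).mul
    (((measurable_uStat fun i => ?_).add (measurable_productStat hX hJ n)).sub
      ((measurable_crossStat hX hJ n).const_mul 2))
  exact hJ.comp ((hX (i 0)).prodMk (hX (i 1)))

end Main

/-! ### Asymptotic normality for product kernels -/

section ProductKernels

variable {k : ℕ} {E : Fin k → Type*} [∀ l, MeasurableSpace (E l)]

/-- Product kernels whose marginal moments satisfy the conditions for asymptotic normality. -/
structure IsAdmissible (Q : ∀ l, Measure (E l)) (G : ℕ → ∀ l, E l → E l → ℝ)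
    (m : ℕ → Fin k → ℝ) : Prop where
  isUnitKernel : ∀ n l, IsUnitKernel (G n l)
  integral_le : ∀ n l x, ∫ z, G n l x z ∂(Q l) ≤ m n l
  secondMoment_pos : ∀ n l, 0 < secondMoment (Q l) (G n l)
  kernelMean_le : ∃ C, ∀ n l, kernelMean (Q l) (G n l) ≤ C * secondMoment (Q l) (G n l)
  tendsto_sq_div : ∀ l, Tendsto (fun n => m n l ^ 2 / secondMoment (Q l) (G n l)) atTop (𝓝 0)
  tendsto_mul_prod : Tendsto (fun n : ℕ => 1 / ((n : ℝ) ^ 2 * ∏ l, secondMoment (Q l) (G n l)))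
    atTop (𝓝 0)

namespace IsAdmissible

variable {Q : ∀ l, Measure (E l)} [∀ l, IsProbabilityMeasure (Q l)]
  {G : ℕ → ∀ l, E l → E l → ℝ} {m : ℕ → Fin k → ℝ}

lemma bound_nonneg (h : IsAdmissible Q G m) (n : ℕ) (l : Fin k) : 0 ≤ m n l :=
  (h.isUnitKernel n l).kernelMean_nonneg.trans
    ((h.isUnitKernel n l).kernelMean_le (h.integral_le n l))

lemma secondMoment_le_one (h : IsAdmissible Q G m) (n : ℕ) (l : Fin k) :
    secondMoment (Q l) (G n l) ≤ 1 := by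
  have hG := h.isUnitKernel n l
  have hb : IsBddMeas fun p : E l × E l => G n l p.1 p.2 ^ 2 := hG.isBddMeas.pow 2
  have h1 : ∀ x, ∫ y, G n l x y ^ 2 ∂(Q l) ≤ 1 := fun x => by
    have := IsBddMeas.integral_mono (IsBddMeas.left (f := fun x y => G n l x y ^ 2) hb x)
      (IsBddMeas.const 1) (Q l) fun y => pow_le_one₀ (hG.nonneg x y) (hG.le_one x y)
    simpa using this
  have := IsBddMeas.integral_mono (IsBddMeas.integral (f := fun x y => G n l x y ^ 2) hb (Q l))
    (IsBddMeas.const 1) (Q l) h1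
  simpa [secondMoment] using this

lemma prod_secondMoment_pos (h : IsAdmissible Q G m) (n : ℕ) :
    0 < ∏ l, secondMoment (Q l) (G n l) := Finset.prod_pos fun l _ => h.secondMoment_pos n l

lemma prod_secondMoment_le (h : IsAdmissible Q G m) (n : ℕ) (l : Fin k) :
    ∏ j, secondMoment (Q j) (G n j) ≤ secondMoment (Q l) (G n l) := by
  rw [← Finset.mul_prod_erase _ _ (Finset.mem_univ l)]
  exact mul_le_of_le_one_right (h.secondMoment_pos n l).le
    (Finset.prod_le_one (fun j _ => (h.secondMoment_pos n j).le)
      fun j _ => h.secondMoment_le_one n j)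

lemma tendsto_mul (h : IsAdmissible Q G m) (l : Fin k) :
    Tendsto (fun n : ℕ => 1 / ((n : ℝ) ^ 2 * secondMoment (Q l) (G n l))) atTop (𝓝 0) := by
  refine squeeze_zero' (Eventually.of_forall fun n => ?_) ?_ h.tendsto_mul_prod
  · have := h.secondMoment_pos n l
    positivity
  · filter_upwards [eventually_gt_atTop 0] with n hn
    have hn' : (0 : ℝ) < n := by exact_mod_cast hn
    have := h.prod_secondMoment_pos n
    exact one_div_le_one_div_of_le (by positivity)
      (mul_le_mul_of_nonneg_left (h.prod_secondMoment_le n l) (by positivity))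

lemma tendsto_prod_sq_div (h : IsAdmissible Q G m) (hk : k ≠ 0) :
    Tendsto (fun n => (∏ l, m n l) ^ 2 / ∏ l, secondMoment (Q l) (G n l)) atTop (𝓝 0) := by
  have := tendsto_finsetProd Finset.univ fun l _ => h.tendsto_sq_div l
  simpa [Finset.prod_div_distrib, Finset.prod_pow, hk] using this

lemma tendsto_prod (h : IsAdmissible Q G m) (hk : k ≠ 0) :
    Tendsto (fun n => ∏ l, m n l) atTop (𝓝 0) := by
  have h1 := (h.tendsto_prod_sq_div hk).sqrt
  rw [Real.sqrt_zero] at h1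
  refine squeeze_zero (fun n => Finset.prod_nonneg fun l _ => h.bound_nonneg n l) (fun n => ?_) h1
  refine Real.le_sqrt_of_sq_le ?_
  rw [le_div_iff₀ (h.prod_secondMoment_pos n)]
  exact mul_le_of_le_one_right (sq_nonneg _) (Finset.prod_le_one
    (fun j _ => (h.secondMoment_pos n j).le) fun j _ => h.secondMoment_le_one n j)

lemma exists_prod_kernelMean_le (h : IsAdmissible Q G m) :
    ∃ C, 0 ≤ C ∧ ∀ n, ∏ l, kernelMean (Q l) (G n l) ≤ C * ∏ l, secondMoment (Q l) (G n l) := by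
  obtain ⟨C, hC⟩ := h.kernelMean_le
  refine ⟨|C| ^ k, by positivity, fun n => ?_⟩
  calc ∏ l, kernelMean (Q l) (G n l) ≤ ∏ l, |C| * secondMoment (Q l) (G n l) :=
        Finset.prod_le_prod (fun l _ => (h.isUnitKernel n l).kernelMean_nonneg) fun l _ =>
          (hC n l).trans (mul_le_mul_of_nonneg_right (le_abs_self C) (h.secondMoment_pos n l).le)
    _ = _ := by
        rw [Finset.prod_mul_distrib]
        simp

/-- Centring changes the second moment by at most twice the product of the m's times the mean of the
product kernel. That mean is at most C times the denominator, so the relative error is at most 2C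
times the product of the m's. -/
lemma tendsto_variance_ratio (h : IsAdmissible Q G m) (hk : k ≠ 0) :
    Tendsto (fun n => secondMoment (Measure.pi Q) (centered (Measure.pi Q) (prodKernel (G n)))
      / ∏ l, secondMoment (Q l) (G n l)) atTop (𝓝 1) := by
  obtain ⟨C, hC0, hC⟩ := h.exists_prod_kernelMean_le
  have hlim : Tendsto (fun n => 2 * C * ∏ l, m n l) atTop (𝓝 0) := by
    simpa using (h.tendsto_prod hk).const_mul (2 * C)
  rw [tendsto_iff_norm_sub_tendsto_zero]
  refine squeeze_zero (fun _ => norm_nonneg _) (fun n => ?_) hlim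
  have hA := h.prod_secondMoment_pos n
  have h1 := (isUnitKernel_prodKernel (h.isUnitKernel n)).abs_secondMoment_centered_sub_le
    (integral_prodKernel_le (h.isUnitKernel n) (h.integral_le n))
  rw [secondMoment_prodKernel, kernelMean_prodKernel] at h1
  rw [div_sub_one hA.ne', Real.norm_eq_abs, abs_div, abs_of_pos hA, div_le_iff₀ hA]
  refine h1.trans ?_
  have h2 := mul_le_mul_of_nonneg_left (hC n)
    (Finset.prod_nonneg fun l _ => h.bound_nonneg n l : 0 ≤ ∏ l, m n l)
  linarith

variable {Ω : Type*} [MeasurableSpace Ω] {μ : Measure Ω}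
  [IsProbabilityMeasure μ] {X : ℕ → Ω → ∀ l, E l}

/-- Let s be the second moment of the centred kernel, A the product of the marginal second moments,
and m the product of the bounds. The three ratios of the central limit theorem are bounded by
4/(n²s), 8m/(ns) and 128 C m²A/s², and s/A → 1. -/
lemma tendstoInDistribution_pairSum (h : IsAdmissible Q G m) (hk : k ≠ 0)
    (hX : ∀ i, Measurable (X i)) (hindep : iIndepFun X μ)
    (hlaw : ∀ i, μ.map (X i) = Measure.pi Q) :
    TendstoInDistribution (fun n ω => Real.sqrt (2 / (n * (n - 1)
      * secondMoment (Measure.pi Q) (centered (Measure.pi Q) (prodKernel (G n)))))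
      * pairSum (centered (Measure.pi Q) (prodKernel (G n))) n fun i => X i ω)
      atTop id (fun _ => μ) (gaussianReal 0 1) := by
  set P := Measure.pi Q with hP
  have hJ := fun n => isUnitKernel_prodKernel (h.isUnitKernel n)
  have hr := h.tendsto_variance_ratio hk
  rw [← hP] at hr
  set A : ℕ → ℝ := fun n => ∏ l, secondMoment (Q l) (G n l) with hA_def
  set s : ℕ → ℝ := fun n => secondMoment P (centered P (prodKernel (G n))) with hs_def
  have hA : ∀ n, 0 < A n := h.prod_secondMoment_pos
  have hs : ∀ᶠ n in atTop, 0 < s n := by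
    filter_upwards [hr.eventually (lt_mem_nhds one_pos)] with n hn
    exact (div_pos_iff_of_pos_right (hA n)).1 hn
  have hinv : Tendsto (fun n => A n / s n) atTop (𝓝 1) := by
    have := hr.inv₀ one_ne_zero
    simpa using this
  have hb := fun n => integral_prodKernel_le (h.isUnitKernel n) (h.integral_le n)
  have hm0 : ∀ n, 0 ≤ ∏ l, m n l := fun n => Finset.prod_nonneg fun l _ => h.bound_nonneg n l
  obtain ⟨C, hC0, hC⟩ := h.exists_prod_kernelMean_le
  refine GaussianDHSIC.tendstoInDistribution_pairSum hX hindep hlaw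
    (fun n => (hJ n).isDegenerate_centered) hs ?_ ?_ ?_
  · have hlim : Tendsto (fun n : ℕ => 4 * (1 / ((n : ℝ) ^ 2 * A n)) * (A n / s n)) atTop (𝓝 0) := by
      simpa using (h.tendsto_mul_prod.const_mul 4).mul hinv
    refine squeeze_zero' (Eventually.of_forall fun n => div_nonneg
      (integral_nonneg fun x => integral_nonneg fun y => by positivity) (by positivity)) ?_ hlim
    filter_upwards [hs, eventually_gt_atTop 0] with n hn hn0
    have hn' : (0 : ℝ) < n := by exact_mod_cast hn0
    have hA' := (hA n).ne'
    rw [div_le_iff₀ (by positivity)]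
    refine (hJ n).fourthMoment_centered_le.trans_eq ?_
    change 4 * s n = _ * (_ * s n ^ 2)
    field_simp
  · have hlim : Tendsto (fun n : ℕ => 8 * ((∏ l, m n l) / (n * A n)) * (A n / s n)) atTop
        (𝓝 0) := by
      simpa using ((tendsto_div_nat_mul hm0 hA (h.tendsto_prod_sq_div hk)
        h.tendsto_mul_prod).const_mul 8).mul hinv
    refine squeeze_zero' (Eventually.of_forall fun n => div_nonneg
      (integral_nonneg fun x => by positivity) (by positivity)) ?_ hlim
    filter_upwards [hs, eventually_gt_atTop 0] with n hn hn0
    have hn' : (0 : ℝ) < n := by exact_mod_cast hn0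
    have hA' := (hA n).ne'
    rw [div_le_iff₀ (by positivity)]
    refine ((hJ n).mixedMoment_centered_le (hb n)).trans_eq ?_
    change 8 * _ * s n = _ * (_ * s n ^ 2)
    field_simp
  · have hlim : Tendsto (fun n : ℕ => 128 * C * ((∏ l, m n l) ^ 2 / A n) * (A n / s n) ^ 2) atTop
        (𝓝 0) := by
      simpa using ((h.tendsto_prod_sq_div hk).const_mul (128 * C)).mul (hinv.pow 2)
    refine squeeze_zero' (Eventually.of_forall fun n => div_nonneg
      (integral_nonneg fun x => integral_nonneg fun y => by positivity) (by positivity)) ?_ hlim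
    filter_upwards [hs] with n hn
    have hA' := hA n
    rw [div_le_iff₀ (by positivity)]
    refine ((hJ n).cycleMoment_centered_le (hb n)).trans ?_
    rw [kernelMean_prodKernel]
    have h1 := mul_le_mul_of_nonneg_left (hC n)
      (by positivity : (0 : ℝ) ≤ 128 * (∏ l, m n l) ^ 2)
    refine h1.trans_eq ?_
    change _ * (C * A n) = _ * s n ^ 2
    field_simp

/-- The assumed bound is of order A(ε/n² + 1/n³), where ε = ∑ m²/a, so after multiplication by n²/A
it is O(ε + 1/n). -/
lemma tendstoInMeasure_of_integral_sq_le (h : IsAdmissible Q G m) {S : ℕ → Ω → ℝ}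
    (hS : ∀ n, IsBddMeas (S n)) {N c c' : ℕ} (hle : ∀ n, N ≤ n → ∫ ω, S n ω ^ 2 ∂μ
      ≤ 16 * ((∑ l, m n l ^ 2 / secondMoment (Q l) (G n l)) * ∏ l, secondMoment (Q l) (G n l))
          * ((c : ℝ) ^ 2 / n.descFactorial 2)
        + 16 * (∏ l, secondMoment (Q l) (G n l)) * ((c' : ℝ) ^ 2 / n.descFactorial 3)) :
    TendstoInMeasure μ (fun n ω => n * (Real.sqrt (∏ l, secondMoment (Q l) (G n l)))⁻¹ * S n ω)
      atTop fun _ => 0 := by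
  refine tendstoInMeasure_of_integral_sq (fun n => (((hS n).const_mul _).pow 2).integrable μ) ?_
  have h1 : Tendsto (fun n => ∑ l, m n l ^ 2 / secondMoment (Q l) (G n l)) atTop (𝓝 0) := by
    simpa using tendsto_finsetSum Finset.univ fun l _ => h.tendsto_sq_div l
  have hlim : Tendsto (fun n : ℕ => 16 * (c : ℝ) ^ 2 * 2
      * (∑ l, m n l ^ 2 / secondMoment (Q l) (G n l)) + 16 * (c' : ℝ) ^ 2 * (6 / n)) atTop
      (𝓝 0) := by
    simpa using (h1.const_mul (16 * (c : ℝ) ^ 2 * 2)).add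
      ((tendsto_const_div_atTop_nhds_zero_nat 6).const_mul (16 * (c' : ℝ) ^ 2))
  refine squeeze_zero' (Eventually.of_forall fun n => integral_nonneg fun ω => sq_nonneg _) ?_ hlim
  filter_upwards [eventually_ge_atTop N, eventually_ge_atTop 3] with n hn hn3
  have hA := h.prod_secondMoment_pos n
  have hε : 0 ≤ ∑ l, m n l ^ 2 / secondMoment (Q l) (G n l) := Finset.sum_nonneg fun l _ =>
    div_nonneg (sq_nonneg _) (h.secondMoment_pos n l).le
  have h2 := hle n hn
  set A := ∏ l, secondMoment (Q l) (G n l)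
  set ε := ∑ l, m n l ^ 2 / secondMoment (Q l) (G n l)
  simp_rw [mul_pow]
  rw [integral_const_mul, inv_pow, Real.sq_sqrt hA.le]
  refine (mul_le_mul_of_nonneg_left h2 (by positivity)).trans ?_
  have h3 := mul_le_mul_of_nonneg_left (sq_div_descFactorial_two_le hn3)
    (by positivity : 0 ≤ 16 * (c : ℝ) ^ 2 * ε)
  have h4 := mul_le_mul_of_nonneg_left (sq_div_descFactorial_three_le hn3)
    (by positivity : 0 ≤ 16 * (c' : ℝ) ^ 2)
  refine le_trans (le_of_eq ?_) (add_le_add (h3.trans_eq ?_) h4)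
  · field_simp
  · ring

lemma mul_kernelMean_le (h : IsAdmissible Q G m) (n : ℕ) (l : Fin k) :
    m n l * kernelMean (Q l) (G n l)
      ≤ (∑ l, m n l ^ 2 / secondMoment (Q l) (G n l)) * secondMoment (Q l) (G n l) := by
  have ha := h.secondMoment_pos n l
  have h1 : m n l ^ 2 / secondMoment (Q l) (G n l)
      ≤ ∑ l, m n l ^ 2 / secondMoment (Q l) (G n l) :=
    Finset.single_le_sum (f := fun l => m n l ^ 2 / secondMoment (Q l) (G n l))
      (fun l _ => div_nonneg (sq_nonneg _) (h.secondMoment_pos n l).le) (Finset.mem_univ l)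
  rw [div_le_iff₀ ha] at h1
  refine le_trans ?_ h1
  rw [sq]
  exact mul_le_mul_of_nonneg_left ((h.isUnitKernel n l).kernelMean_le (h.integral_le n l))
    (h.bound_nonneg n l)

/-- Here k ≥ 2 provides three distinct places among the indices. For k = 1 the pairs could coincide
completely when two indices are shared, and the term would not be negligible. -/
lemma tendstoInMeasure_productStat (h : IsAdmissible Q G m) (hk : 2 ≤ k)
    (hX : ∀ i, Measurable (X i)) (hindep : iIndepFun X μ)
    (hlaw : ∀ i, μ.map (X i) = Measure.pi Q) :
    TendstoInMeasure μ (fun n ω => n * (Real.sqrt (∏ l, secondMoment (Q l) (G n l)))⁻¹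
      * productStat (centered (Measure.pi Q) (prodKernel (G n))) (fun i : Fin n => X i ω))
      atTop fun _ => 0 := by
  unfold productStat
  refine h.tendstoInMeasure_of_integral_sq_le (N := 2 * k)
    (c := Fintype.card (Fin 2 ↪ Fin k ⊕ Fin k)) (c' := Fintype.card (Fin 3 ↪ Fin k ⊕ Fin k))
    (fun n => isBddMeas_uStat fun i =>
      (isUnitKernel_prodKernel (h.isUnitKernel n)).centered_isBddMeas.comp
        ((measurable_mixed hX fun l => i (Sum.inl l)).prodMk
          (measurable_mixed hX fun l => i (Sum.inr l)))) fun n hn => ?_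
  refine integral_uStat_centered_sq_le hX hindep hlaw (h.isUnitKernel n) (h.integral_le n)
    (Finset.sum_nonneg fun l _ => div_nonneg (sq_nonneg _) (h.secondMoment_pos n l).le)
    (h.mul_kernelMean_le n) (α := Sum.inl) (β := Sum.inr) (fun _ _ => Sum.inl_ne_inr)
    (v := ⟨![Sum.inl ⟨0, by omega⟩, Sum.inl ⟨1, by omega⟩, Sum.inr ⟨0, by omega⟩], ?_⟩) ?_
    (by simp; omega) (by omega)
  · intro s t
    fin_cases s <;> fin_cases t <;> simp
  · intro s
    fin_cases s
    exacts [Or.inl ⟨_, rfl⟩, Or.inl ⟨_, rfl⟩, Or.inr ⟨_, rfl⟩]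

lemma tendstoInMeasure_crossStat (h : IsAdmissible Q G m) (hk : 2 ≤ k)
    (hX : ∀ i, Measurable (X i)) (hindep : iIndepFun X μ)
    (hlaw : ∀ i, μ.map (X i) = Measure.pi Q) :
    TendstoInMeasure μ (fun n ω => n * (Real.sqrt (∏ l, secondMoment (Q l) (G n l)))⁻¹
      * crossStat (centered (Measure.pi Q) (prodKernel (G n))) (fun i : Fin n => X i ω))
      atTop fun _ => 0 := by
  unfold crossStat
  refine h.tendstoInMeasure_of_integral_sq_le (N := 2 * k)
    (c := Fintype.card (Fin 2 ↪ Option (Fin k))) (c' := Fintype.card (Fin 3 ↪ Option (Fin k)))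
    (fun n => isBddMeas_uStat fun i =>
      (isUnitKernel_prodKernel (h.isUnitKernel n)).centered_isBddMeas.comp
        ((hX (i none)).prodMk (measurable_mixed hX fun l => i (some l)))) fun n hn => ?_
  refine integral_uStat_centered_sq_le hX hindep hlaw (h.isUnitKernel n) (h.integral_le n)
    (Finset.sum_nonneg fun l _ => div_nonneg (sq_nonneg _) (h.secondMoment_pos n l).le)
    (h.mul_kernelMean_le n) (α := fun _ => none) (β := some)
    (fun _ l => (Option.some_ne_none l).symm)
    (v := ⟨![none, some ⟨0, by omega⟩, some ⟨1, by omega⟩], ?_⟩) ?_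
    (by simp; omega) (by omega)
  · intro s t
    fin_cases s <;> fin_cases t <;> simp
  · intro s
    fin_cases s
    exacts [Or.inl ⟨⟨0, by omega⟩, rfl⟩, Or.inr ⟨_, rfl⟩, Or.inr ⟨_, rfl⟩]

/-- Consistency of the variance estimate. -/
lemma tendstoInMeasure_varianceStat (h : IsAdmissible Q G m) (hk : 2 ≤ k)
    (hX : ∀ i, Measurable (X i)) (hindep : iIndepFun X μ)
    (hlaw : ∀ i, μ.map (X i) = Measure.pi Q) :
    TendstoInMeasure μ (fun n ω => (Real.sqrt (varianceStat (G n) (fun i : Fin n => X i ω)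
      / ∏ l, secondMoment (Q l) (G n l)))⁻¹) atTop fun _ => 1 := by
  -- The coordinate `none` carries the truncation level. By homogeneity, dividing the truncated
  -- estimate by A divides each triple of moments by its a and turns 1/n² into 1/(n²A), which tends
  -- to 0. It remains to use continuity at the limit point.
  let F : (Option (Fin k × Fin 3) → ℝ) → ℝ := fun p => max (varianceFormula
    (fun l => p (some (l, 0))) (fun l => p (some (l, 1))) (fun l => p (some (l, 2)))) (p none)
  have hF : Continuous F := (continuous_varianceFormula.comp
    (by fun_prop : Continuous fun (p : Option (Fin k × Fin 3) → ℝ) q => p (some q))).max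
      (continuous_apply none)
  let c : Option (Fin k × Fin 3) → ℝ := fun q => q.elim 0 fun q => ![1, 0, 0] q.2
  have hFc : F c = 1 := by
    have := varianceFormula_one_zero_zero hk
    simp only [F, c, Option.elim, Matrix.cons_val]
    rw [this]
    simp
  let p : ℕ → Ω → Option (Fin k × Fin 3) → ℝ := fun n ω q => q.elim
    (1 / ((n : ℝ) ^ 2 * ∏ l, secondMoment (Q l) (G n l)))
    fun q => (secondMoment (Q q.1) (G n q.1))⁻¹
      * momentStat (G n q.1) (fun i : Fin n => X i ω q.1) q.2
  have hp : TendstoInMeasure μ p atTop fun _ => c := by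
    refine tendstoInMeasure_pi fun q => ?_
    rcases q with _ | ⟨l, t⟩
    · exact tendstoInMeasure_of_tendsto h.tendsto_mul_prod
    · exact tendstoInMeasure_momentStat (fun i => measurable_component hX i l)
        (iIndepFun_column hindep l) (fun i => map_component hX hlaw i l)
        (fun n => h.isUnitKernel n l) (fun n => h.integral_le n l)
        (fun n => h.secondMoment_pos n l) (h.tendsto_sq_div l) (h.tendsto_mul l) t
  have hcont : ContinuousAt (fun p => (Real.sqrt (F p))⁻¹) c :=
    hF.sqrt.continuousAt.inv₀ (by simp [hFc])
  have h1 := tendstoInMeasure_comp hp hcont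
  rw [hFc] at h1
  simp only [Real.sqrt_one, inv_one] at h1
  convert h1 using 5 with n ω
  have hA := h.prod_secondMoment_pos n
  have h2 := varianceFormula_mul (fun l => (secondMoment (Q l) (G n l))⁻¹)
    (fun l => momentStat (G n l) (fun i : Fin n => X i ω l) 0)
    (fun l => momentStat (G n l) (fun i : Fin n => X i ω l) 1)
    (fun l => momentStat (G n l) (fun i : Fin n => X i ω l) 2)
  simp only [varianceStat, F, p, Option.elim]
  rw [h2, ← max_div_div_right hA.le, Finset.prod_inv_distrib, div_eq_inv_mul, div_div]

/-- Slutsky's theorem. The statistic is a continuous function of the normalised main term and of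
four quantities that converge in probability to constants: the variance ratio, a deterministic
normalisation, and the two negligible U-statistics. -/
lemma tendstoInDistribution_studentStat (h : IsAdmissible Q G m) (hk : 2 ≤ k)
    (hX : ∀ i, Measurable (X i)) (hindep : iIndepFun X μ)
    (hlaw : ∀ i, μ.map (X i) = Measure.pi Q) :
    TendstoInDistribution (fun n ω => studentStat (G n) (fun i : Fin n => X i ω)) atTop
      (id : ℝ → ℝ) (fun _ => μ) (gaussianReal 0 1) := by
  have hk0 : k ≠ 0 := by omega
  have hJ := fun n => isUnitKernel_prodKernel (h.isUnitKernel n)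
  have hH := fun n => ((hJ n).centered_isBddMeas (P := Measure.pi Q)).measurable
  have hZ := h.tendstoInDistribution_pairSum hk0 hX hindep hlaw
  have hr := h.tendsto_variance_ratio hk0
  set P := Measure.pi Q with hP
  set A : ℕ → ℝ := fun n => ∏ l, secondMoment (Q l) (G n l) with hA_def
  have hA : ∀ n, 0 < A n := h.prod_secondMoment_pos
  set s : ℕ → ℝ := fun n => secondMoment P (centered P (prodKernel (G n))) with hs_def
  have hs : ∀ᶠ n in atTop, 0 < s n := by
    filter_upwards [hr.eventually (lt_mem_nhds one_pos)] with n hn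
    exact (div_pos_iff_of_pos_right (hA n)).1 hn
  have hd : Tendsto (fun n : ℕ => Real.sqrt (n / ((n : ℝ) - 1)) * Real.sqrt (s n / A n)) atTop
      (𝓝 1) := by
    have h1 : Tendsto (fun n : ℕ => (n : ℝ) / ((n : ℝ) - 1)) atTop (𝓝 1) := by
      have := tendsto_natCast_div_add_atTop (𝕜 := ℝ) (-1)
      simpa [sub_eq_add_neg] using this
    simpa using h1.sqrt.mul hr.sqrt
  let Y : ℕ → Ω → Fin 4 → ℝ := fun n ω => ![
    (Real.sqrt (varianceStat (G n) (fun i : Fin n => X i ω) / A n))⁻¹,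
    Real.sqrt (n / ((n : ℝ) - 1)) * Real.sqrt (s n / A n),
    n * (Real.sqrt (A n))⁻¹ * productStat (centered P (prodKernel (G n))) (fun i : Fin n => X i ω),
    n * (Real.sqrt (A n))⁻¹ * crossStat (centered P (prodKernel (G n))) (fun i : Fin n => X i ω)]
  have hY : TendstoInMeasure μ Y atTop fun _ => ![1, 1, 0, 0] := by
    refine tendstoInMeasure_pi fun j => ?_
    fin_cases j
    · exact h.tendstoInMeasure_varianceStat hk hX hindep hlaw
    · exact tendstoInMeasure_of_tendsto hd
    · exact h.tendstoInMeasure_productStat hk hX hindep hlaw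
    · exact h.tendstoInMeasure_crossStat hk hX hindep hlaw
  have hYm : ∀ n, AEMeasurable (Y n) μ := fun n => by
    refine (measurable_pi_lambda _ fun j => ?_).aemeasurable
    fin_cases j
    · exact ((measurable_varianceStat hX (fun l => (h.isUnitKernel n l).measurable) n).div_const
      _).sqrt.inv
    · exact measurable_const
    · exact (measurable_productStat hX (hH n) n).const_mul _
    · exact (measurable_crossStat hX (hH n) n).const_mul _
  -- At the limit (1, 1, 0, 0) of the second argument, this map is the identity in the first.
  have hcont : Continuous fun p : ℝ × (Fin 4 → ℝ) =>
      p.2 0 * (p.2 1 * p.1 + (p.2 2 - 2 * p.2 3) / Real.sqrt 2) := by fun_prop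
  have hmain := hZ.continuous_comp_prodMk_of_tendstoInMeasure_const hcont hY hYm
  simp only [Matrix.cons_val, one_mul, mul_zero, sub_zero, zero_div, add_zero] at hmain
  refine tendstoInDistribution_congr_eventually hmain
    (fun n => (measurable_studentStat hX
      (fun l => (h.isUnitKernel n l).measurable) n).aemeasurable) ?_
  filter_upwards [hs, eventually_ge_atTop (2 * k)] with n hsn hn
  funext ω
  have hn1 : (1 : ℝ) < n := by exact_mod_cast (by omega : 1 < n)
  have hdec := uStat_sub_eq_centered hk P (prodKernel (G n)) hn fun i : Fin n => X i ω
  have htwo := uStat_two_eq (h := centered P (prodKernel (G n)))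
    (hJ n).isDegenerate_centered.symm (by omega : 2 ≤ n) fun i => X i ω
  rw [htwo] at hdec
  simp only [studentStat, productStat, crossStat, Y, Matrix.cons_val] at hdec ⊢
  rw [hdec]
  have hv : 0 < varianceStat (G n) fun i : Fin n => X i ω :=
    lt_max_of_lt_right (by positivity)
  -- The deterministic factor converts the normalisation by the exact second moment s and n(n-1)
  -- into the one by A and n - 1 that results from the definition of the statistic. This needs s >
  -- 0, hence the identity holds only eventually.
  have h2 : Real.sqrt (n / ((n : ℝ) - 1)) * Real.sqrt (s n / A n)
      * Real.sqrt (2 / (n * (n - 1) * s n)) = Real.sqrt 2 / ((n - 1) * Real.sqrt (A n)) := by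
    have hn2 : (0 : ℝ) < n - 1 := by linarith
    have hAn := hA n
    rw [← Real.sqrt_mul (by positivity), ← Real.sqrt_mul (by positivity)]
    have h3 : (n : ℝ) / (n - 1) * (s n / A n) * (2 / (n * (n - 1) * s n))
        = 2 / ((n - 1) ^ 2 * A n) := by
      field_simp
    rw [h3, Real.sqrt_div (by positivity), Real.sqrt_mul (by positivity), Real.sqrt_sq hn2.le]
  rw [← mul_assoc _ (Real.sqrt (2 / _)), h2, Real.sqrt_div hv.le]
  have h4 : Real.sqrt 2 ^ 2 = 2 := Real.sq_sqrt (by norm_num)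
  have h5 : Real.sqrt 2 ≠ 0 := by positivity
  have h6 : Real.sqrt (A n) ≠ 0 := (Real.sqrt_pos.2 (hA n)).ne'
  have h7 := (Real.sqrt_pos.2 hv).ne'
  have h8 : (n : ℝ) - 1 ≠ 0 := by linarith
  have h9 : (n : ℝ) ≠ 0 := by linarith
  generalize Real.sqrt 2 = r at *
  field_simp
  rw [h4]
  ring

end IsAdmissible

end ProductKernels

/-! ### Gaussian kernels -/

lemma isUnitKernel_gauss {m : ℕ} {ν : ℝ} (hν : 0 ≤ ν) :
    IsUnitKernel (gauss ν : EuclideanSpace ℝ (Fin m) → EuclideanSpace ℝ (Fin m) → ℝ) where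
  measurable := (isBddMeas_gauss hν).measurable
  symm := gauss_comm ν
  nonneg := gauss_nonneg ν
  le_one := gauss_le_one hν

/-- The squared Euclidean norm is additive over the components. -/
lemma gaussJoint_eq_prodKernel {k : ℕ} {d : Fin k → ℕ} (ν : ℝ) :
    (gaussJoint ν : Obs d → Obs d → ℝ) = prodKernel fun _ => gauss ν := by
  funext x y
  simp only [gaussJoint, prodKernel, gauss, ← Real.exp_sum]
  rw [PiLp.norm_sq_eq_of_L2, Finset.mul_sum]
  rfl

lemma tStat_eq_studentStat {k n : ℕ} {d : Fin k → ℕ} (ν : ℝ) (x : Fin n → Obs d) :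
    tStat ν x = studentStat (fun _ => gauss ν) x := by
  simp only [tStat, studentStat, sHatSq, varianceStat, sTildeSq, gammaSqHat, productStat,
    crossStat, gaussJoint_eq_prodKernel, momentStat_zero, momentStat_one, momentStat_two,
    gauss_sq]
  rfl

/-- The moments of the Gaussian kernel with respect to a distribution with square integrable
characteristic function. -/
lemma exists_gauss_moment_bounds {m : ℕ} (hm : 1 ≤ m) {Q : Measure (EuclideanSpace ℝ (Fin m))}
    [IsProbabilityMeasure Q]
    (hQ : Integrable fun w : EuclideanSpace ℝ (Fin m) => ‖charFun Q w‖ ^ 2) :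
    ∃ (c K : ℝ) (b : ℝ → ℝ), 0 < c ∧ (∀ ν, 1 ≤ ν → ∀ x, ∫ y, gauss ν x y ∂Q ≤ b ν) ∧
      (∀ ν, 1 ≤ ν → c ≤ ν ^ ((m : ℝ) / 2) * secondMoment Q (gauss ν)) ∧
      (∀ ν, 1 ≤ ν → kernelMean Q (gauss ν) ≤ K * secondMoment Q (gauss ν)) ∧
      Tendsto (fun ν => b ν ^ 2 / secondMoment Q (gauss ν)) atTop (𝓝 0) := by
  obtain ⟨c, C, hc, hC, h⟩ := exists_bounds_integral_gauss hQ
  obtain ⟨b, hb, hlim⟩ := exists_bound_integral_gauss hm hQ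
  have hr : (0 : ℝ) < 2 ^ ((m : ℝ) / 2) := by positivity
  set r : ℝ := 2 ^ ((m : ℝ) / 2) with hr_def
  have ha : ∀ ν : ℝ, 1 ≤ ν → c / r ≤ ν ^ ((m : ℝ) / 2) * secondMoment Q (gauss ν) := by
    intro ν hν
    -- The square of the kernel with parameter ν is the kernel with parameter 2ν, so the second
    -- moment is a mean at 2ν; this is the origin of the factor r.
    have h1 := (h (2 * ν) (by linarith)).1
    rw [Real.mul_rpow zero_le_two (by linarith), mul_assoc] at h1
    rw [div_le_iff₀' hr]
    simpa only [secondMoment, gauss_sq] using h1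
  have hpos : ∀ ν : ℝ, 1 ≤ ν → 0 < secondMoment Q (gauss ν) := fun ν hν => by
    have h1 : 0 < ν ^ ((m : ℝ) / 2) := Real.rpow_pos_of_pos (by linarith) _
    exact (pos_iff_pos_of_mul_pos ((div_pos hc hr).trans_le (ha ν hν))).1 h1
  refine ⟨c / r, C / (c / r), b, div_pos hc hr, fun ν hν => hb ν (by linarith), ha,
    fun ν hν => ?_, ?_⟩
  · have h1 : 0 < ν ^ ((m : ℝ) / 2) := Real.rpow_pos_of_pos (by linarith) _
    have h2 : ν ^ ((m : ℝ) / 2) * kernelMean Q (gauss ν) ≤ C := (h ν hν).2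
    have h3 := mul_le_mul_of_nonneg_left (ha ν hν) (div_pos hC (div_pos hc hr)).le
    rw [div_mul_cancel₀ _ (div_pos hc hr).ne'] at h3
    have h4 := h2.trans h3
    rw [mul_left_comm] at h4
    exact le_of_mul_le_mul_left h4 h1
  · have hlim2 : Tendsto (fun ν => (ν ^ ((m : ℝ) / 4) * b ν) ^ 2 / (c / r)) atTop (𝓝 0) := by
      simpa using (hlim.pow 2).div_const (c / r)
    refine squeeze_zero' ?_ ?_ hlim2
    · filter_upwards [eventually_ge_atTop 1] with ν hν
      exact div_nonneg (sq_nonneg _) (hpos ν hν).le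
    · filter_upwards [eventually_ge_atTop 1] with ν hν
      have h1 : 0 < ν ^ ((m : ℝ) / 4) := Real.rpow_pos_of_pos (by linarith) _
      have h2 : ν ^ ((m : ℝ) / 2) = (ν ^ ((m : ℝ) / 4)) ^ 2 := by
        rw [← Real.rpow_natCast, ← Real.rpow_mul (by linarith)]
        congr 1
        push_cast
        ring
      have h3 := ha ν hν
      rw [h2] at h3
      rw [div_le_div_iff₀ (hpos ν hν) (div_pos hc hr), mul_pow]
      nlinarith [mul_le_mul_of_nonneg_left h3 (sq_nonneg (b ν))]

/-- The growth condition enters only through the last requirement. The product of the marginal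
second moments is at least a constant times ν^{-d/2}, so its reciprocal over n² is at most a
constant times (ν / n^{4/d})^{d/2}. -/
lemma isAdmissible_gauss {k : ℕ} (hk : k ≠ 0) {d : Fin k → ℕ} (hd : ∀ j, 1 ≤ d j)
    {Q : ∀ j, Measure (EuclideanSpace ℝ (Fin (d j)))} [∀ j, IsProbabilityMeasure (Q j)]
    (hQ : ∀ j, Integrable fun w : EuclideanSpace ℝ (Fin (d j)) => ‖charFun (Q j) w‖ ^ 2)
    {ν : ℕ → ℝ} (hν1 : ∀ n, 1 ≤ ν n) (hν : Tendsto ν atTop atTop)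
    (hνo : ν =o[atTop] fun n : ℕ => (n : ℝ) ^ (4 / ((∑ j, d j : ℕ) : ℝ))) :
    ∃ m, IsAdmissible Q (fun n _ => gauss (ν n)) m := by
  choose c K b hc hb ha hK hlim using fun j => exists_gauss_moment_bounds (hd j) (hQ j)
  have hpos : ∀ n j, 0 < secondMoment (Q j) (gauss (ν n)) := fun n j => by
    have h1 : 0 < ν n ^ ((d j : ℝ) / 2) := Real.rpow_pos_of_pos (by linarith [hν1 n]) _
    exact (pos_iff_pos_of_mul_pos ((hc j).trans_le (ha j _ (hν1 n)))).1 h1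
  refine ⟨fun n j => b j (ν n), ⟨fun n l => isUnitKernel_gauss (by linarith [hν1 n]),
    fun n l => hb l _ (hν1 n), hpos, ⟨∑ j, |K j|, fun n l => (hK l _ (hν1 n)).trans
      (mul_le_mul_of_nonneg_right ((le_abs_self _).trans
        (Finset.single_le_sum (f := fun j => |K j|) (fun j _ => abs_nonneg _) (Finset.mem_univ l)))
        (hpos n l).le)⟩, fun l => (hlim l).comp hν, ?_⟩⟩
  set D : ℝ := ((∑ j, d j : ℕ) : ℝ) with hD
  have hD0 : 0 < D := by
    have : 0 < ∑ j, d j := by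
      have : Nonempty (Fin k) := ⟨⟨0, Nat.pos_of_ne_zero hk⟩⟩
      exact Finset.sum_pos (fun j _ => hd j) Finset.univ_nonempty
    rw [hD]
    exact_mod_cast this
  have hprod : ∀ n, ∏ j, c j ≤ ν n ^ (D / 2) * ∏ j, secondMoment (Q j) (gauss (ν n)) := fun n => by
    have h1 : ν n ^ (D / 2) = ∏ j, ν n ^ ((d j : ℝ) / 2) := by
      rw [← Real.rpow_sum_of_pos (by linarith [hν1 n]), ← Finset.sum_div, hD]
      push_cast
      rfl
    rw [h1, ← Finset.prod_mul_distrib]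
    exact Finset.prod_le_prod (fun j _ => (hc j).le) fun j _ => ha j _ (hν1 n)
  have hc0 : 0 < ∏ j, c j := Finset.prod_pos fun j _ => hc j
  have h2 : Tendsto (fun n : ℕ => (ν n / (n : ℝ) ^ (4 / D)) ^ (D / 2) * (∏ j, c j)⁻¹) atTop
      (𝓝 0) := by
    have h3 := hνo.tendsto_div_nhds_zero.rpow_const (p := D / 2) (Or.inr (by positivity))
    rw [Real.zero_rpow (by positivity)] at h3
    simpa using h3.mul_const (∏ j, c j)⁻¹
  refine squeeze_zero' (Eventually.of_forall fun n => ?_) ?_ h2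
  · have := Finset.prod_pos fun j (_ : j ∈ Finset.univ) => hpos n j
    positivity
  · filter_upwards [eventually_gt_atTop 0] with n hn
    have hn' : (0 : ℝ) < n := by exact_mod_cast hn
    have hν0 : 0 < ν n := by linarith [hν1 n]
    have hA := Finset.prod_pos fun j (_ : j ∈ Finset.univ) => hpos n j
    have h4 : ((n : ℝ) ^ (4 / D)) ^ (D / 2) = (n : ℝ) ^ 2 := by
      rw [← Real.rpow_mul hn'.le, ← Real.rpow_natCast]
      congr 1
      push_cast
      field_simp
      norm_num
    rw [Real.div_rpow hν0.le (by positivity), h4, ← div_eq_mul_inv, div_div,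
      div_le_div_iff₀ (by positivity) (by positivity), one_mul]
    calc (n : ℝ) ^ 2 * ∏ j, c j
        ≤ (n : ℝ) ^ 2 * (ν n ^ (D / 2) * ∏ j, secondMoment (Q j) (gauss (ν n))) :=
          mul_le_mul_of_nonneg_left (hprod n) (by positivity)
      _ = _ := by ring

end GaussianDHSIC

/-! ### Conclusion for Gaussian kernels -/

theorem theorem6 {k : ℕ} (hk : 2 ≤ k) (d : Fin k → ℕ) (hd : ∀ j, 1 ≤ d j)
    (s : ℝ) (hs : 0 ≤ s) (M : Fin k → ℝ)
    {Ω : Type*} [MeasurableSpace Ω] (μ : Measure Ω) [IsProbabilityMeasure μ]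
    (X : ℕ → Ω → GaussianDHSIC.Obs d) (hX : ∀ i, Measurable (X i)) (hindep : iIndepFun X μ)
    (P : Measure (GaussianDHSIC.Obs d)) (hlaw : ∀ i, μ.map (X i) = P)
    (hnull : GaussianDHSIC.NullHypothesis s M P)
    (ν : ℕ → ℝ) (hν : Tendsto ν atTop atTop)
    (hνo : ν =o[atTop] fun n : ℕ => (n : ℝ) ^ (4 / ((∑ j, d j : ℕ) : ℝ))) :
    TendstoInDistribution
      (fun (n : ℕ) (ω : Ω) => GaussianDHSIC.tStat (ν n) (fun i : Fin n => X i ω))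
      atTop (id : ℝ → ℝ) (fun _ => μ) (gaussianReal 0 1) := by
  have hP : IsProbabilityMeasure P := hlaw 0 ▸
    Measure.isProbabilityMeasure_map (hX 0).aemeasurable
  have hQ : ∀ j, IsProbabilityMeasure (GaussianDHSIC.marginal P j) := fun j =>
    Measure.isProbabilityMeasure_map (measurable_pi_apply j).aemeasurable
  have hint : ∀ j, Integrable fun w => ‖charFun (GaussianDHSIC.marginal P j) w‖ ^ 2 := fun j => by
    obtain ⟨p, hp, hpM⟩ := hnull.exists_density j
    exact GaussianDHSIC.integrable_norm_charFun_sq hs hp hpM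
  -- Admissibility is a condition on every n and needs ν ≥ 1. Truncating ν from below at 1 alters
  -- only finitely many terms, which does not affect the limit.
  have heq : (fun n => max (ν n) 1) =ᶠ[atTop] ν := by
    filter_upwards [hν.eventually_ge_atTop 1] with n hn
    exact max_eq_left hn
  obtain ⟨m, hm⟩ := GaussianDHSIC.isAdmissible_gauss (by omega) hd hint
    (fun n => le_max_right (ν n) 1) (hν.congr' heq.symm) (hνo.congr' heq.symm EventuallyEq.rfl)
  have hmain := hm.tendstoInDistribution_studentStat hk hX hindep fun i =>
    (hlaw i).trans hnull.eq_pi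
  simp_rw [← GaussianDHSIC.tStat_eq_studentStat] at hmain
  refine GaussianDHSIC.tendstoInDistribution_congr_eventually hmain (fun n => ?_) ?_
  · simp_rw [GaussianDHSIC.tStat_eq_studentStat]
    exact (GaussianDHSIC.measurable_studentStat hX
      (fun l => by unfold GaussianDHSIC.gauss; fun_prop) n).aemeasurable
  · filter_upwards [heq] with n hn
    rw [hn]
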